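/- Let $X$ be a smooth connected compact complex curve, $\omega$ a nonzero meromorphic differential on $X$, and $S$ a finite set of points of $X$ containing all zeros and poles of $\omega$. Choose a local coordinate $z_s$ at each $s\in S$, let $\mathcal K_s=\mathbb C((z_s))$ be the local field at $s$ and $\mathcal K=\bigoplus_{s\in S}\mathcal K_s$, with the pairing $\langle f,g\rangle=\sum_{s\in S}\operatorname{res}_s(fg\,\omega)$ and the derivation $\partial f=df/\omega$. Let $R\subset\mathcal K$ be the ring of Laurent expansions at the points of $S$ of the meromorphic functions on $X$ that are regular outside $S$, and let $\Lambda$ be an isotropic complement of $R$ in $\mathcal K$, commensurable with $\bigoplus_{s\in S}\mathbb C[[z_s]]$. Let $(e^i)_{i\ge0}$, $(e_i)_{i\ge0}$ be dual bases of $R$ and $\Lambda$, normalized by $\langle e^i,e_j\rangle=-\delta_{ij}$, with $e_i\to0$, and put $$G=\sum_i e^i\otimes e_i,\qquad \gamma=(\partial\otimes1)G-G^2 .$$ (With this normalization $G(z,w)$ behaves like $-(\partial z)/(z-w)$ near the diagonal, so that $\gamma$ is regular there.) Let $\gamma_0,\gamma_1,\dots$ be free variables, $D=\sum_i\gamma_{i+1}\,\partial/\partial\gamma_i$,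 and let $\psi,\phi_0\in\hbar\,\mathbb C[\gamma_0,\gamma_1,\dots][[\hbar]]$ be the solutions of $$\frac{\partial\psi}{\partial\hbar}=D\psi-1-\gamma_0\psi^2,\qquad \frac{\partial\phi_0}{\partial\hbar}=D\phi_0-\gamma_0\psi .$$ Substitute $\gamma_i=(\partial^i\otimes1)\gamma$ and set $\psi_\pm=\psi(\pm\hbar)$ and $\phi=\frac1{2\hbar}\left(\phi_0(\hbar)-\phi_0(-\hbar)\right)$. Let $T=\frac{\sinh(\hbar\partial)}{\hbar\partial}$, let $\tau\in(R\otimes R)[[\hbar]]$ be any element with $\tau+\tau^{(21)}=\sum_i\left(Te^i\otimes e_i-e^i\otimes Te_i\right)$, where $^{(21)}$ exchanges the two factors, and, with $q=e^{\hbar}$, define the structure function $$q(z,w)=q^{2(\tau-\phi)}\,\frac{1+\psi_+G}{1+\psi_-G}(z,w).$$ Then $q(z,w)$ vanishes on $z=q^{-\partial}w$, and its inverse $q(z,w)^{-1}$ vanishes on $z=q^{\partial}w$. Here, for $c=\pm1$, vanishing of $Q(z,w)$ on $z=q^{c\partial}w$ means the following. For every $s\in S$, the component of $Q$ at $(s,s)$,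 which lies in $\mathbb C((z_s))((w_s))[[\hbar]]$, can be written as $N/D$ with $N,D\in\mathbb C((z_s,w_s))[[\hbar]]$, where $\mathbb C((z,w))=\mathbb C[[z,w]][z^{-1},w^{-1}]$; and under the substitution $f(z,w)\mapsto f(q^{c\partial}w,w)=\sum_{k\ge0}\frac{(c\hbar)^k}{k!}\left((\partial^k\otimes1)f\right)(w,w)\in\mathbb C((w_s))[[\hbar]]$ the denominator $D$ becomes nonzero (hence invertible in $\mathbb C((w_s))((\hbar))$) while the numerator $N$ becomes $0$. -/

import Mathlib

open Filter Topology
open scoped Manifold TensorProduct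

noncomputable section

namespace CurveKernel

/-- The field `k((t))`. -/
abbrev Laurent (k : Type*) [Field k] := LaurentSeries k

/-! ### Meromorphic differentials and Laurent expansions on a complex curve -/

section Curve

variable {X : Type*} [TopologicalSpace X] [ChartedSpace ℂ X]

/-- A differential on `X`: a cotangent vector at every point. The values at isolated points such
as poles carry no information; only the germs at punctured neighbourhoods are used. -/
abbrev Differential (X : Type*) [TopologicalSpace X] [ChartedSpace ℂ X] :=
  (x : X) → (TangentSpace 𝓘(ℂ, ℂ) x →L[ℂ] ℂ)

/-- The function `h` such that `om = h(z) dz` in the coordinate `e`. -/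
def localDensity (om : Differential X) (e : OpenPartialHomeomorph X ℂ) (z : ℂ) : ℂ :=
  om (e.symm z) (mfderiv 𝓘(ℂ, ℂ) 𝓘(ℂ, ℂ) e.symm z (1 : ℂ))

/-- `om` is meromorphic at every point. -/
def IsMeromorphicDifferential (om : Differential X) : Prop :=
  ∀ x : X, MeromorphicAt (localDensity om (chartAt ℂ x)) (chartAt ℂ x x)

/-- The order of `om` at `x`: positive at zeros, negative at poles, `⊤` if `om` vanishes
identically near `x`. -/
def diffOrder (om : Differential X) (x : X) : WithTop ℤ :=
  meromorphicOrderAt (localDensity om (chartAt ℂ x)) (chartAt ℂ x x)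

/-- `f(t) = ∑ aₙ tⁿ` for all small nonzero `t`. -/
def HasLaurentExpansion (f : ℂ → ℂ) (a : Laurent ℂ) : Prop :=
  ∀ᶠ t in 𝓝[≠] (0 : ℂ), HasSum (fun n : ℤ => a.coeff n * t ^ n) (f t)

open Classical in
/-- The Laurent expansion at `0` of a function meromorphic at `0`. -/
def laurentExpansion (f : ℂ → ℂ) : Laurent ℂ :=
  if h : ∃ a, HasLaurentExpansion f a then h.choose else 0

variable (X) in
/-- A curve with a nonzero meromorphic differential `om`, a finite set `S` of points containing
all zeros and poles of `om`, and a local coordinate at each point of `S`. -/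
structure MarkedCurve [IsManifold 𝓘(ℂ, ℂ) (⊤ : WithTop ℕ∞) X] where
  om : Differential X
  meromorphic : IsMeromorphicDifferential om
  nonzero : ∃ x, diffOrder om x ≠ ⊤
  S : Finset X
  zeros_poles_mem : ∀ x, diffOrder om x ≠ 0 → x ∈ S
  coord : S → OpenPartialHomeomorph X ℂ
  coord_mem_atlas : ∀ s, coord s ∈ IsManifold.maximalAtlas 𝓘(ℂ, ℂ) (⊤ : WithTop ℕ∞) X
  mem_coord_source : ∀ s, (s : X) ∈ (coord s).source
  coord_apply : ∀ s, coord s (s : X) = 0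

end Curve

variable {X : Type*} [TopologicalSpace X] [ChartedSpace ℂ X]
  [IsManifold 𝓘(ℂ, ℂ) (⊤ : WithTop ℕ∞) X]

namespace MarkedCurve

variable (M : MarkedCurve X)

/-- The sum of the local fields at the points of `S`; the local field at `s` is `ℂ((z_s))`. -/
abbrev K := M.S → Laurent ℂ

/-- The series `p_s` such that `om = p_s(z_s) dz_s` near `s`. -/
def density (s : M.S) : Laurent ℂ :=
  laurentExpansion (localDensity M.om (M.coord s))

/-- The derivation `∂ f = df / om` of the local field at `s`. -/
def del (s : M.S) : Laurent ℂ →ₗ[ℂ] Laurent ℂ where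
  toFun f := (M.density s)⁻¹ * LaurentSeries.derivative ℂ f
  map_add' f g := by rw [map_add, mul_add]
  map_smul' c f := by
    rw [map_smul, RingHom.id_apply, ← HahnSeries.C_mul_eq_smul, ← HahnSeries.C_mul_eq_smul]
    ring

/-- The pairing `⟨f, g⟩ = ∑ₛ resₛ (f g om)`. -/
def pairing (f g : M.K) : ℂ := ∑ s, (f s * g s * M.density s).coeff (-1)

/-- The Laurent expansions at the points of `S` of the functions regular on `X ∖ S` and
meromorphic on `X`. -/
def R : Submodule ℂ M.K where
  carrier := {a | ∃ f : X → ℂ, MDifferentiableOn 𝓘(ℂ, ℂ) 𝓘(ℂ, ℂ) f ((M.S : Set X)ᶜ) ∧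
    ∀ s, HasLaurentExpansion (f ∘ (M.coord s).symm) (a s)}
  add_mem' := by
    rintro a b ⟨f, hf, ha⟩ ⟨g, hg, hb⟩
    refine ⟨f + g, hf.add hg, fun s => ?_⟩
    filter_upwards [ha s, hb s] with t h1 h2
    simpa [add_mul] using h1.add h2
  zero_mem' := by
    refine ⟨fun _ => 0, mdifferentiableOn_const, fun s => ?_⟩
    exact Eventually.of_forall fun t => by simp
  smul_mem' := by
    rintro c a ⟨f, hf, ha⟩
    refine ⟨c • f, hf.const_smul c, fun s => ?_⟩
    filter_upwards [ha s] with t h1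
    simpa [mul_assoc] using h1.mul_left c

/-- The sum of the completed local rings at the points of `S`. -/
def localRings : Submodule ℂ M.K where
  carrier := {a | ∀ s, ∀ n : ℤ, n < 0 → (a s).coeff n = 0}
  add_mem' := fun ha hb s n hn => by simp [ha s n hn, hb s n hn]
  zero_mem' := fun s n _ => by simp
  smul_mem' := fun c a ha s n hn => by simp [ha s n hn]

end MarkedCurve

/-- Each of the two subspaces meets the other one in a subspace of finite codimension. -/
def Commensurable {V : Type*} [AddCommGroup V] [Module ℂ V] (A B : Submodule ℂ V) : Prop :=
  Module.Finite ℂ (A ⧸ B.submoduleOf A) ∧ Module.Finite ℂ (B ⧸ A.submoduleOf B)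

/-- An isotropic complement of `R`, commensurable with the sum of the completed local rings. -/
structure LagrangianComplement (M : MarkedCurve X) where
  La : Submodule ℂ M.K
  isCompl : IsCompl M.R La
  isotropic : ∀ a ∈ La, ∀ b ∈ La, M.pairing a b = 0
  commensurable : Commensurable La M.localRings

/-- Dual bases of `R` and `La`, the second one tending to `0`. The normalization
`⟨eⁱ, eⱼ⟩ = -δᵢⱼ` is the one for which the Green kernel `G` behaves like `-(∂z)/(z - w)` near the
diagonal, so that `(∂ ⊗ 1)G - G²` is regular there. -/
structure DualBases (M : MarkedCurve X) (L : LagrangianComplement M) where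
  up : Module.Basis ℕ ℂ M.R
  down : ℕ → L.La
  pairing_up_down : ∀ i j, M.pairing (up i) (down j) = if i = j then -1 else 0
  tendsto_zero : ∀ N : ℤ, ∀ᶠ i in atTop, ∀ s, ∀ n < N, ((down i : M.K) s).coeff n = 0

/-! ### Kernels in two variables

`Ker` is `ℂ((z))((w))`: series in `w` whose coefficients are series in `z`. The component of
`K ⊗ K`, or of its completion, at a pair `(s, t)` of points of `S` is read in it, with
`z = z_s` and `w = w_t`. -/

/-- The field `ℂ((z))((w))`. -/
abbrev Ker := Laurent (Laurent ℂ)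

/-- The decomposable kernel `a(z) b(w)`. -/
def tens (a b : Laurent ℂ) : Ker :=
  b.map (HahnSeries.C : ℂ →+* Laurent ℂ) * HahnSeries.C a

theorem smul_eq_C_C_mul (c : ℂ) (f : Ker) :
    c • f = HahnSeries.C (HahnSeries.C c) * f := by
  rw [HahnSeries.C_mul_eq_smul]
  apply HahnSeries.ext
  funext n
  rw [HahnSeries.coeff_smul, HahnSeries.coeff_smul, smul_eq_mul, HahnSeries.C_mul_eq_smul]

namespace MarkedCurve

variable (M : MarkedCurve X)

/-- `∂ ⊗ 1`, with `z` the coordinate at `s`. -/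
def delZ (s : M.S) (f : Ker) : Ker := f.map (M.del s)

/-- `1 ⊗ ∂`, with `w` the coordinate at `t`. -/
def delW (t : M.S) (f : Ker) : Ker :=
  tens 1 (M.density t)⁻¹ * LaurentSeries.derivative (Laurent ℂ) f

/-- The component at `(s, t)` of an element of `R ⊗ R`. -/
def regKer (s t : M.S) : (M.R ⊗[ℂ] M.R) →ₗ[ℂ] Ker :=
  TensorProduct.lift <| LinearMap.mk₂ ℂ (fun a b : M.R => tens ((a : M.K) s) ((b : M.K) t))
    (fun a a' b => by simp [tens, mul_add])
    (fun c a b => by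
      simp only [tens, Submodule.coe_smul, Pi.smul_apply, smul_eq_C_C_mul]
      rw [← HahnSeries.C_mul_eq_smul, map_mul]
      ring)
    (fun a b b' => by
      simp only [tens, Submodule.coe_add, Pi.add_apply]
      rw [← add_mul]
      congr 1
      apply HahnSeries.ext
      funext n
      simp)
    (fun c a b => by
      simp only [tens, Submodule.coe_smul, Pi.smul_apply, smul_eq_C_C_mul]
      rw [← mul_assoc]
      congr 1
      rw [← smul_eq_C_C_mul]
      apply HahnSeries.ext
      funext n
      change HahnSeries.C (c * ((b : M.K) t).coeff n) =
        c • HahnSeries.C (((b : M.K) t).coeff n)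
      rw [map_mul, HahnSeries.C_mul_eq_smul])

end MarkedCurve

namespace DualBases

variable {M : MarkedCurve X} {L : LagrangianComplement M} (E : DualBases M L)

theorem bddBelow_green (s t : M.S) :
    BddBelow (Function.support fun n : ℤ =>
      ∑ᶠ i, ((E.down i : M.K) t).coeff n • (E.up i : M.K) s) := by
  obtain ⟨k, hk⟩ := eventually_atTop.1 (E.tendsto_zero 0)
  have hfin : ∀ m : ℕ, ∃ N : ℤ, N ≤ 0 ∧ ∀ i < m, ∀ n < N, ((E.down i : M.K) t).coeff n = 0 := by
    intro m
    induction m with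
    | zero => exact ⟨0, le_rfl, by simp⟩
    | succ m ih =>
      obtain ⟨N, hN, h⟩ := ih
      refine ⟨min N ((E.down m : M.K) t).order, (min_le_left _ _).trans hN, fun i hi n hn => ?_⟩
      rcases Nat.lt_succ_iff_lt_or_eq.1 hi with hi | rfl
      · exact h i hi n (hn.trans_le (min_le_left _ _))
      · exact HahnSeries.coeff_eq_zero_of_lt_order (hn.trans_le (min_le_right _ _))
  obtain ⟨N, hN, h⟩ := hfin k
  refine ⟨N, fun n hn => ?_⟩
  by_contra hlt
  push Not at hlt
  refine hn ?_
  refine finsum_eq_zero_of_forall_eq_zero fun i => ?_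
  by_cases hi : i < k
  · rw [h i hi n hlt, zero_smul]
  · rw [hk i (not_lt.1 hi) t n (hlt.trans_le hN), zero_smul]

/-- The component at `(s, t)` of the Green kernel `G = ∑ᵢ eⁱ ⊗ eᵢ`. -/
def green (s t : M.S) : Ker :=
  HahnSeries.ofSuppBddBelow
    (fun n : ℤ => ∑ᶠ i, ((E.down i : M.K) t).coeff n • (E.up i : M.K) s) (E.bddBelow_green s t)

/-- `γ = (∂ ⊗ 1)G - G²`. -/
def gam (s t : M.S) : Ker := M.delZ s (E.green s t) - E.green s t ^ 2

end DualBases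

/-! ### The universal series `ψ` and `φ`

They have coefficients in the polynomials in free variables `γ₀, γ₁, …`, and the power series
variable is `ℏ`. -/

/-- `D = ∑ᵢ γᵢ₊₁ ∂/∂γᵢ`. -/
def shiftD : Derivation ℂ (MvPolynomial ℕ ℂ) (MvPolynomial ℕ ℂ) :=
  MvPolynomial.mkDerivation ℂ fun i => MvPolynomial.X (i + 1)

/-- The coefficients of the solution `ψ` of `∂ψ/∂ℏ = Dψ - 1 - γ₀ψ²`, `ψ(0) = 0`. -/
def psiCoeff : ℕ → MvPolynomial ℕ ℂ
  | 0 => 0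
  | n + 1 => ((n + 1 : ℂ)⁻¹) • (shiftD (psiCoeff n) - (if n = 0 then 1 else 0)
      - MvPolynomial.X 0 * ∑ i : Fin (n + 1), psiCoeff i * psiCoeff (n - i))

/-- The solution `ψ` of `∂ψ/∂ℏ = Dψ - 1 - γ₀ψ²`, `ψ(0) = 0`. -/
def psi : PowerSeries (MvPolynomial ℕ ℂ) := PowerSeries.mk psiCoeff

/-- The coefficients of the solution `φ` of `∂φ/∂ℏ = Dφ - γ₀ψ`, `φ(0) = 0`. -/
def phiCoeff : ℕ → MvPolynomial ℕ ℂ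
  | 0 => 0
  | n + 1 => ((n + 1 : ℂ)⁻¹) • (shiftD (phiCoeff n) - MvPolynomial.X 0 * psiCoeff n)

/-- The solution `φ` of `∂φ/∂ℏ = Dφ - γ₀ψ`, `φ(0) = 0`. -/
def phi : PowerSeries (MvPolynomial ℕ ℂ) := PowerSeries.mk phiCoeff

theorem psi_zero : PowerSeries.constantCoeff psi = 0 := by
  rw [← PowerSeries.coeff_zero_eq_constantCoeff_apply, psi, PowerSeries.coeff_mk, psiCoeff]

theorem phi_zero : PowerSeries.constantCoeff phi = 0 := by
  rw [← PowerSeries.coeff_zero_eq_constantCoeff_apply, phi, PowerSeries.coeff_mk, phiCoeff]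

theorem smul_succ_inv_mul (n : ℕ) (p : MvPolynomial ℕ ℂ) :
    ((n + 1 : ℂ)⁻¹) • p * ((n : MvPolynomial ℕ ℂ) + 1) = p := by
  have h : ((n : MvPolynomial ℕ ℂ) + 1) = MvPolynomial.C (n + 1 : ℂ) := by simp
  have h0 : (n + 1 : ℂ) ≠ 0 := by exact_mod_cast n.succ_ne_zero
  rw [h, MvPolynomial.smul_eq_C_mul, mul_right_comm, ← MvPolynomial.C_mul, inv_mul_cancel₀ h0]
  simp

theorem psi_ode (n : ℕ) :
    PowerSeries.coeff n (PowerSeries.derivative (MvPolynomial ℕ ℂ) psi) =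
      shiftD (PowerSeries.coeff n psi) - PowerSeries.coeff n 1
        - PowerSeries.coeff n (PowerSeries.C (MvPolynomial.X 0) * psi ^ 2) := by
  rw [PowerSeries.coeff_derivative, PowerSeries.coeff_C_mul, pow_two, PowerSeries.coeff_mul,
    PowerSeries.coeff_one, Finset.Nat.sum_antidiagonal_eq_sum_range_succ_mk]
  simp only [psi, PowerSeries.coeff_mk]
  rw [psiCoeff, smul_succ_inv_mul, Finset.sum_range]

theorem phi_ode (n : ℕ) :
    PowerSeries.coeff n (PowerSeries.derivative (MvPolynomial ℕ ℂ) phi) =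
      shiftD (PowerSeries.coeff n phi)
        - PowerSeries.coeff n (PowerSeries.C (MvPolynomial.X 0) * psi) := by
  rw [PowerSeries.coeff_derivative, PowerSeries.coeff_C_mul]
  simp only [psi, phi, PowerSeries.coeff_mk]
  rw [phiCoeff, smul_succ_inv_mul]

/-! ### The structure function -/

namespace DualBases

variable {M : MarkedCurve X} {L : LagrangianComplement M} (E : DualBases M L)

/-- The substitution `γᵢ ↦ (∂ⁱ ⊗ 1)γ` in a series in `ℏ`. -/
def evalGam (s t : M.S) (f : PowerSeries (MvPolynomial ℕ ℂ)) : PowerSeries Ker :=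
  PowerSeries.map
    (MvPolynomial.aeval (R := ℂ) fun i : ℕ => (M.delZ s)^[i] (E.gam s t)).toRingHom f

/-- `ψ₊(ℏ) = ψ(ℏ, (∂ⁱ ⊗ 1)γ)`. -/
def psiPlus (s t : M.S) : PowerSeries Ker := E.evalGam s t psi

/-- `ψ₋(ℏ) = ψ(-ℏ, (∂ⁱ ⊗ 1)γ)`. -/
def psiMinus (s t : M.S) : PowerSeries Ker := PowerSeries.rescale (-1) (E.psiPlus s t)

/-- `(φ(ℏ, (∂ⁱ ⊗ 1)γ) - φ(-ℏ, (∂ⁱ ⊗ 1)γ)) / 2ℏ`, which is the series called `φ` in the formula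
for the structure function. -/
def phiSym (s t : M.S) : PowerSeries Ker :=
  PowerSeries.mk fun n => (2 : ℂ)⁻¹ • PowerSeries.coeff (n + 1)
    (E.evalGam s t phi - PowerSeries.rescale (-1) (E.evalGam s t phi))

/-- The coefficient of `ℏⁿ` in `∑ᵢ Teⁱ ⊗ eᵢ - eⁱ ⊗ Teᵢ`, where
`T = sh(ℏ∂)/(ℏ∂) = ∑ₖ ℏ²ᵏ ∂²ᵏ / (2k+1)!`. -/
def tDefect (s t : M.S) (n : ℕ) : Ker :=
  if Even n then ((n + 1).factorial : ℂ)⁻¹ •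
    ((M.delZ s)^[n] (E.green s t) - (M.delW t)^[n] (E.green s t)) else 0

/-- The series `τ = ∑ τₙ ℏⁿ` in `(R ⊗ R)[[ℏ]]` satisfies
`τ + τ⁽²¹⁾ = ∑ᵢ Teⁱ ⊗ eᵢ - eⁱ ⊗ Teᵢ`. -/
def IsTau (tau : ℕ → M.R ⊗[ℂ] M.R) : Prop :=
  ∀ n s t, M.regKer s t (tau n + TensorProduct.comm ℂ M.R M.R (tau n)) = E.tDefect s t n

/-- The component at `(s, t)` of the structure function
`q(z,w) = q^{2(τ - φ)} (1 + ψ₊G)/(1 + ψ₋G)`, where `q = e^ℏ`. -/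
def structureFunction (tau : ℕ → M.R ⊗[ℂ] M.R) (s t : M.S) : PowerSeries Ker :=
  PowerSeries.subst
      (2 * PowerSeries.X * (PowerSeries.mk (fun n => M.regKer s t (tau n)) - E.phiSym s t))
      (PowerSeries.exp ℂ)
    * (1 + E.psiPlus s t * PowerSeries.C (E.green s t))
    * (1 + E.psiMinus s t * PowerSeries.C (E.green s t))⁻¹

end DualBases

/-! ### Substitution of `q^{c∂}w` for `z`

This is done on the diagonal components, where `z` and `w` are two copies of one coordinate. -/

/-- `f` belongs to `ℂ((z, w)) = ℂ[[z, w]][z⁻¹, w⁻¹]`. -/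
def IsRegular (f : Ker) : Prop := ∃ N : ℤ, ∀ n m : ℤ, m < N → (f.coeff n).coeff m = 0

open Classical in
/-- The restriction `f(w, w)` to the diagonal of `f(z, w)` in `ℂ((z, w))`. -/
def diag (f : Ker) : Laurent ℂ :=
  if h : BddBelow (Function.support fun k : ℤ => ∑ᶠ n : ℤ, (f.coeff n).coeff (k - n)) then
    HahnSeries.ofSuppBddBelow (fun k : ℤ => ∑ᶠ n : ℤ, (f.coeff n).coeff (k - n)) h
  else 0

namespace MarkedCurve

variable (M : MarkedCurve X)

/-- `f(q^{c∂}w, w) = ∑ₖ (cℏ)ᵏ/k! ((∂ᵏ ⊗ 1)f)(w, w)`, for `f` in `ℂ((z, w))[[ℏ]]`. -/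
def substZ (s : M.S) (c : ℂ) (f : PowerSeries Ker) : PowerSeries (Laurent ℂ) :=
  PowerSeries.mk fun n => ∑ kl ∈ Finset.HasAntidiagonal.antidiagonal n,
    (c ^ kl.1 / (kl.1.factorial : ℂ)) • diag ((M.delZ s)^[kl.1] (PowerSeries.coeff kl.2 f))

/-- The function `Q` can be written as a fraction `N/D` with `N` and `D` in `ℂ((z, w))[[ℏ]]`, such
that at `z = q^{c∂}w` the denominator is nonzero, hence invertible in `ℂ((w))((ℏ))`, and the
numerator is zero. -/
def VanishesAt (s : M.S) (c : ℂ) (Q : PowerSeries Ker) : Prop :=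
  ∃ N D : PowerSeries Ker,
    (∀ n, IsRegular (PowerSeries.coeff n N)) ∧ (∀ n, IsRegular (PowerSeries.coeff n D)) ∧
    D * Q = N ∧ M.substZ s c D ≠ 0 ∧ M.substZ s c N = 0

end MarkedCurve

end CurveKernel

end

noncomputable section

namespace CurveKernel

/-! ### Laurent series -/

/-! Fix `s`, write `ω = p dz` and `P = 1/p = ∂z`. Kernels are restricted to the diagonal inside
`ℂ((z, w))`, where restriction is a ring homomorphism whose kernel is generated by `z - w`. Near the
diagonal `G = -P(z)/(z - w) + r` with `r` regular and `2 r(w, w) = P'(w)`; the last identity makes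
`γ = ∂G - G²` regular (`riccati_mem`).

Replacing `γᵢ` by `∂ⁱγ` turns `D` into `∂ ⊗ 1`, so `u = ψ₊` satisfies the Riccati equation `(d/dℏ -
∂)u = -1 - γu²`. It linearizes: `Y = (z - w)(1 + uG)` satisfies `(d/dℏ - ∂)Y = -(r + γu)Y`
(`flowDer_riccati`). Since `d/dℏ` of `e^{-ℏ∂}F` is `e^{-ℏ∂}(d/dℏ - ∂)F`, the restriction of `Y` to
`z = q^{-∂}w` solves a homogeneous linear equation with initial value `(z - w)|_{z = w} = 0`, hence
is zero (`exists_expCoeff_eq`). Changing the sign of `ℏ`, `(z - w)(1 + ψ₋G)` vanishes on `z =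
q^{∂}w`. These two kernels are numerator and denominator of the structure function, up to an
exponential with regular coefficients and constant term 1. On the opposite curve each of them has
`ℏ`-coefficient `±2P`, hence is nonzero (`flowVanishes_of_riccati`).

It remains to find the shape of `G`. Its coefficient of `wⁿ` is minus the projection to `R` along
`Λ` of `w^{-n-1}/p` (`coeff_green`). As `Λ` has bounded poles, this gives the polar part; as `R` and
`Λ` are both isotropic, `G` is antisymmetric up to its polar part, which determines `r(w, w)`
(`diag_greenReg`).

Isotropy of `R` is the residue theorem, obtained algebraically from the complement `Λ`. In the
spirit of Tate, the commutator of `g ∈ R` with the projection has finite rank, and restricting its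
kernel `(g(z) - g(w))G` to the diagonal gives `⟨f, ∂g⟩ = 0` for `f, g ∈ R` (`pairing_derivation`).
So the radical `J` of the pairing on `R` is an ideal containing `∂R`. For nonzero `u ∈ ∂R` the ring
`R/uR` is Artinian. If `J` were proper, some `a ∉ uR` would satisfy `aJ ⊆ uR`; but `J` is `∂`-stable
and so has no common zero outside `S`, which forces `a/u` to be regular there, that is, `a ∈ uR`
(`pairing_R_eq_zero`). -/

theorem exists_bound {A : Type*} [Zero A] (f : LaurentSeries A) :
    ∃ N : ℤ, ∀ n < N, f.coeff n = 0 :=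
  ⟨f.order, fun _ hn => HahnSeries.coeff_eq_zero_of_lt_order hn⟩

/-- Summing over an interval given by lower bounds, rather than over supports, lets products of
different series share one index set. -/
theorem coeff_mul_Icc {A : Type*} [Ring A] {f g : LaurentSeries A} {a b : ℤ}
    (hf : ∀ n < a, f.coeff n = 0) (hg : ∀ n < b, g.coeff n = 0) (n : ℤ) :
    (f * g).coeff n = ∑ i ∈ Finset.Icc a (n - b), f.coeff i * g.coeff (n - i) := by
  rw [HahnSeries.coeff_mul]
  refine Finset.sum_of_injOn (fun p : ℤ × ℤ => p.1) ?_ ?_ ?_ ?_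
  · rintro ⟨i, j⟩ h ⟨i', j'⟩ h' (rfl : i = i')
    simp only [Finset.mem_coe, Finset.mem_antidiagonal] at h h'
    ext1
    · rfl
    · show j = j'; omega
  · rintro ⟨i, j⟩ h
    simp only [Finset.mem_coe, Finset.mem_antidiagonal, HahnSeries.mem_support] at h
    obtain ⟨h1, h2, h3⟩ := h
    simp only [Finset.coe_Icc, Set.mem_Icc]
    have := not_lt.1 fun h => h1 (hf _ h)
    have := not_lt.1 fun h => h2 (hg _ h)
    omega
  · intro i _ h
    by_contra h0
    refine h ⟨(i, n - i), ?_, rfl⟩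
    simp only [Finset.mem_coe, Finset.mem_antidiagonal, HahnSeries.mem_support]
    exact ⟨left_ne_zero_of_mul h0, right_ne_zero_of_mul h0, by ring⟩
  · rintro ⟨i, j⟩ h
    simp only [Finset.mem_antidiagonal] at h
    have : j = n - i := by omega
    rw [this]

theorem coeff_mul_eq_zero {A : Type*} [Ring A] {f g : LaurentSeries A} {a b : ℤ}
    (hf : ∀ n < a, f.coeff n = 0) (hg : ∀ n < b, g.coeff n = 0) :
    ∀ n < a + b, (f * g).coeff n = 0 := by
  intro n hn
  rw [coeff_mul_Icc hf hg, Finset.Icc_eq_empty (by omega), Finset.sum_empty]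

theorem coeff_derivative (A : Type*) {V : Type*} [AddCommGroup V] [Ring A] [Module A V]
    (f : LaurentSeries V) (n : ℤ) :
    (LaurentSeries.derivative A f).coeff n = (n + 1) • f.coeff (n + 1) := by
  rw [LaurentSeries.derivative_apply, LaurentSeries.hasseDeriv_coeff]
  simp

theorem derivative_mul {A : Type*} [CommRing A] (f g : LaurentSeries A) :
    LaurentSeries.derivative A (f * g) =
      LaurentSeries.derivative A f * g + f * LaurentSeries.derivative A g := by
  obtain ⟨a, ha⟩ := exists_bound f
  obtain ⟨b, hb⟩ := exists_bound g
  have ha' : ∀ n < a - 1, (LaurentSeries.derivative A f).coeff n = 0 := fun n hn => by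
    rw [coeff_derivative, ha _ (by omega), smul_zero]
  have hb' : ∀ n < b - 1, (LaurentSeries.derivative A g).coeff n = 0 := fun n hn => by
    rw [coeff_derivative, hb _ (by omega), smul_zero]
  ext n
  rw [coeff_derivative, HahnSeries.coeff_add, coeff_mul_Icc ha hb, coeff_mul_Icc ha' hb,
    coeff_mul_Icc ha hb']
  have e : Finset.Icc a (n + 1 - b) = (Finset.Icc (a - 1) (n - b)).map (addRightEmbedding 1) := by
    rw [Finset.map_add_right_Icc]; congr 1 <;> ring
  have e2 : n - (b - 1) = n + 1 - b := by ring
  rw [e2]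
  have e3 : ∑ i ∈ Finset.Icc (a - 1) (n - b), (LaurentSeries.derivative A f).coeff i *
      g.coeff (n - i) = ∑ i ∈ Finset.Icc a (n + 1 - b), (i : A) * f.coeff i *
        g.coeff (n + 1 - i) := by
    rw [e, Finset.sum_map]
    refine Finset.sum_congr rfl fun i _ => ?_
    rw [coeff_derivative, addRightEmbedding_apply, zsmul_eq_mul]
    congr 2; ring
  rw [e3, ← Finset.sum_add_distrib, Finset.smul_sum]
  refine Finset.sum_congr rfl fun i _ => ?_
  rw [coeff_derivative, zsmul_eq_mul, zsmul_eq_mul, show n - i + 1 = n + 1 - i by ring]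
  push_cast
  ring

/-! ### Kernels -/

theorem coeff_tens (a b : Laurent ℂ) (n : ℤ) : (tens a b).coeff n = b.coeff n • a := by
  rw [tens, mul_comm, HahnSeries.C_mul_eq_smul, HahnSeries.coeff_smul, smul_eq_mul, mul_comm]
  exact HahnSeries.C_mul_eq_smul

theorem coeff_coeff_tens (a b : Laurent ℂ) (n m : ℤ) :
    ((tens a b).coeff n).coeff m = a.coeff m * b.coeff n := by
  rw [coeff_tens, HahnSeries.coeff_smul, smul_eq_mul, mul_comm]

theorem tens_mul_tens (a b a' b' : Laurent ℂ) :
    tens a b * tens a' b' = tens (a * a') (b * b') := by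
  have h : (b * b').map (HahnSeries.C : ℂ →+* Laurent ℂ) =
      b.map (HahnSeries.C : ℂ →+* Laurent ℂ) * b'.map (HahnSeries.C : ℂ →+* Laurent ℂ) :=
    HahnSeries.map_mul (HahnSeries.C : ℂ →+* Laurent ℂ).toNonUnitalRingHom
  simp only [tens, h, map_mul]
  ring

theorem tens_one_one : tens 1 1 = 1 := by
  ext n m
  rw [coeff_coeff_tens, HahnSeries.coeff_one, HahnSeries.coeff_one, HahnSeries.coeff_one]
  split_ifs <;> simp [*]

theorem coeff_C_mul (a : Laurent ℂ) (f : Ker) (n : ℤ) :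
    (tens a 1 * f).coeff n = a * f.coeff n := by
  have : tens a 1 = HahnSeries.C a := by
    ext n m
    rw [coeff_coeff_tens, HahnSeries.coeff_one, HahnSeries.C_apply, HahnSeries.coeff_single]
    split_ifs <;> simp [*]
  rw [this, HahnSeries.C_mul_eq_smul, HahnSeries.coeff_smul, smul_eq_mul]

/-- The series in `w` of the coefficients of `z^m`. -/
def col (m : ℤ) (f : Ker) : Laurent ℂ := f.map (HahnSeries.coeff.linearMap (R := ℂ) m)

theorem coeff_col (m : ℤ) (f : Ker) (n : ℤ) : (col m f).coeff n = (f.coeff n).coeff m := rfl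

theorem coeff_tens_one_mul (b : Laurent ℂ) (f : Ker) (n m : ℤ) :
    ((tens 1 b * f).coeff n).coeff m = (b * col m f).coeff n := by
  obtain ⟨M, hM⟩ := exists_bound f
  obtain ⟨N, hN⟩ := exists_bound b
  have h1 : ∀ n < N, (tens 1 b).coeff n = 0 := fun n hn => by
    rw [coeff_tens, hN n hn, zero_smul]
  have h2 : ∀ n < M, (col m f).coeff n = 0 := fun n hn => by
    rw [coeff_col, hM n hn, HahnSeries.coeff_zero]
  rw [coeff_mul_Icc h1 hM, coeff_mul_Icc hN h2, HahnSeries.coeff_sum]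
  refine Finset.sum_congr rfl fun i _ => ?_
  rw [coeff_tens, ← HahnSeries.C_mul_eq_smul, mul_one, HahnSeries.C_mul_eq_smul,
    HahnSeries.coeff_smul, coeff_col, smul_eq_mul]

/-- The kernel `z - w`. -/
def zw : Ker := tens (HahnSeries.single 1 1) 1 - tens 1 (HahnSeries.single 1 1)

theorem coeff_zw_mul (f : Ker) (n m : ℤ) :
    ((zw * f).coeff n).coeff m = (f.coeff n).coeff (m - 1) - (f.coeff (n - 1)).coeff m := by
  rw [zw, sub_mul, HahnSeries.coeff_sub, HahnSeries.coeff_sub, coeff_C_mul, coeff_tens_one_mul,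
    HahnSeries.coeff_single_mul, HahnSeries.coeff_single_mul, coeff_col]
  simp

theorem zw_ne_zero : zw ≠ 0 := by
  intro h
  have := congrArg (fun f : Ker => (f.coeff 0).coeff 1) h
  simp [zw, coeff_coeff_tens] at this

/-! ### Regular kernels -/

theorem isRegular_tens (a b : Laurent ℂ) : IsRegular (tens a b) := by
  obtain ⟨N, hN⟩ := exists_bound a
  exact ⟨N, fun n m hm => by rw [coeff_coeff_tens, hN m hm, zero_mul]⟩

theorem IsRegular.mul {f g : Ker} (hf : IsRegular f) (hg : IsRegular g) : IsRegular (f * g) := by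
  obtain ⟨N, hN⟩ := hf
  obtain ⟨N', hN'⟩ := hg
  obtain ⟨a, ha⟩ := exists_bound f
  obtain ⟨b, hb⟩ := exists_bound g
  refine ⟨N + N', fun n m hm => ?_⟩
  rw [coeff_mul_Icc ha hb, HahnSeries.coeff_sum]
  exact Finset.sum_eq_zero fun i _ => coeff_mul_eq_zero (hN _) (hN' _) m hm

theorem IsRegular.add {f g : Ker} (hf : IsRegular f) (hg : IsRegular g) : IsRegular (f + g) := by
  obtain ⟨N, hN⟩ := hf
  obtain ⟨N', hN'⟩ := hg
  refine ⟨min N N', fun n m hm => ?_⟩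
  rw [HahnSeries.coeff_add, HahnSeries.coeff_add, hN n m (by omega), hN' n m (by omega), add_zero]

theorem smul_eq_tens_mul (c : ℂ) (f : Ker) : c • f = tens (HahnSeries.C c) 1 * f := by
  ext n m
  rw [coeff_C_mul, HahnSeries.coeff_smul, HahnSeries.C_mul_eq_smul]

/-- The ring `ℂ((z, w))`. -/
def regAlg : Subring Ker where
  carrier := {f | IsRegular f}
  mul_mem' := IsRegular.mul
  add_mem' := IsRegular.add
  one_mem' := tens_one_one ▸ isRegular_tens 1 1
  zero_mem' := ⟨0, fun _ _ _ => rfl⟩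
  neg_mem' := by
    rintro f ⟨N, hN⟩
    refine ⟨N, fun n m hm => ?_⟩
    rw [HahnSeries.coeff_neg, HahnSeries.coeff_neg, hN n m hm, neg_zero]

theorem tens_mem (a b : Laurent ℂ) : tens a b ∈ regAlg := isRegular_tens a b

theorem smul_mem_regAlg (c : ℂ) {f : Ker} (hf : f ∈ regAlg) : c • f ∈ regAlg := by
  rw [smul_eq_tens_mul]
  exact mul_mem (tens_mem _ _) hf

theorem zw_mem : zw ∈ regAlg := sub_mem (tens_mem _ _) (tens_mem _ _)

/-! ### Restriction to the diagonal, and divisibility by `z - w` -/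

theorem coeff_diag {f : Ker} {M N : ℤ} (hM : ∀ n < M, f.coeff n = 0)
    (hN : ∀ n, ∀ m < N, (f.coeff n).coeff m = 0) (k : ℤ) :
    (diag f).coeff k = ∑ n ∈ Finset.Icc M (k - N), (f.coeff n).coeff (k - n) := by
  have key : ∀ k : ℤ, ∑ᶠ n : ℤ, (f.coeff n).coeff (k - n) =
      ∑ n ∈ Finset.Icc M (k - N), (f.coeff n).coeff (k - n) := by
    intro k
    refine finsum_eq_sum_of_support_subset _ fun n hn => ?_
    rw [Function.mem_support] at hn
    simp only [Finset.coe_Icc, Set.mem_Icc]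
    have h1 := not_lt.1 fun h => hn (by rw [hM n h, HahnSeries.coeff_zero])
    have h2 := not_lt.1 fun h => hn (hN n _ h)
    omega
  have hb : BddBelow (Function.support fun k : ℤ => ∑ᶠ n : ℤ, (f.coeff n).coeff (k - n)) := by
    refine ⟨M + N, fun k hk => ?_⟩
    by_contra hlt
    refine hk ?_
    change ∑ᶠ n : ℤ, (f.coeff n).coeff (k - n) = 0
    rw [key, Finset.Icc_eq_empty (by omega), Finset.sum_empty]
  rw [diag, dif_pos hb, HahnSeries.coeff_ofSuppBddBelow, key]

theorem exists_bounds {f : Ker} (hf : f ∈ regAlg) : ∃ M N : ℤ,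
    (∀ n < M, f.coeff n = 0) ∧ ∀ n, ∀ m < N, (f.coeff n).coeff m = 0 := by
  obtain ⟨N, hN⟩ := hf
  obtain ⟨M, hM⟩ := exists_bound f
  exact ⟨M, N, hM, hN⟩

theorem diag_add {f g : Ker} (hf : f ∈ regAlg) (hg : g ∈ regAlg) :
    diag (f + g) = diag f + diag g := by
  obtain ⟨M, N, hM, hN⟩ := exists_bounds hf
  obtain ⟨M', N', hM', hN'⟩ := exists_bounds hg
  have h1 : ∀ n < min M M', f.coeff n = 0 := fun n hn => hM n (by omega)
  have h2 : ∀ n, ∀ m < min N N', (f.coeff n).coeff m = 0 := fun n m hn => hN n m (by omega)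
  have h1' : ∀ n < min M M', g.coeff n = 0 := fun n hn => hM' n (by omega)
  have h2' : ∀ n, ∀ m < min N N', (g.coeff n).coeff m = 0 := fun n m hn => hN' n m (by omega)
  ext k
  rw [HahnSeries.coeff_add, coeff_diag h1 h2, coeff_diag h1' h2',
    coeff_diag (f := f + g) (M := min M M') (N := min N N')
      (fun n hn => by rw [HahnSeries.coeff_add, h1 n hn, h1' n hn, add_zero])
      (fun n m hn => by
        rw [HahnSeries.coeff_add, HahnSeries.coeff_add, h2 n m hn, h2' n m hn, add_zero]),
    ← Finset.sum_add_distrib]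
  rfl

theorem diag_tens (a b : Laurent ℂ) : diag (tens a b) = a * b := by
  obtain ⟨N, hN⟩ := exists_bound a
  obtain ⟨M, hM⟩ := exists_bound b
  ext k
  rw [coeff_diag (M := M) (N := N) (fun n hn => by rw [coeff_tens, hM n hn, zero_smul])
    (fun n m hm => by rw [coeff_coeff_tens, hN m hm, zero_mul]), mul_comm a b,
    coeff_mul_Icc hM hN]
  refine Finset.sum_congr rfl fun i _ => ?_
  rw [coeff_coeff_tens, mul_comm]

theorem diag_smul (c : ℂ) {f : Ker} (hf : f ∈ regAlg) : diag (c • f) = c • diag f := by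
  obtain ⟨M, N, hM, hN⟩ := exists_bounds hf
  ext k
  rw [HahnSeries.coeff_smul, coeff_diag hM hN, coeff_diag (f := c • f) (M := M) (N := N)
      (fun n hn => by rw [HahnSeries.coeff_smul, hM n hn, smul_zero])
      (fun n m hn => by
        rw [HahnSeries.coeff_smul, HahnSeries.coeff_smul, hN n m hn, smul_zero]), Finset.smul_sum]
  rfl

theorem diag_neg {f : Ker} (hf : f ∈ regAlg) : diag (-f) = -diag f := by
  have h : -f = (-1 : ℂ) • f := by simp
  rw [h, diag_smul _ hf]; simp

theorem diag_sub {f g : Ker} (hf : f ∈ regAlg) (hg : g ∈ regAlg) :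
    diag (f - g) = diag f - diag g := by
  rw [sub_eq_add_neg, diag_add hf (neg_mem hg), diag_neg hg, sub_eq_add_neg]

theorem diag_zero : diag 0 = 0 := by
  have := diag_sub (zero_mem regAlg) (zero_mem regAlg)
  rwa [sub_self, sub_self] at this

theorem diag_sum {ι : Type*} (s : Finset ι) {f : ι → Ker} (hf : ∀ i ∈ s, f i ∈ regAlg) :
    diag (∑ i ∈ s, f i) = ∑ i ∈ s, diag (f i) := by
  classical
  induction s using Finset.induction_on with
  | empty => simp [diag_zero]
  | insert a s ha ih =>
    rw [Finset.sum_insert ha, Finset.sum_insert ha, diag_add (hf a (Finset.mem_insert_self a s))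
      (sum_mem fun i hi => hf i (Finset.mem_insert_of_mem hi)),
      ih fun i hi => hf i (Finset.mem_insert_of_mem hi)]

theorem diag_zw_mul {f : Ker} (hf : f ∈ regAlg) : diag (zw * f) = 0 := by
  obtain ⟨M, N, hM, hN⟩ := exists_bounds hf
  ext k
  rw [coeff_diag (M := M) (N := N) (f := zw * f)]
  · simp only [coeff_zw_mul, HahnSeries.coeff_zero]
    rw [Finset.sum_sub_distrib, sub_eq_zero]
    have hl : ∑ n ∈ Finset.Icc M (k - N), (f.coeff n).coeff (k - n - 1) =
        ∑ n ∈ Finset.Icc M (k - N - 1), (f.coeff n).coeff (k - n - 1) := by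
      refine (Finset.sum_subset (Finset.Icc_subset_Icc le_rfl (by omega)) fun n h h' => ?_).symm
      simp only [Finset.mem_Icc] at h h'
      exact hN _ _ (by omega)
    have hr : ∑ n ∈ Finset.Icc M (k - N), (f.coeff (n - 1)).coeff (k - n) =
        ∑ n ∈ Finset.Icc (M + 1) (k - N), (f.coeff (n - 1)).coeff (k - n) := by
      refine (Finset.sum_subset (Finset.Icc_subset_Icc (by omega) le_rfl) fun n h h' => ?_).symm
      simp only [Finset.mem_Icc] at h h'
      rw [hM _ (by omega), HahnSeries.coeff_zero]
    have e : Finset.Icc (M + 1) (k - N) =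
        (Finset.Icc M (k - N - 1)).map (addRightEmbedding 1) := by
      rw [Finset.map_add_right_Icc]; congr 1; ring
    rw [hl, hr, e, Finset.sum_map]
    refine Finset.sum_congr rfl fun n _ => ?_
    rw [addRightEmbedding_apply, show n + 1 - 1 = n by ring, show k - (n + 1) = k - n - 1 by ring]
  · intro n hn
    ext m
    rw [coeff_zw_mul, hM _ hn, hM (n - 1) (by omega)]
    simp
  · intro n m hm
    rw [coeff_zw_mul, hN _ _ hm, hN _ (m - 1) (by omega), sub_zero]

theorem exists_eq_zw_mul {f : Ker} (hf : f ∈ regAlg) (h0 : diag f = 0) :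
    ∃ g ∈ regAlg, f = zw * g := by
  obtain ⟨M, N, hM, hN⟩ := exists_bounds hf
  -- Division by `z - w` is the recursion `g(n, m-1) - g(n-1, m) = f(n, m)`, solved by partial sums
  -- along an antidiagonal. For `m < N` the omitted terms have `z`-exponent below `N`, so the
  -- partial sum is a full coefficient of `diag f`, namely zero: this bounds the poles in `z`.
  let c : ℤ → ℤ → ℂ := fun n m => ∑ i ∈ Finset.Icc M n, (f.coeff i).coeff (m + n + 1 - i)
  have hc : ∀ n, ∀ m < N, c n m = 0 := by
    intro n m hlt
    have h2 := congrArg (fun a : Laurent ℂ => a.coeff (m + n + 1)) h0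
    simp only [coeff_diag hM hN, HahnSeries.coeff_zero] at h2
    rcases le_total n (m + n + 1 - N) with hle | hle
    · rw [← h2]
      refine Finset.sum_subset (Finset.Icc_subset_Icc le_rfl hle) fun i hi hi' => ?_
      simp only [Finset.mem_Icc] at hi hi'
      exact hN _ _ (by omega)
    · rw [← h2]
      refine (Finset.sum_subset (Finset.Icc_subset_Icc le_rfl hle) fun i hi hi' => ?_).symm
      simp only [Finset.mem_Icc] at hi hi'
      exact hN _ _ (by omega)
  have hc' : ∀ n < M, ∀ m, c n m = 0 := fun n hn m => by
    simp only [c]; rw [Finset.Icc_eq_empty (by omega), Finset.sum_empty]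
  let g : Ker := HahnSeries.ofSuppBddBelow (fun n => HahnSeries.ofSuppBddBelow (c n)
    ⟨N, fun m hm => not_lt.1 fun h => hm (hc n m h)⟩)
    ⟨M, fun n hn => not_lt.1 fun h => hn (by ext m; exact hc' n h m)⟩
  have hg : ∀ n m, (g.coeff n).coeff m = c n m := fun n m => rfl
  refine ⟨g, ⟨N, fun n m hm => hc n m hm⟩, ?_⟩
  ext n m
  rw [coeff_zw_mul, hg, hg]
  rcases lt_or_ge n M with hn | hn
  · rw [hM n hn, hc' n hn, hc' (n - 1) (by omega), HahnSeries.coeff_zero, sub_zero]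
  · simp only [c]
    have e : Finset.Icc M n = insert n (Finset.Icc M (n - 1)) := by
      ext i; simp only [Finset.mem_Icc, Finset.mem_insert]; omega
    rw [e, Finset.sum_insert (by simp)]
    have : ∀ i, m - 1 + n + 1 - i = m + (n - 1) + 1 - i := fun i => by ring
    simp only [this]
    rw [add_sub_cancel_right, show m + (n - 1) + 1 - n = m by ring]

/-- Modulo `z - w` every regular kernel equals the function of `w` given by its restriction, and on
functions of `w` multiplicativity is clear. -/
theorem diag_mul {f g : Ker} (hf : f ∈ regAlg) (hg : g ∈ regAlg) :
    diag (f * g) = diag f * diag g := by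
  have key : ∀ {f : Ker}, f ∈ regAlg → ∃ f' ∈ regAlg, f = tens 1 (diag f) + zw * f' := by
    intro f hf
    obtain ⟨f', hf', h⟩ := exists_eq_zw_mul (sub_mem hf (tens_mem 1 (diag f)))
      (by rw [diag_sub hf (tens_mem _ _), diag_tens, one_mul, sub_self])
    exact ⟨f', hf', by rw [← h]; ring⟩
  obtain ⟨f', hf', h⟩ := key hf
  obtain ⟨g', hg', h'⟩ := key hg
  have : f * g = tens 1 (diag f * diag g) +
      zw * (f' * g + tens 1 (diag f) * g') := by
    calc f * g = (tens 1 (diag f) + zw * f') * g := by rw [← h]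
      _ = tens 1 (diag f) * g + zw * (f' * g) := by ring
      _ = tens 1 (diag f) * (tens 1 (diag g) + zw * g') + zw * (f' * g) := by rw [← h']
      _ = tens 1 (diag f) * tens 1 (diag g) + zw * (f' * g + tens 1 (diag f) * g') := by ring
      _ = _ := by rw [tens_mul_tens, one_mul]
  have hm : f' * g + tens 1 (diag f) * g' ∈ regAlg :=
    add_mem (mul_mem hf' hg) (mul_mem (tens_mem _ _) hg')
  rw [this, diag_add (tens_mem _ _) (mul_mem zw_mem hm), diag_zw_mul hm, diag_tens]
  ring

/-! ### Derivations in `z` -/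

/-- The derivation `P d/dz` of `ℂ((z))`. -/
def derLin (P : Laurent ℂ) : Laurent ℂ →ₗ[ℂ] Laurent ℂ where
  toFun f := P * LaurentSeries.derivative ℂ f
  map_add' f g := by rw [map_add, mul_add]
  map_smul' c f := by
    rw [map_smul, RingHom.id_apply, ← HahnSeries.C_mul_eq_smul, ← HahnSeries.C_mul_eq_smul]
    ring

theorem derLin_apply (P f : Laurent ℂ) : derLin P f = P * LaurentSeries.derivative ℂ f := rfl

theorem derLin_mul (P f g : Laurent ℂ) :
    derLin P (f * g) = derLin P f * g + f * derLin P g := by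
  simp only [derLin_apply, derivative_mul]
  ring

/-- The derivation `P(z) d/dz` on `ℂ((z))((w))`. -/
def derZ (P : Laurent ℂ) (f : Ker) : Ker := f.map (derLin P)

theorem coeff_derZ (P : Laurent ℂ) (f : Ker) (n : ℤ) :
    (derZ P f).coeff n = derLin P (f.coeff n) := rfl

theorem derZ_add (P : Laurent ℂ) (f g : Ker) : derZ P (f + g) = derZ P f + derZ P g := by
  ext n : 2
  simp only [coeff_derZ, HahnSeries.coeff_add, map_add]

theorem derZ_zero (P : Laurent ℂ) : derZ P 0 = 0 := by
  ext n : 2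
  simp only [coeff_derZ, HahnSeries.coeff_zero, map_zero]

theorem derZ_neg (P : Laurent ℂ) (f : Ker) : derZ P (-f) = -derZ P f := by
  ext n : 2
  simp only [coeff_derZ, HahnSeries.coeff_neg, map_neg]

theorem derZ_sub (P : Laurent ℂ) (f g : Ker) : derZ P (f - g) = derZ P f - derZ P g := by
  ext n : 2
  simp only [coeff_derZ, HahnSeries.coeff_sub, map_sub]

theorem derZ_smul (P : Laurent ℂ) (c : ℂ) (f : Ker) : derZ P (c • f) = c • derZ P f := by
  ext n : 2
  simp only [coeff_derZ, HahnSeries.coeff_smul, map_smul]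

theorem derZ_mul (P : Laurent ℂ) (f g : Ker) :
    derZ P (f * g) = derZ P f * g + f * derZ P g := by
  obtain ⟨a, ha⟩ := exists_bound f
  obtain ⟨b, hb⟩ := exists_bound g
  have ha' : ∀ n < a, (derZ P f).coeff n = 0 := fun n hn => by
    rw [coeff_derZ, ha n hn, map_zero]
  have hb' : ∀ n < b, (derZ P g).coeff n = 0 := fun n hn => by
    rw [coeff_derZ, hb n hn, map_zero]
  ext n : 2
  rw [coeff_derZ, HahnSeries.coeff_add, coeff_mul_Icc ha hb, coeff_mul_Icc ha' hb,
    coeff_mul_Icc ha hb', map_sum, ← Finset.sum_add_distrib]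
  exact Finset.sum_congr rfl fun i _ => derLin_mul _ _ _

theorem derZ_tens (P a b : Laurent ℂ) : derZ P (tens a b) = tens (derLin P a) b := by
  ext n : 2
  rw [coeff_derZ, coeff_tens, coeff_tens, map_smul]

theorem derivative_one : LaurentSeries.derivative ℂ (1 : Laurent ℂ) = 0 := by
  have := derivative_mul (1 : Laurent ℂ) 1
  simpa using this

theorem derivative_single_one : LaurentSeries.derivative ℂ (HahnSeries.single 1 1 : Laurent ℂ)
    = 1 := by
  ext n
  rw [coeff_derivative, HahnSeries.coeff_single, HahnSeries.coeff_one]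
  by_cases h : n = 0 <;> simp [h]

theorem derZ_one (P : Laurent ℂ) : derZ P 1 = 0 := by
  rw [← tens_one_one, derZ_tens, derLin_apply, derivative_one, mul_zero]
  simp [tens]

theorem derZ_zw (P : Laurent ℂ) : derZ P zw = tens P 1 := by
  rw [zw, derZ_sub, derZ_tens, derZ_tens, derLin_apply, derLin_apply, derivative_one,
    derivative_single_one, mul_one, mul_zero]
  simp [tens]

theorem derZ_mem (P : Laurent ℂ) {f : Ker} (hf : f ∈ regAlg) : derZ P f ∈ regAlg := by
  obtain ⟨N, hN⟩ := hf
  obtain ⟨a, ha⟩ := exists_bound P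
  refine ⟨a + (N - 1), fun n m hm => ?_⟩
  rw [coeff_derZ, derLin_apply]
  refine coeff_mul_eq_zero ha (fun m hm => ?_) m hm
  rw [coeff_derivative, hN n _ (by omega), smul_zero]

theorem derZ_iterate_mem (P : Laurent ℂ) {f : Ker} (hf : f ∈ regAlg) (n : ℕ) :
    (derZ P)^[n] f ∈ regAlg := by
  induction n with
  | zero => exact hf
  | succ n ih => rw [Function.iterate_succ_apply']; exact derZ_mem P ih

/-- The divided difference of `a` restricts to the derivative of `a` on the diagonal. -/
theorem diag_eq_derivative {a : Laurent ℂ} {q : Ker} (hq : q ∈ regAlg)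
    (h : zw * q = tens a 1 - tens 1 a) : diag q = LaurentSeries.derivative ℂ a := by
  have h1 := congrArg (derZ 1) h
  rw [derZ_mul, derZ_zw, derZ_sub, derZ_tens, derZ_tens, tens_one_one, one_mul, derLin_apply,
    derLin_apply, derivative_one, mul_zero, one_mul] at h1
  have h2 : tens (0 : Laurent ℂ) a = 0 := by simp [tens]
  rw [h2, sub_zero] at h1
  have h3 := congrArg diag h1
  rwa [diag_add hq (mul_mem zw_mem (derZ_mem 1 hq)), diag_zw_mul (derZ_mem 1 hq), add_zero,
    diag_tens, mul_one] at h3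

theorem exists_divided_difference (a : Laurent ℂ) :
    ∃ q ∈ regAlg, zw * q = tens a 1 - tens 1 a ∧ diag q = LaurentSeries.derivative ℂ a := by
  obtain ⟨q, hq, h⟩ := exists_eq_zw_mul (sub_mem (tens_mem a 1) (tens_mem 1 a))
    (by rw [diag_sub (tens_mem _ _) (tens_mem _ _), diag_tens, diag_tens, one_mul, mul_one,
      sub_self])
  exact ⟨q, hq, h.symm, diag_eq_derivative hq h.symm⟩

/-- If `G = -P(z)/(z - w) + r` with `r` regular and `2 r(w, w) = P'(w)`, then `∂G - G²` is
regular. -/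
theorem riccati_mem {P : Laurent ℂ} {G r : Ker} (hr : r ∈ regAlg)
    (hG : zw * G = -tens P 1 + zw * r)
    (hd : 2 * diag r = LaurentSeries.derivative ℂ P) : derZ P G - G ^ 2 ∈ regAlg := by
  have hz := zw_ne_zero
  -- In `∂G - G²` the double poles `P²/(z - w)²` cancel, and the simple pole is `P (2r - P'(z))/(z -
  -- w)`. The hypothesis on the diagonal makes this quotient the regular kernel `P y`.
  obtain ⟨y, hy, h⟩ := exists_eq_zw_mul
    (f := r + r - tens (LaurentSeries.derivative ℂ P) 1)
    (sub_mem (add_mem hr hr) (tens_mem _ _))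
    (by rw [diag_sub (add_mem hr hr) (tens_mem _ _), diag_add hr hr, diag_tens, ← hd]; ring)
  have h1 := congrArg (derZ P) hG
  rw [derZ_mul, derZ_zw, derZ_add, derZ_neg, derZ_tens, derZ_mul, derZ_zw, derLin_apply,
    ← mul_one (1 : Laurent ℂ), ← tens_mul_tens, mul_one] at h1
  have key : derZ P G - G ^ 2 = tens P 1 * y + derZ P r - r ^ 2 := by
    have : zw ^ 2 * (derZ P G - G ^ 2) = zw ^ 2 * (tens P 1 * y + derZ P r - r ^ 2) := by
      linear_combination zw * h1 - (zw * G - tens P 1 + zw * r + tens P 1) * hG +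
        (zw * tens P 1) * h
    exact mul_left_cancel₀ (pow_ne_zero 2 hz) this
  rw [key]
  exact sub_mem (add_mem (mul_mem (tens_mem _ _) hy) (derZ_mem P hr)) (pow_mem hr 2)

end CurveKernel

namespace CurveKernel

/-! ### Formal flows -/

/-- The additive map underlying `derZ`. -/
def derZHom (P : Laurent ℂ) : Ker →+ Ker where
  toFun := derZ P
  map_zero' := derZ_zero P
  map_add' := derZ_add P

/-- `derZ` on the coefficients of a series in `ℏ`. -/
def derC (P : Laurent ℂ) (F : PowerSeries Ker) : PowerSeries Ker :=
  PowerSeries.mk fun n => derZ P (PowerSeries.coeff n F)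

theorem coeff_derC (P : Laurent ℂ) (F : PowerSeries Ker) (n : ℕ) :
    PowerSeries.coeff n (derC P F) = derZ P (PowerSeries.coeff n F) := PowerSeries.coeff_mk _ _

/-- The derivation `d/dℏ - P(z) d/dz`. -/
def flowDer (P : Laurent ℂ) (F : PowerSeries Ker) : PowerSeries Ker :=
  PowerSeries.derivative Ker F - derC P F

theorem derC_mul (P : Laurent ℂ) (F H : PowerSeries Ker) :
    derC P (F * H) = derC P F * H + F * derC P H := by
  ext n : 1
  rw [coeff_derC, map_add, PowerSeries.coeff_mul, PowerSeries.coeff_mul, PowerSeries.coeff_mul,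
    ← Finset.sum_add_distrib]
  refine (map_sum (derZHom P) _ _).trans (Finset.sum_congr rfl fun i _ => ?_)
  rw [coeff_derC, coeff_derC]
  exact derZ_mul _ _ _

theorem derC_add (P : Laurent ℂ) (F H : PowerSeries Ker) :
    derC P (F + H) = derC P F + derC P H := by
  ext n : 1
  simp only [coeff_derC, map_add, derZ_add]

theorem derC_C (P : Laurent ℂ) (f : Ker) : derC P (PowerSeries.C f) = PowerSeries.C (derZ P f) := by
  ext n : 1
  rw [coeff_derC, PowerSeries.coeff_C, PowerSeries.coeff_C]
  split_ifs
  · rfl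
  · exact derZ_zero P

theorem flowDer_mul (P : Laurent ℂ) (F H : PowerSeries Ker) :
    flowDer P (F * H) = flowDer P F * H + F * flowDer P H := by
  simp only [flowDer, derC_mul, Derivation.leibniz, smul_eq_mul]
  ring

theorem flowDer_add (P : Laurent ℂ) (F H : PowerSeries Ker) :
    flowDer P (F + H) = flowDer P F + flowDer P H := by
  simp only [flowDer, derC_add, map_add]
  ring

theorem flowDer_C (P : Laurent ℂ) (f : Ker) :
    flowDer P (PowerSeries.C f) = -PowerSeries.C (derZ P f) := by
  rw [flowDer, derC_C, PowerSeries.derivative_C, zero_sub]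

/-- The coefficient of `ℏⁿ` in `e^{cℏ∂} F`. -/
def expCoeff (P : Laurent ℂ) (c : ℂ) (F : PowerSeries Ker) (n : ℕ) : Ker :=
  ∑ kl ∈ Finset.HasAntidiagonal.antidiagonal n,
    (c ^ kl.1 / (kl.1.factorial : ℂ)) • (derZ P)^[kl.1] (PowerSeries.coeff kl.2 F)

theorem derZ_iterate_sub (P : Laurent ℂ) (k : ℕ) (f g : Ker) :
    (derZ P)^[k] (f - g) = (derZ P)^[k] f - (derZ P)^[k] g := by
  induction k with
  | zero => rfl
  | succ k ih => rw [Function.iterate_succ_apply', ih, derZ_sub, Function.iterate_succ_apply',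
      Function.iterate_succ_apply']

theorem derZ_iterate_smul (P : Laurent ℂ) (k : ℕ) (c : ℂ) (f : Ker) :
    (derZ P)^[k] (c • f) = c • (derZ P)^[k] f := by
  induction k with
  | zero => rfl
  | succ k ih => rw [Function.iterate_succ_apply', ih, derZ_smul, Function.iterate_succ_apply']

/-- Coefficientwise form of `d/dℏ (e^{-ℏ∂}F) = e^{-ℏ∂}(d/dℏ - ∂)F`. The weight `n + 1` splits as `k
+ l` over the antidiagonal: the `k` part cancels against the factorial and gives `-∂`, the `l` part
gives `d/dℏ`. -/
theorem expCoeff_succ (P : Laurent ℂ) (F : PowerSeries Ker) (n : ℕ) :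
    (n + 1 : ℂ) • expCoeff P (-1) F (n + 1) = expCoeff P (-1) (flowDer P F) n := by
  let t : ℕ × ℕ → Ker := fun kl =>
    ((-1) ^ kl.1 / (kl.1.factorial : ℂ)) • (derZ P)^[kl.1] (PowerSeries.coeff kl.2 F)
  have h1 : (n + 1 : ℂ) • expCoeff P (-1) F (n + 1) =
      ∑ kl ∈ Finset.HasAntidiagonal.antidiagonal (n + 1), (kl.1 : ℂ) • t kl +
      ∑ kl ∈ Finset.HasAntidiagonal.antidiagonal (n + 1), (kl.2 : ℂ) • t kl := by
    rw [expCoeff, Finset.smul_sum, ← Finset.sum_add_distrib]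
    refine Finset.sum_congr rfl fun kl hkl => ?_
    rw [← add_smul]
    have : (n + 1 : ℂ) = kl.1 + kl.2 := by
      exact_mod_cast (Finset.HasAntidiagonal.mem_antidiagonal.1 hkl).symm
    rw [this]
  rw [h1, Finset.Nat.sum_antidiagonal_succ, Finset.Nat.sum_antidiagonal_succ']
  simp only [Nat.cast_zero, zero_smul, zero_add]
  rw [expCoeff, ← Finset.sum_add_distrib]
  refine Finset.sum_congr rfl fun kl _ => ?_
  have hk : ((kl.1 + 1 : ℕ) : ℂ) ≠ 0 := by exact_mod_cast Nat.succ_ne_zero kl.1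
  have hf : (kl.1.factorial : ℂ) ≠ 0 := by exact_mod_cast Nat.factorial_ne_zero kl.1
  have hd : PowerSeries.coeff kl.2 (flowDer P F) =
      ((kl.2 + 1 : ℕ) : ℂ) • PowerSeries.coeff (kl.2 + 1) F - derZ P (PowerSeries.coeff kl.2 F) := by
    rw [flowDer, map_sub, coeff_derC, PowerSeries.coeff_derivative, Nat.cast_smul_eq_nsmul,
      nsmul_eq_mul]
    push_cast
    ring
  rw [hd, derZ_iterate_sub, derZ_iterate_smul, smul_sub,
    ← Function.iterate_succ_apply (derZ P)]
  simp only [t, smul_smul]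
  rw [add_comm, sub_eq_add_neg, ← neg_smul, Nat.factorial_succ]
  congr 2
  · ring
  · push_cast at hk ⊢
    field_simp
    ring

/-- Series in `ℏ` with regular coefficients. -/
def regSer : Subring (PowerSeries Ker) where
  carrier := {F | ∀ n, PowerSeries.coeff n F ∈ regAlg}
  mul_mem' := fun hF hH n => by
    rw [PowerSeries.coeff_mul]
    exact sum_mem fun i _ => mul_mem (hF _) (hH _)
  add_mem' := fun hF hH n => by rw [map_add]; exact add_mem (hF n) (hH n)
  one_mem' := fun n => by
    rw [PowerSeries.coeff_one]; split_ifs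
    exacts [one_mem _, zero_mem _]
  zero_mem' := fun n => by rw [map_zero]; exact zero_mem _
  neg_mem' := fun hF n => by rw [map_neg]; exact neg_mem (hF n)

theorem C_mem_regSer {f : Ker} (hf : f ∈ regAlg) : PowerSeries.C f ∈ regSer := fun n => by
  rw [PowerSeries.coeff_C]; split_ifs
  exacts [hf, zero_mem _]

theorem X_mem_regSer : (PowerSeries.X : PowerSeries Ker) ∈ regSer := fun n => by
  rw [PowerSeries.coeff_X]; split_ifs
  exacts [one_mem _, zero_mem _]

theorem flowDer_mem (P : Laurent ℂ) {F : PowerSeries Ker} (hF : F ∈ regSer) :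
    flowDer P F ∈ regSer := by
  refine sub_mem (fun n => ?_) fun n => ?_
  · rw [PowerSeries.coeff_derivative]
    exact mul_mem (hF _) (add_mem (natCast_mem _ n) (one_mem _))
  · rw [coeff_derC]
    exact derZ_mem P (hF n)

theorem rescale_mem {F : PowerSeries Ker} (hF : F ∈ regSer) :
    PowerSeries.rescale (-1) F ∈ regSer := fun n => by
  rw [PowerSeries.coeff_rescale]
  exact mul_mem (pow_mem (neg_mem (one_mem _)) n) (hF n)

/-- The restriction of `F` to `z = q^{c∂} w`. -/
def flowSubst (P : Laurent ℂ) (c : ℂ) (f : PowerSeries Ker) : PowerSeries (Laurent ℂ) :=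
  PowerSeries.mk fun n => ∑ kl ∈ Finset.HasAntidiagonal.antidiagonal n,
    (c ^ kl.1 / (kl.1.factorial : ℂ)) • diag ((derZ P)^[kl.1] (PowerSeries.coeff kl.2 f))

theorem coeff_flowSubst (P : Laurent ℂ) (c : ℂ) {F : PowerSeries Ker} (hF : F ∈ regSer) (n : ℕ) :
    PowerSeries.coeff n (flowSubst P c F) = diag (expCoeff P c F n) := by
  rw [flowSubst, PowerSeries.coeff_mk, expCoeff, diag_sum]
  · refine Finset.sum_congr rfl fun kl _ => ?_
    rw [diag_smul _ (derZ_iterate_mem P (hF _) _)]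
  · exact fun kl _ => smul_mem_regAlg _ (derZ_iterate_mem P (hF _) _)

/-- The change `ℏ ↦ -ℏ` exchanges `q^{c∂}` and `q^{-c∂}`; each coefficient of `ℏⁿ` is multiplied by
`(-1)ⁿ`. -/
theorem flowSubst_rescale (P : Laurent ℂ) (c : ℂ) (F : PowerSeries Ker) (hF : F ∈ regSer)
    (h0 : flowSubst P (-c) F = 0) : flowSubst P c (PowerSeries.rescale (-1) F) = 0 := by
  ext n : 1
  have h := congrArg (PowerSeries.coeff n) h0
  rw [flowSubst, PowerSeries.coeff_mk, map_zero] at h ⊢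
  have h' := congrArg (fun a => ((-1 : ℂ) ^ n) • a) h
  simp only [smul_zero, Finset.smul_sum] at h'
  rw [← h']
  refine Finset.sum_congr rfl fun kl hkl => ?_
  have e : PowerSeries.coeff kl.2 (PowerSeries.rescale (-1) F) =
      ((-1 : ℂ) ^ kl.2) • PowerSeries.coeff kl.2 F := by
    rw [PowerSeries.coeff_rescale]
    rcases Nat.even_or_odd kl.2 with h | h <;> simp [h.neg_one_pow]
  rw [e, derZ_iterate_smul, diag_smul _ (derZ_iterate_mem P (hF _) _), smul_smul, smul_smul,
    ← Finset.HasAntidiagonal.mem_antidiagonal.1 hkl]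
  congr 1
  rw [pow_add, neg_pow c]
  have : ((-1 : ℂ) ^ kl.1) * ((-1 : ℂ) ^ kl.1) = 1 := by rw [← mul_pow]; norm_num
  linear_combination (-(-1 : ℂ) ^ kl.2 * c ^ kl.1 / (kl.1.factorial : ℂ)) * this

/-- Uniqueness for a homogeneous linear equation, modulo `z - w`. The multiplier `f` is kept
arbitrary so that the induction closes: the flow derivation sends `fY` to another regular multiple
of `Y`, and the coefficient of `ℏⁿ⁺¹` for `f` is governed by the coefficient of `ℏⁿ` for that
multiple. -/
theorem exists_expCoeff_eq {P : Laurent ℂ} {Y k : PowerSeries Ker} {y : Ker} (hk : k ∈ regSer)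
    (hY : flowDer P Y = k * Y) (hy : y ∈ regAlg) (h0 : PowerSeries.coeff 0 Y = zw * y) (n : ℕ) :
    ∀ f ∈ regSer, ∃ g ∈ regAlg, expCoeff P (-1) (f * Y) n = zw * g := by
  induction n with
  | zero =>
    intro f hf
    refine ⟨PowerSeries.coeff 0 f * y, mul_mem (hf 0) hy, ?_⟩
    simp [expCoeff] at h0 ⊢
    rw [h0]; ring
  | succ n ih =>
    intro f hf
    obtain ⟨g, hg, h⟩ := ih (flowDer P f + f * k) (add_mem (flowDer_mem P hf) (mul_mem hf hk))
    refine ⟨((n + 1 : ℂ)⁻¹) • g, smul_mem_regAlg _ hg, ?_⟩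
    have e := expCoeff_succ P (f * Y) n
    rw [flowDer_mul, hY, show flowDer P f * Y + f * (k * Y) = (flowDer P f + f * k) * Y by ring,
      h] at e
    have hn : (n + 1 : ℂ) ≠ 0 := by exact_mod_cast n.succ_ne_zero
    rw [smul_eq_tens_mul, mul_left_comm, ← e, ← smul_eq_tens_mul, smul_smul, inv_mul_cancel₀ hn,
      one_smul]

/-- `VanishesAt`, for a derivation `P d/dz`. -/
def FlowVanishes (P : Laurent ℂ) (c : ℂ) (Q : PowerSeries Ker) : Prop :=
  ∃ N D : PowerSeries Ker, N ∈ regSer ∧ D ∈ regSer ∧ D * Q = N ∧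
    flowSubst P c D ≠ 0 ∧ flowSubst P c N = 0

/-- Nonvanishing of denominators is detected at first order in `ℏ`, since their constant term `z -
w` restricts to zero while `∂(z - w) = P` does not. -/
theorem coeff_one_flowSubst (P : Laurent ℂ) (c : ℂ) (D : PowerSeries Ker)
    (h0 : PowerSeries.coeff 0 D = zw) :
    PowerSeries.coeff 1 (flowSubst P c D) = diag (PowerSeries.coeff 1 D) + c • P := by
  rw [flowSubst, PowerSeries.coeff_mk]
  rw [Finset.Nat.sum_antidiagonal_succ]
  simp [h0, derZ_zw, diag_tens, -PowerSeries.coeff_zero_eq_constantCoeff]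

theorem constantCoeff_rescale_neg (u : PowerSeries Ker) :
    PowerSeries.constantCoeff (PowerSeries.rescale (-1) u) = PowerSeries.constantCoeff u := by
  rw [← PowerSeries.coeff_zero_eq_constantCoeff_apply, PowerSeries.coeff_rescale, pow_zero, one_mul,
    PowerSeries.coeff_zero_eq_constantCoeff_apply]

theorem rescale_neg_C (f : Ker) :
    PowerSeries.rescale (-1) (PowerSeries.C f) = PowerSeries.C f := by
  ext n : 1
  rw [PowerSeries.coeff_rescale, PowerSeries.coeff_C]
  split_ifs with h <;> simp [h]

/-! ### From the Riccati equation to vanishing on the shifted diagonal -/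

section RiccatiFlow

variable {P : Laurent ℂ} {G r : Ker} {u : PowerSeries Ker}

/-- The Riccati equation gives `1 + uG` the logarithmic derivative `-(G + γu)` along the flow. The
factor `z - w` contributes `-P/(z - w)`, which cancels the pole of `-G` and leaves `-(r + γu)`. -/
theorem flowDer_riccati
    (hode : flowDer P u = -1 - PowerSeries.C (derZ P G - G ^ 2) * u ^ 2)
    (hG : zw * G = -tens P 1 + zw * r) :
    flowDer P (PowerSeries.C zw * (1 + u * PowerSeries.C G)) =
      -(PowerSeries.C r + PowerSeries.C (derZ P G - G ^ 2) * u) *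
        (PowerSeries.C zw * (1 + u * PowerSeries.C G)) := by
  have h1 : flowDer P 1 = 0 := by
    rw [← map_one PowerSeries.C, flowDer_C, derZ_one, map_zero, neg_zero]
  rw [flowDer_mul, flowDer_C, derZ_zw, flowDer_add, h1, flowDer_mul, hode, flowDer_C]
  have hG' := congrArg (PowerSeries.C (R := Ker)) hG
  simp only [map_mul, map_add, map_neg, map_sub, map_pow] at hG' ⊢
  linear_combination -(1 + u * PowerSeries.C G) * hG'

theorem flowSubst_riccati
    (hr : r ∈ regAlg) (hG : zw * G = -tens P 1 + zw * r) (hγ : derZ P G - G ^ 2 ∈ regAlg)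
    (hu : u ∈ regSer) (hu0 : PowerSeries.constantCoeff u = 0)
    (hode : flowDer P u = -1 - PowerSeries.C (derZ P G - G ^ 2) * u ^ 2)
    {E : PowerSeries Ker} (hE : E ∈ regSer)
    (hY : PowerSeries.C zw * (1 + u * PowerSeries.C G) ∈ regSer) :
    flowSubst P (-1) (E * (PowerSeries.C zw * (1 + u * PowerSeries.C G))) = 0 := by
  ext n : 1
  obtain ⟨g, hg, h⟩ := exists_expCoeff_eq
    (neg_mem (add_mem (C_mem_regSer hr) (mul_mem (C_mem_regSer hγ) hu)))
    (flowDer_riccati hode hG) (one_mem regAlg) (by simp [hu0]) n E hE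
  rw [coeff_flowSubst P _ (mul_mem hE hY), h, diag_zw_mul hg, map_zero]

theorem C_zw_mul_mem (hr : r ∈ regAlg) (hG : zw * G = -tens P 1 + zw * r) (hu : u ∈ regSer) :
    PowerSeries.C zw * (1 + u * PowerSeries.C G) ∈ regSer := by
  have : PowerSeries.C zw * (1 + u * PowerSeries.C G) =
      PowerSeries.C zw + u * PowerSeries.C (zw * G) := by
    rw [map_mul]; ring
  rw [this]
  refine add_mem (C_mem_regSer zw_mem) (mul_mem hu (C_mem_regSer ?_))
  rw [hG]
  exact add_mem (neg_mem (tens_mem _ _)) (mul_mem zw_mem hr)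

theorem diag_zw_mul_green (hr : r ∈ regAlg) (hG : zw * G = -tens P 1 + zw * r) :
    diag (zw * G) = -P := by
  rw [hG, diag_add (neg_mem (tens_mem _ _)) (mul_mem zw_mem hr), diag_neg (tens_mem _ _),
    diag_tens, diag_zw_mul hr, mul_one, add_zero]

theorem two_smul_ne_zero (hP : P ≠ 0) : (2 : ℂ) • P ≠ 0 := by
  intro h
  refine hP ?_
  ext n
  have := congrArg (fun a : Laurent ℂ => a.coeff n) h
  simpa using this

/-- Multiplying numerator and denominator by `z - w` clears the pole of `G`, so the fraction is one
of regular series. The same fraction, turned over, serves for the inverse. -/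
theorem flowVanishes_of_riccati (hP : P ≠ 0)
    (hr : r ∈ regAlg) (hG : zw * G = -tens P 1 + zw * r) (hγ : derZ P G - G ^ 2 ∈ regAlg)
    (hu : u ∈ regSer) (hu0 : PowerSeries.constantCoeff u = 0)
    (hode : flowDer P u = -1 - PowerSeries.C (derZ P G - G ^ 2) * u ^ 2)
    {E : PowerSeries Ker} (hE : E ∈ regSer) (hE0 : PowerSeries.constantCoeff E = 1) :
    FlowVanishes P (-1) (E * (1 + u * PowerSeries.C G) *
      (1 + PowerSeries.rescale (-1) u * PowerSeries.C G)⁻¹) ∧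
    FlowVanishes P 1 (E * (1 + u * PowerSeries.C G) *
      (1 + PowerSeries.rescale (-1) u * PowerSeries.C G)⁻¹)⁻¹ := by
  set U := 1 + u * PowerSeries.C G with hU
  set V := 1 + PowerSeries.rescale (-1) u * PowerSeries.C G with hV
  have hYm : PowerSeries.C zw * U ∈ regSer := C_zw_mul_mem hr hG hu
  have hYm' : PowerSeries.C zw * V ∈ regSer := C_zw_mul_mem hr hG (rescale_mem hu)
  have hV0 : PowerSeries.constantCoeff V ≠ 0 := by
    simp [hV, constantCoeff_rescale_neg, hu0]
  have hU0 : PowerSeries.constantCoeff U ≠ 0 := by simp [hU, hu0]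
  have hV1 : V * V⁻¹ = 1 := PowerSeries.mul_inv_cancel _ hV0
  have hQ : PowerSeries.constantCoeff (E * U * V⁻¹) ≠ 0 := by
    rw [map_mul, map_mul, hE0, PowerSeries.constantCoeff_inv, one_mul]
    exact mul_ne_zero hU0 (inv_ne_zero hV0)
  have hu1 : PowerSeries.coeff 1 u = -1 := by
    have h := congrArg (PowerSeries.coeff 0) hode
    rw [flowDer, map_sub, coeff_derC, PowerSeries.coeff_derivative] at h
    simpa [hu0, derZ_zero] using h
  have hX := flowSubst_riccati hr hG hγ hu hu0 hode hE hYm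
  have hX' := flowSubst_riccati hr hG hγ hu hu0 hode (one_mem regSer) hYm
  have hP2 := two_smul_ne_zero hP
  refine ⟨⟨E * (PowerSeries.C zw * U), PowerSeries.C zw * V, mul_mem hE hYm, hYm', ?_, ?_, hX⟩,
    ⟨PowerSeries.C zw * V, E * (PowerSeries.C zw * U), hYm', mul_mem hE hYm, ?_, ?_, ?_⟩⟩
  · linear_combination (PowerSeries.C zw * E * U) * hV1
  -- The `ℏ`-coefficient of the restricted denominator is `-P - P`: one term is the restriction of
  -- `(z - w)G`, the other comes from shifting `z - w` by `q^{-∂}`.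
  · intro h
    have h' := congrArg (PowerSeries.coeff 1) h
    rw [coeff_one_flowSubst _ _ _ (by simp [hV, constantCoeff_rescale_neg, hu0]), map_zero,
      PowerSeries.coeff_C_mul, hV, map_add, PowerSeries.coeff_mul_C, PowerSeries.coeff_rescale,
      hu1, PowerSeries.coeff_one, if_neg one_ne_zero, zero_add, pow_one, neg_mul_neg, one_mul,
      one_mul, diag_zw_mul_green hr hG] at h'
    refine hP2 ?_
    rw [neg_smul, one_smul] at h'
    rw [two_smul]
    linear_combination -h'
  · have h := PowerSeries.mul_inv_cancel _ hQ
    linear_combination (-PowerSeries.C zw * E * U * (E * U * V⁻¹)⁻¹) * hV1 +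
      (PowerSeries.C zw * V) * h
  -- Now both contributions are `+P`. The `ℏ`-coefficient of `E` enters multiplied by `z - w`, so it
  -- disappears on the diagonal.
  · intro h
    have h' := congrArg (PowerSeries.coeff 1) h
    have e : E * (PowerSeries.C zw * U) = PowerSeries.C zw * (E * U) := by ring
    rw [coeff_one_flowSubst _ _ _ (by simp [hU, hu0, hE0]), map_zero, e,
      PowerSeries.coeff_C_mul, PowerSeries.coeff_mul, Finset.Nat.sum_antidiagonal_succ] at h'
    simp only [Finset.Nat.antidiagonal_zero, Finset.sum_singleton, zero_add,
      PowerSeries.coeff_zero_eq_constantCoeff_apply, hE0] at h'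
    have hU1 : PowerSeries.coeff 1 U = -G := by
      rw [hU, map_add, PowerSeries.coeff_mul_C, hu1, PowerSeries.coeff_one, if_neg one_ne_zero]
      ring
    have hU0' : PowerSeries.constantCoeff U = 1 := by simp [hU, hu0]
    rw [hU1, hU0', one_mul, mul_one, mul_add, mul_neg, diag_add, diag_neg, diag_zw_mul_green hr hG,
      diag_zw_mul (hE 1), neg_neg, add_zero, one_smul] at h'
    · refine hP2 ?_
      rw [two_smul]
      exact h'
    · rw [hG]; exact add_mem (neg_mem (tens_mem _ _)) (mul_mem zw_mem hr)
    · refine neg_mem ?_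
      rw [hG]; exact add_mem (neg_mem (tens_mem _ _)) (mul_mem zw_mem hr)
    · exact mul_mem zw_mem (hE 1)
  -- The kernel `(z - w)V` is `(z - w)U` with `ℏ` replaced by `-ℏ`, so its vanishing on `z = q^{∂}w`
  -- is that of `(z - w)U` on `z = q^{-∂}w`.
  · have e : PowerSeries.C zw * V = PowerSeries.rescale (-1) (1 * (PowerSeries.C zw * U)) := by
      rw [one_mul, map_mul, hU, map_add, map_one, map_mul, rescale_neg_C, rescale_neg_C]
    rw [e]
    exact flowSubst_rescale P 1 _ (mul_mem (one_mem _) hYm) hX'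

end RiccatiFlow

/-! ### The universal series -/

theorem algebraMap_ker (c : ℂ) : algebraMap ℂ Ker c = tens (HahnSeries.C c) 1 := by
  have h1 : algebraMap ℂ (Laurent ℂ) c = HahnSeries.C c := by
    rw [HahnSeries.algebraMap_apply', MvPowerSeries.algebraMap_apply]
    exact HahnSeries.ofPowerSeries_C _
  have h2 : algebraMap ℂ Ker c = HahnSeries.C (HahnSeries.C c) := by
    rw [HahnSeries.algebraMap_apply', MvPowerSeries.algebraMap_apply, h1]
    exact HahnSeries.ofPowerSeries_C _
  rw [h2, ← mul_one (HahnSeries.C _), ← smul_eq_C_C_mul, smul_eq_tens_mul, mul_one]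

theorem aeval_mem_regAlg {x : ℕ → Ker} (hx : ∀ i, x i ∈ regAlg) (p : MvPolynomial ℕ ℂ) :
    MvPolynomial.aeval (R := ℂ) x p ∈ regAlg := by
  induction p using MvPolynomial.induction_on with
  | C a => rw [MvPolynomial.aeval_C, algebraMap_ker]; exact tens_mem _ _
  | add p q hp hq => rw [map_add]; exact add_mem hp hq
  | mul_X p i hp => rw [map_mul, MvPolynomial.aeval_X]; exact mul_mem hp (hx i)

/-- Two derivations along the evaluation map agree once they agree on the variables, where both give
`∂ⁱ⁺¹x`. This carries the universal equation for `ψ` to the flow equation for `ψ₊`. -/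
theorem aeval_shiftD (P : Laurent ℂ) (x : Ker) (p : MvPolynomial ℕ ℂ) :
    MvPolynomial.aeval (R := ℂ) (fun i => (derZ P)^[i] x) (shiftD p) =
      derZ P (MvPolynomial.aeval (R := ℂ) (fun i => (derZ P)^[i] x) p) := by
  induction p using MvPolynomial.induction_on with
  | C a =>
    rw [MvPolynomial.aeval_C, algebraMap_ker, derZ_tens, derLin_apply,
      ← mul_one (HahnSeries.C a), HahnSeries.C_mul_eq_smul, map_smul, derivative_one,
      MvPolynomial.derivation_C]
    simp [tens]
  | add p q hp hq => rw [map_add, map_add, map_add, derZ_add, hp, hq]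
  | mul_X p i hp =>
    rw [Derivation.leibniz, map_add, map_mul, derZ_mul, MvPolynomial.aeval_X, smul_eq_mul,
      smul_eq_mul, map_mul, map_mul, MvPolynomial.aeval_X, hp, shiftD,
      MvPolynomial.mkDerivation_X, MvPolynomial.aeval_X, Function.iterate_succ_apply']
    ring

/-! ### The exponential prefactor, and reduction to the polar part of `G` -/

theorem subst_exp_mem {F : PowerSeries Ker} (hF : F ∈ regSer)
    (h0 : PowerSeries.constantCoeff F = 0) :
    PowerSeries.subst F (PowerSeries.exp ℂ) ∈ regSer := by
  intro n
  rw [PowerSeries.coeff_subst' (PowerSeries.HasSubst.of_constantCoeff_zero' h0)]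
  refine finsum_induction (· ∈ regAlg) (zero_mem _) (fun _ _ => add_mem) fun d => ?_
  rw [Algebra.smul_def, algebraMap_ker]
  exact mul_mem (tens_mem _ _) (pow_mem hF d n)

theorem constantCoeff_subst_exp {F : PowerSeries Ker}
    (h0 : PowerSeries.constantCoeff F = 0) :
    PowerSeries.constantCoeff (PowerSeries.subst F (PowerSeries.exp ℂ) : PowerSeries Ker) = 1 := by
  rw [← PowerSeries.coeff_zero_eq_constantCoeff_apply,
    PowerSeries.coeff_subst' (PowerSeries.HasSubst.of_constantCoeff_zero' h0),
    finsum_eq_single _ 0]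
  · rw [Algebra.smul_def]; simp
  · intro d hd
    rw [Algebra.smul_def]; simp [h0, hd]

namespace DualBases

variable {X : Type*} [TopologicalSpace X] [ChartedSpace ℂ X]
  [IsManifold 𝓘(ℂ, ℂ) (⊤ : WithTop ℕ∞) X]
  {M : MarkedCurve X} {L : LagrangianComplement M} (E : DualBases M L)

theorem evalGam_mem (s : M.S) (hγ : E.gam s s ∈ regAlg) (f : PowerSeries (MvPolynomial ℕ ℂ)) :
    E.evalGam s s f ∈ regSer := fun n => by
  rw [evalGam, PowerSeries.coeff_map]
  exact aeval_mem_regAlg (fun i => derZ_iterate_mem (M.density s)⁻¹ hγ i) _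

theorem regKer_mem (s t : M.S) (x : M.R ⊗[ℂ] M.R) : M.regKer s t x ∈ regAlg := by
  induction x using TensorProduct.induction_on with
  | zero => rw [map_zero]; exact zero_mem _
  | tmul a b => exact tens_mem _ _
  | add x y hx hy => rw [map_add]; exact add_mem hx hy

theorem vanishesAt_of_green (s : M.S) {r : Ker} (hP : M.density s ≠ 0) (hr : r ∈ regAlg)
    (hG : zw * E.green s s = -tens (M.density s)⁻¹ 1 + zw * r)
    (hd : 2 * diag r = LaurentSeries.derivative ℂ (M.density s)⁻¹)
    (tau : ℕ → M.R ⊗[ℂ] M.R) :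
    M.VanishesAt s (-1) (E.structureFunction tau s s) ∧
      M.VanishesAt s 1 (E.structureFunction tau s s)⁻¹ := by
  have hγ : E.gam s s ∈ regAlg := riccati_mem hr hG hd
  have hu := E.evalGam_mem s hγ psi
  have hu0 : PowerSeries.constantCoeff (E.evalGam s s psi) = 0 := by
    rw [← PowerSeries.coeff_zero_eq_constantCoeff_apply, evalGam, PowerSeries.coeff_map,
      PowerSeries.coeff_zero_eq_constantCoeff_apply, psi_zero, map_zero]
  have hode : flowDer (M.density s)⁻¹ (E.evalGam s s psi) =
      -1 - PowerSeries.C (E.gam s s) * E.evalGam s s psi ^ 2 := by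
    set ev := MvPolynomial.aeval (R := ℂ) fun i : ℕ => (M.delZ s)^[i] (E.gam s s) with hev
    have hC : PowerSeries.C (E.gam s s) =
        PowerSeries.map ev.toRingHom (PowerSeries.C (MvPolynomial.X 0)) := by
      rw [PowerSeries.map_C]
      congr 1
      exact (MvPolynomial.aeval_X (R := ℂ) (fun i : ℕ => (M.delZ s)^[i] (E.gam s s)) 0).symm
    ext n : 1
    have h := congrArg ev (psi_ode n)
    have hD : ev (shiftD (PowerSeries.coeff n psi)) =
        derZ (M.density s)⁻¹ (ev (PowerSeries.coeff n psi)) := aeval_shiftD _ _ _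
    rw [map_sub, map_sub, hD, PowerSeries.coeff_derivative, map_mul] at h
    rw [flowDer, map_sub, coeff_derC, PowerSeries.coeff_derivative, hC, evalGam, ← hev,
      ← map_pow, ← map_mul, map_sub, map_neg, PowerSeries.coeff_map, PowerSeries.coeff_map,
      PowerSeries.coeff_map, ← map_one (PowerSeries.map ev.toRingHom), PowerSeries.coeff_map]
    simp only [AlgHom.toRingHom_eq_coe, RingHom.coe_coe, map_add, map_natCast, map_one] at h ⊢
    linear_combination h
  have hphi : E.phiSym s s ∈ regSer := fun n => by
    rw [phiSym, PowerSeries.coeff_mk]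
    exact smul_mem_regAlg _ (sub_mem (E.evalGam_mem s hγ phi)
      (rescale_mem (E.evalGam_mem s hγ phi)) _)
  have htau : PowerSeries.mk (fun n => M.regKer s s (tau n)) ∈ regSer := fun n => by
    rw [PowerSeries.coeff_mk]; exact regKer_mem s s _
  have hF : 2 * PowerSeries.X * (PowerSeries.mk (fun n => M.regKer s s (tau n)) - E.phiSym s s) ∈
      regSer := mul_mem (mul_mem (ofNat_mem regSer 2) X_mem_regSer) (sub_mem htau hphi)
  have hF0 : PowerSeries.constantCoeff (2 * PowerSeries.X *
      (PowerSeries.mk (fun n => M.regKer s s (tau n)) - E.phiSym s s)) = 0 := by simp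
  -- By definition `M.delZ s` is `derZ P` with `P = (M.density s)⁻¹`, so `M.VanishesAt s` unfolds to
  -- `FlowVanishes P`.
  exact flowVanishes_of_riccati (inv_ne_zero hP) hr hG hγ hu hu0 hode (subst_exp_mem hF hF0)
    (constantCoeff_subst_exp hF0)

end DualBases

end CurveKernel

namespace CurveKernel

variable {X : Type*} [TopologicalSpace X] [ChartedSpace ℂ X]
  [IsManifold 𝓘(ℂ, ℂ) (⊤ : WithTop ℕ∞) X]

namespace MarkedCurve

variable (M : MarkedCurve X)

/-! ### Lattices and the residue pairing -/

theorem pairing_comm (f g : M.K) : M.pairing f g = M.pairing g f := by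
  simp only [pairing, mul_comm (f _)]

theorem pairing_add_left (f f' g : M.K) :
    M.pairing (f + f') g = M.pairing f g + M.pairing f' g := by
  simp only [pairing, Pi.add_apply, add_mul, HahnSeries.coeff_add, Finset.sum_add_distrib]

theorem pairing_smul_left (c : ℂ) (f g : M.K) :
    M.pairing (c • f) g = c * M.pairing f g := by
  rw [pairing, pairing, Finset.mul_sum]
  refine Finset.sum_congr rfl fun s _ => ?_
  rw [Pi.smul_apply, ← HahnSeries.C_mul_eq_smul, mul_assoc, mul_assoc, HahnSeries.C_mul_eq_smul,
    HahnSeries.coeff_smul, smul_eq_mul, mul_assoc]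

/-- The functional `⟨·, g⟩`. -/
def pairingLin (g : M.K) : M.K →ₗ[ℂ] ℂ where
  toFun f := M.pairing f g
  map_add' f f' := M.pairing_add_left f f' g
  map_smul' c f := M.pairing_smul_left c f g

theorem pairingLin_apply (f g : M.K) : M.pairingLin g f = M.pairing f g := rfl

theorem pairing_sub_left (f f' g : M.K) :
    M.pairing (f - f') g = M.pairing f g - M.pairing f' g :=
  map_sub (M.pairingLin g) f f'

theorem pairing_add_right (f g g' : M.K) :
    M.pairing f (g + g') = M.pairing f g + M.pairing f g' := by
  rw [pairing_comm, pairing_add_left, pairing_comm, M.pairing_comm g']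

theorem pairing_sub_right (f g g' : M.K) :
    M.pairing f (g - g') = M.pairing f g - M.pairing f g' := by
  rw [pairing_comm, pairing_sub_left, pairing_comm, M.pairing_comm g']

theorem pairing_mul_left (f g h : M.K) : M.pairing (f * g) h = M.pairing f (g * h) := by
  simp only [pairing, Pi.mul_apply, mul_assoc]

/-- The elements all of whose components have order at least `N`. -/
def latt (N : ℤ) : Submodule ℂ M.K where
  carrier := {a | ∀ s, ∀ n < N, (a s).coeff n = 0}
  add_mem' := fun ha hb s n hn => by
    rw [Pi.add_apply, HahnSeries.coeff_add, ha s n hn, hb s n hn, add_zero]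
  zero_mem' := fun s n _ => rfl
  smul_mem' := fun c a ha s n hn => by
    rw [Pi.smul_apply, HahnSeries.coeff_smul, ha s n hn, smul_zero]

variable {M}

theorem latt_anti {N N' : ℤ} (h : N ≤ N') : M.latt N' ≤ M.latt N :=
  fun _ ha s n hn => ha s n (hn.trans_le h)

theorem mul_mem_latt {N N' : ℤ} {a b : M.K} (ha : a ∈ M.latt N) (hb : b ∈ M.latt N') :
    a * b ∈ M.latt (N + N') :=
  fun s n hn => coeff_mul_eq_zero (ha s) (hb s) n hn

theorem exists_mem_latt (a : M.K) : ∃ N, a ∈ M.latt N := by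
  choose N hN using fun s => exists_bound (a s)
  obtain ⟨B, hB⟩ := (Set.finite_range N).bddBelow
  exact ⟨B, fun s n hn => hN s n (hn.trans_le (hB ⟨s, rfl⟩))⟩

theorem exists_pairing_eq_zero (M : MarkedCurve X) : ∃ d : ℤ, ∀ N N' : ℤ, d ≤ N + N' →
    ∀ a ∈ M.latt N, ∀ b ∈ M.latt N', M.pairing a b = 0 := by
  obtain ⟨d, hd⟩ := exists_mem_latt (M := M) M.density
  refine ⟨-d, fun N N' h a ha b hb => Finset.sum_eq_zero fun s _ => ?_⟩
  exact mul_mem_latt (mul_mem_latt ha hb) hd s (-1) (by omega)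

variable (M) in
/-- The element `w^{-n-1}/p_t(w)` of the local field at `t`; it pairs with `f` to the coefficient
of `wⁿ` in the component of `f` at `t`. -/
def dualMonomial (t : M.S) (n : ℤ) : M.K := by
  classical
  exact Pi.single t (HahnSeries.single (-n - 1) 1 * (M.density t)⁻¹)

theorem dualMonomial_same (t : M.S) (n : ℤ) :
    M.dualMonomial t n t = HahnSeries.single (-n - 1) 1 * (M.density t)⁻¹ := by
  simp [dualMonomial]

theorem dualMonomial_of_ne {s t : M.S} (h : s ≠ t) (n : ℤ) : M.dualMonomial t n s = 0 := by
  simp [dualMonomial, h]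

theorem coeff_dualMonomial (t : M.S) (n m : ℤ) :
    (M.dualMonomial t n t).coeff m = (M.density t)⁻¹.coeff (n + m + 1) := by
  rw [dualMonomial_same, HahnSeries.coeff_single_mul, one_mul]
  congr 1; ring

theorem pairing_dualMonomial (hP : ∀ s, M.density s ≠ 0) (f : M.K) (t : M.S) (n : ℤ) :
    M.pairing f (M.dualMonomial t n) = (f t).coeff n := by
  rw [pairing, Finset.sum_eq_single t]
  · rw [dualMonomial_same, mul_assoc, mul_assoc, inv_mul_cancel₀ (hP t), mul_one,
      HahnSeries.coeff_mul_single, mul_one]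
    congr 1; ring
  · intro s _ hs
    rw [dualMonomial_of_ne hs, mul_zero, zero_mul, HahnSeries.coeff_zero]
  · simp

theorem latt_le_sup (hP : ∀ s, M.density s ≠ 0) (N : ℤ) :
    ∃ F : Submodule ℂ M.K, F.FG ∧
      F ≤ Submodule.span ℂ (Set.range fun p : M.S × ℤ => M.dualMonomial p.1 p.2) ∧
      M.latt N ≤ F ⊔ M.latt (N + 1) := by
  let o : M.S → ℤ := fun t => (M.density t)⁻¹.order
  -- The index `o t - 1 - N` makes the dual monomial at `t` have order exactly `N`, so that one of
  -- them for each `t` removes the coefficients of degree `N`.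
  refine ⟨Submodule.span ℂ (Set.range fun t => M.dualMonomial t (o t - 1 - N)),
    Submodule.fg_span (Set.finite_range _), Submodule.span_mono ?_, fun a ha => ?_⟩
  · rintro _ ⟨t, rfl⟩
    exact ⟨(t, o t - 1 - N), rfl⟩
  · have hlead : ∀ t, (M.density t)⁻¹.coeff (o t) ≠ 0 := fun t h =>
      inv_ne_zero (hP t) (HahnSeries.coeff_order_eq_zero.1 h)
    let c : M.S → ℂ := fun t => (a t).coeff N / (M.density t)⁻¹.coeff (o t)
    let b : M.K := ∑ t, c t • M.dualMonomial t (o t - 1 - N)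
    have hb : b ∈ Submodule.span ℂ (Set.range fun t => M.dualMonomial t (o t - 1 - N)) :=
      sum_mem fun t _ => Submodule.smul_mem _ _ (Submodule.subset_span ⟨t, rfl⟩)
    have hbs : ∀ s n, (b s).coeff n = c s * (M.density s)⁻¹.coeff (o s - N + n) := by
      intro s n
      have : b s = c s • M.dualMonomial s (o s - 1 - N) s := by
        rw [show b = ∑ t, c t • M.dualMonomial t (o t - 1 - N) from rfl, Finset.sum_apply,
          Finset.sum_eq_single s]
        · rfl
        · intro t _ ht
          rw [Pi.smul_apply, dualMonomial_of_ne ht.symm, smul_zero]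
        · simp
      rw [this, HahnSeries.coeff_smul, coeff_dualMonomial, smul_eq_mul]
      congr 2; ring
    refine Submodule.mem_sup.2 ⟨b, hb, a - b, fun s n hn => ?_, by abel⟩
    rw [Pi.sub_apply, HahnSeries.coeff_sub, hbs]
    rcases lt_or_eq_of_le (Int.lt_add_one_iff.1 hn) with h | rfl
    · rw [ha s n h, HahnSeries.coeff_eq_zero_of_lt_order (show o s - N + n < o s by omega),
        mul_zero, sub_zero]
    · rw [show o s - n + n = o s by ring, div_mul_cancel₀ _ (hlead s), sub_self]

theorem latt_le_fg_sup (hP : ∀ s, M.density s ≠ 0) (N N' : ℤ) :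
    ∃ F : Submodule ℂ M.K, F.FG ∧
      F ≤ Submodule.span ℂ (Set.range fun p : M.S × ℤ => M.dualMonomial p.1 p.2) ∧
      M.latt N ≤ F ⊔ M.latt N' := by
  have key : ∀ k : ℕ, ∃ F : Submodule ℂ M.K, F.FG ∧
      F ≤ Submodule.span ℂ (Set.range fun p : M.S × ℤ => M.dualMonomial p.1 p.2) ∧
      M.latt N ≤ F ⊔ M.latt (N + k) := by
    intro k
    induction k with
    | zero => exact ⟨⊥, Submodule.fg_bot, bot_le, by simp⟩
    | succ k ih =>
      obtain ⟨F, h1, h2, h3⟩ := ih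
      obtain ⟨F', h1', h2', h3'⟩ := latt_le_sup hP (N + k)
      refine ⟨F ⊔ F', h1.sup h1', sup_le h2 h2', h3.trans ?_⟩
      rw [sup_assoc]
      refine sup_le_sup_left ?_ F
      push_cast
      rwa [← add_assoc]
  obtain ⟨F, h1, h2, h3⟩ := key (N' - N).toNat
  exact ⟨F, h1, h2, h3.trans (sup_le_sup_left (latt_anti (by omega)) F)⟩

/-- A functional on the local fields that kills a lattice is represented by the pairing. -/
theorem exists_pairing_eq (hP : ∀ s, M.density s ≠ 0) (l : M.K →ₗ[ℂ] ℂ) {N : ℤ}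
    (hl : ∀ a ∈ M.latt N, l a = 0) : ∃ b : M.K, ∀ a, l a = M.pairing b a := by
  obtain ⟨o, ho⟩ := exists_mem_latt (M := M) fun t => (M.density t)⁻¹
  have hbd : ∀ t, ∀ n < o - N, l (M.dualMonomial t n) = 0 := by
    intro t n hn
    refine hl _ fun s m hm => ?_
    rcases eq_or_ne s t with rfl | h
    · rw [coeff_dualMonomial]
      exact ho s _ (by omega)
    · rw [dualMonomial_of_ne h, HahnSeries.coeff_zero]
  -- Pairing with dual monomials reads off coefficients, so these values are forced. The lattice
  -- killed by `l` bounds the poles of `b`. Every element is a combination of dual monomials up to a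
  -- lattice killed both by `l` and by `⟨b, ·⟩`.
  let b : M.K := fun t => HahnSeries.ofSuppBddBelow (fun n => l (M.dualMonomial t n))
    ⟨o - N, fun n hn => not_lt.1 fun h => hn (hbd t n h)⟩
  have hb : ∀ t n, M.pairing b (M.dualMonomial t n) = l (M.dualMonomial t n) := fun t n => by
    rw [pairing_dualMonomial hP]; rfl
  refine ⟨b, fun a => ?_⟩
  obtain ⟨d, hd⟩ := exists_pairing_eq_zero M
  obtain ⟨B, hB⟩ := exists_mem_latt b
  obtain ⟨A, hA⟩ := exists_mem_latt a
  obtain ⟨F, -, hF, h⟩ := latt_le_fg_sup hP A (max N (d - B))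
  obtain ⟨f, hf, c, hc, rfl⟩ := Submodule.mem_sup.1 (h hA)
  rw [map_add, pairing_add_right, hl c (latt_anti (le_max_left _ _) hc),
    hd B (max N (d - B)) (by omega) b hB c hc, add_zero, add_zero]
  have : Set.EqOn l (M.pairingLin b)
      (Submodule.span ℂ (Set.range fun p : M.S × ℤ => M.dualMonomial p.1 p.2)) := by
    refine LinearMap.eqOn_span ?_
    rintro _ ⟨⟨t, n⟩, rfl⟩
    rw [pairingLin_apply, pairing_comm, hb]
  rw [this (hF hf), pairingLin_apply, pairing_comm]

end MarkedCurve

/-! ### The projection to `R` along `Λ`, and the poles of `Λ` -/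

namespace LagrangianComplement

variable {M : MarkedCurve X} (L : LagrangianComplement M)

/-- The projection to `R` along `La`. -/
def prR : M.K →ₗ[ℂ] M.K := M.R.projection L.La L.isCompl

theorem prR_mem (a : M.K) : L.prR a ∈ M.R := Submodule.projection_apply_mem _ _

theorem prR_of_mem {a : M.K} (ha : a ∈ M.R) : L.prR a = a :=
  Submodule.projection_apply_of_mem_left _ ha

theorem prR_eq_zero {a : M.K} (ha : a ∈ L.La) : L.prR a = 0 :=
  (Submodule.projection_apply_eq_zero_iff _).2 ha

theorem sub_prR_mem (a : M.K) : a - L.prR a ∈ L.La := Submodule.sub_projection_mem _ _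

/-- Commensurability makes `Λ/(Λ ∩ O)` finite-dimensional, `O` being the sum of the completed local
rings. The images in it of the elements of `Λ` with poles of order at most `k` increase with `k` and
exhaust it, so they become stationary. -/
theorem exists_le_latt : ∃ N, L.La ≤ M.latt N := by
  have := L.commensurable.1
  let O := M.localRings.submoduleOf L.La
  let W : ℕ →o Submodule ℂ (L.La ⧸ O) :=
    ⟨fun k => ((M.latt (-k)).submoduleOf L.La).map O.mkQ, fun k k' h =>
      Submodule.map_mono (Submodule.comap_mono (MarkedCurve.latt_anti (by simpa using h)))⟩
  obtain ⟨k, hk⟩ := monotone_stabilizes_iff_noetherian.2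
    (inferInstance : IsNoetherian ℂ (L.La ⧸ O)) W
  refine ⟨-k, fun a ha => ?_⟩
  obtain ⟨N, hN⟩ := MarkedCurve.exists_mem_latt a
  have h1 : O.mkQ ⟨a, ha⟩ ∈ W (max k (-N).toNat) :=
    ⟨⟨a, ha⟩, MarkedCurve.latt_anti (by simp; omega) hN, rfl⟩
  rw [← hk _ (le_max_left _ _)] at h1
  obtain ⟨b, hb, hba⟩ := h1
  have h2 : b - ⟨a, ha⟩ ∈ O := (Submodule.Quotient.eq O).1 hba
  have h3 : (b : M.K) - a ∈ M.latt (-k) :=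
    MarkedCurve.latt_anti (by simp) (show _ ∈ M.latt 0 from h2)
  have := sub_mem (show (b : M.K) ∈ M.latt (-k) from hb) h3
  simpa using this

end LagrangianComplement

/-! ### Self-orthogonality of `Λ`, and `G` as the kernel of the projection -/

namespace DualBases

variable {M : MarkedCurve X} {L : LagrangianComplement M} (E : DualBases M L)

theorem pairing_down (r : M.R) (j : ℕ) : M.pairing r (E.down j) = -E.up.repr r j := by
  have : M.pairingLin (E.down j) ∘ₗ M.R.subtype = -(E.up.coord j) := by
    refine E.up.ext fun i => ?_
    rw [LinearMap.comp_apply, MarkedCurve.pairingLin_apply, Submodule.subtype_apply,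
      E.pairing_up_down, LinearMap.neg_apply, Module.Basis.coord_apply, Module.Basis.repr_self,
      Finsupp.single_apply]
    split_ifs <;> simp
  exact LinearMap.congr_fun this r

/-- If `a` is orthogonal to `Λ`, so is its component in `R`, by isotropy of `Λ`. The `eⱼ` read off
the coordinates of that component, which is therefore zero. -/
theorem mem_La_of_pairing (E : DualBases M L) {a : M.K} (h : ∀ b ∈ L.La, M.pairing a b = 0) : a ∈ L.La := by
  have h0 : (⟨L.prR a, L.prR_mem a⟩ : M.R) = 0 := by
    refine E.up.repr.map_eq_zero_iff.1 (Finsupp.ext fun j => ?_)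
    have h1 := E.pairing_down ⟨L.prR a, L.prR_mem a⟩ j
    have h2 := L.isotropic _ (L.sub_prR_mem a) _ (E.down j).2
    rw [M.pairing_sub_left, h _ (E.down j).2, zero_sub, neg_eq_zero] at h2
    rw [h2] at h1
    simpa using h1.symm
  have h1 := L.sub_prR_mem a
  rw [show L.prR a = 0 from congrArg Subtype.val h0, sub_zero] at h1
  exact h1

theorem exists_latt_le (E : DualBases M L) : ∃ N, M.latt N ≤ L.La := by
  obtain ⟨N, hN⟩ := L.exists_le_latt
  obtain ⟨d, hd⟩ := MarkedCurve.exists_pairing_eq_zero M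
  exact ⟨d - N, fun a ha => E.mem_La_of_pairing fun b hb =>
    hd (d - N) N (by omega) a ha b (hN hb)⟩

/-- The coefficient of `wⁿ` in `eᵢ` is its pairing with the dual monomial. Isotropy of `Λ` allows
the dual monomial to be replaced by its component in `R`, and the pairing becomes minus the `i`-th
coordinate of that component; the sum over `i` reassembles it. -/
theorem coeff_green (hP : ∀ s, M.density s ≠ 0) (s t : M.S) (n : ℤ) :
    (E.green s t).coeff n = -L.prR (M.dualMonomial t n) s := by
  let r : M.R := ⟨L.prR (M.dualMonomial t n), L.prR_mem _⟩
  have h1 : ∀ i, ((E.down i : M.K) t).coeff n = -E.up.repr r i := by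
    intro i
    rw [← MarkedCurve.pairing_dualMonomial hP, ← E.pairing_down, M.pairing_comm, ← sub_eq_zero,
      ← M.pairing_sub_left]
    exact L.isotropic _ (L.sub_prR_mem _) _ (E.down i).2
  have h2 : L.prR (M.dualMonomial t n) = ∑ i ∈ (E.up.repr r).support,
      E.up.repr r i • (E.up i : M.K) := by
    have := congrArg Subtype.val (E.up.linearCombination_repr r)
    rw [Finsupp.linearCombination_apply, Finsupp.sum] at this
    rw [show L.prR (M.dualMonomial t n) = (r : M.K) from rfl, ← this]
    simp
  rw [green, HahnSeries.coeff_ofSuppBddBelow, h2, Finset.sum_apply, ← Finset.sum_neg_distrib]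
  rw [finsum_eq_sum_of_support_subset (s := (E.up.repr r).support)]
  · refine Finset.sum_congr rfl fun i _ => ?_
    rw [h1, Pi.smul_apply, neg_smul]
  · intro i hi
    rw [Finset.mem_coe, Finsupp.mem_support_iff]
    intro h
    refine hi ?_
    simp only [h1, h, neg_zero, zero_smul]

end DualBases

/-! ### The polar part of the Green kernel -/

/-- The expansion of `1/(z - w)` in `ℂ((z))((w))`. -/
def cauchy : Ker := HahnSeries.ofSuppBddBelow
  (fun n : ℤ => if 0 ≤ n then HahnSeries.single (-n - 1) (1 : ℂ) else 0)
  ⟨0, fun _ hn => not_lt.1 fun h => hn (if_neg (not_le.2 h))⟩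

theorem coeff_cauchy (n : ℤ) :
    cauchy.coeff n = if 0 ≤ n then HahnSeries.single (-n - 1) (1 : ℂ) else 0 := rfl

theorem coeff_coeff_cauchy (n m : ℤ) :
    (cauchy.coeff n).coeff m = if 0 ≤ n ∧ n + m + 1 = 0 then 1 else 0 := by
  rw [coeff_cauchy]
  by_cases h : 0 ≤ n
  · rw [if_pos h, HahnSeries.coeff_single]
    split_ifs <;> first | rfl | omega
  · rw [if_neg h, if_neg (fun h' => h h'.1), HahnSeries.coeff_zero]

theorem zw_mul_cauchy : zw * cauchy = 1 := by
  ext n m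
  rw [coeff_zw_mul, coeff_coeff_cauchy, coeff_coeff_cauchy, HahnSeries.coeff_one]
  by_cases hn : n = 0
  · subst hn
    rw [if_neg (by omega : ¬(0 ≤ (0 : ℤ) - 1 ∧ _)), if_pos rfl, HahnSeries.coeff_one, sub_zero]
    split_ifs <;> first | rfl | omega
  · rw [if_neg hn, HahnSeries.coeff_zero, sub_eq_zero]
    exact if_congr ⟨fun h => by omega, fun h => by omega⟩ rfl rfl

/-- Exchange of the two variables in `ℂ((z, w))`. -/
theorem exists_swap {f : Ker} (hf : f ∈ regAlg) : ∃ g ∈ regAlg,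
    (∀ n m, (g.coeff n).coeff m = (f.coeff m).coeff n) ∧ diag g = diag f := by
  obtain ⟨M, N, hM, hN⟩ := exists_bounds hf
  have hM' : ∀ n, ∀ m < M, (f.coeff m).coeff n = 0 := fun n m hm => by
    rw [hM m hm, HahnSeries.coeff_zero]
  let g : Ker := HahnSeries.ofSuppBddBelow (fun n => HahnSeries.ofSuppBddBelow
    (fun m => (f.coeff m).coeff n) ⟨M, fun m hm => not_lt.1 fun h => hm (hM' n m h)⟩)
    ⟨N, fun n hn => not_lt.1 fun h => hn (by ext m; exact hN m n h)⟩
  have hg : ∀ n m, (g.coeff n).coeff m = (f.coeff m).coeff n := fun n m => rfl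
  refine ⟨g, ⟨M, fun n m hm => hM' n m hm⟩, hg, ?_⟩
  ext k
  rw [coeff_diag (f := g) (M := N) (N := M) (fun n hn => by ext m; exact hN m n hn)
    (fun n m hm => hM' n m hm), coeff_diag hM hN]
  refine Finset.sum_nbij' (fun n => k - n) (fun n => k - n) ?_ ?_ ?_ ?_ ?_
  · intro n hn; simp only [Finset.mem_Icc] at hn ⊢; omega
  · intro n hn; simp only [Finset.mem_Icc] at hn ⊢; omega
  · intro n _; ring
  · intro n _; ring
  · intro n _; rw [hg, sub_sub_cancel]

namespace DualBases

variable {M : MarkedCurve X} {L : LagrangianComplement M} (E : DualBases M L)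

/-- The regular part `G + (∂z)/(z - w)` of the Green kernel. -/
def greenReg (s : M.S) : Ker := E.green s s + tens (M.density s)⁻¹ 1 * cauchy

theorem zw_mul_green (s : M.S) :
    zw * E.green s s = -tens (M.density s)⁻¹ 1 + zw * E.greenReg s := by
  rw [greenReg]
  linear_combination (-tens (M.density s)⁻¹ 1) * zw_mul_cauchy

/-- For `n ≥ 0` the term `P/(z - w)` contributes the dual monomial itself, leaving an element of
`Λ`, whose poles are bounded uniformly in `n`. For `n < 0` the dual monomial already has bounded
poles. -/
theorem greenReg_mem (hP : ∀ s, M.density s ≠ 0) (s : M.S) : E.greenReg s ∈ regAlg := by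
  obtain ⟨N, hN⟩ := L.exists_le_latt
  obtain ⟨o, ho⟩ := exists_bound (M.density s)⁻¹
  refine ⟨min N o, fun n m hm => ?_⟩
  have h1 := hN (L.sub_prR_mem (M.dualMonomial s n)) s m (by omega)
  rw [Pi.sub_apply, HahnSeries.coeff_sub] at h1
  rw [greenReg, HahnSeries.coeff_add, HahnSeries.coeff_add, E.coeff_green hP, coeff_C_mul,
    coeff_cauchy, HahnSeries.coeff_neg]
  by_cases h : 0 ≤ n
  · rw [if_pos h, mul_comm, ← MarkedCurve.dualMonomial_same, ← h1]
    ring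
  · rw [MarkedCurve.coeff_dualMonomial, ho _ (by omega)] at h1
    rw [if_neg h, mul_zero, HahnSeries.coeff_zero, add_zero, ← h1, zero_sub]

theorem coeff_greenReg (s : M.S) (n m : ℤ) :
    ((E.greenReg s).coeff n).coeff m = ((E.green s s).coeff n).coeff m +
      if 0 ≤ n then (M.density s)⁻¹.coeff (n + m + 1) else 0 := by
  rw [greenReg, HahnSeries.coeff_add, HahnSeries.coeff_add, coeff_C_mul, coeff_cauchy]
  split_ifs with h
  · rw [HahnSeries.coeff_mul_single, mul_one]
    congr 2; ring
  · rw [mul_zero, HahnSeries.coeff_zero]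

/-- When both summands are isotropic, the adjoint of the projection to `R` is the complementary
projection. This relation is read on two dual monomials. -/
theorem green_antisymm (hP : ∀ s, M.density s ≠ 0)
    (hR : ∀ a ∈ M.R, ∀ b ∈ M.R, M.pairing a b = 0) (s : M.S) (n m : ℤ) :
    ((E.green s s).coeff n).coeff m + ((E.green s s).coeff m).coeff n =
      -(M.density s)⁻¹.coeff (n + m + 1) := by
  have adj : ∀ f h : M.K, M.pairing (L.prR f) h = M.pairing f h - M.pairing f (L.prR h) := by
    intro f h
    have h1 := hR _ (L.prR_mem f) _ (L.prR_mem h)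
    have h2 := L.isotropic _ (L.sub_prR_mem f) _ (L.sub_prR_mem h)
    rw [M.pairing_sub_left, M.pairing_sub_right, M.pairing_sub_right, h1] at h2
    linear_combination -h2
  have h1 := adj (M.dualMonomial s n) (M.dualMonomial s m)
  rw [MarkedCurve.pairing_dualMonomial hP, MarkedCurve.pairing_dualMonomial hP,
    M.pairing_comm _ (L.prR _), MarkedCurve.pairing_dualMonomial hP,
    MarkedCurve.coeff_dualMonomial] at h1
  rw [E.coeff_green hP, E.coeff_green hP, HahnSeries.coeff_neg, HahnSeries.coeff_neg, h1]
  ring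

/-- Antisymmetry makes `r(z, w) + r(w, z)` the divided difference `(P(z) - P(w))/(z - w)`. On the
diagonal the first is `2r(w, w)` and the second is `P'(w)`. -/
theorem diag_greenReg (hP : ∀ s, M.density s ≠ 0)
    (hR : ∀ a ∈ M.R, ∀ b ∈ M.R, M.pairing a b = 0) (s : M.S) :
    2 * diag (E.greenReg s) = LaurentSeries.derivative ℂ (M.density s)⁻¹ := by
  have hr := E.greenReg_mem hP s
  obtain ⟨g, hg, hc, hd⟩ := exists_swap hr
  have hX : ∀ n m : ℤ, ((E.greenReg s + g).coeff n).coeff m =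
      -(M.density s)⁻¹.coeff (n + m + 1) +
        ((if 0 ≤ n then (M.density s)⁻¹.coeff (n + m + 1) else 0) +
        if 0 ≤ m then (M.density s)⁻¹.coeff (n + m + 1) else 0) := by
    intro n m
    rw [HahnSeries.coeff_add, HahnSeries.coeff_add, hc, coeff_greenReg, coeff_greenReg,
      ← E.green_antisymm hP hR, add_comm m n]
    ring
  have h : zw * (E.greenReg s + g) = tens (M.density s)⁻¹ 1 - tens 1 (M.density s)⁻¹ := by
    ext n m
    rw [coeff_zw_mul, hX, hX, HahnSeries.coeff_sub, HahnSeries.coeff_sub, coeff_coeff_tens,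
      coeff_coeff_tens,
      show n + (m - 1) + 1 = n + m by ring, show n - 1 + m + 1 = n + m by ring]
    have e : ∀ (k : ℤ) (p : ℂ), ((if 0 ≤ k then p else 0) - if 0 ≤ k - 1 then p else 0) =
        if k = 0 then p else 0 := by
      intro k p
      split_ifs <;> first | omega | simp
    have e1 : (if n = 0 then (M.density s)⁻¹.coeff (n + m) else 0) =
        (M.density s)⁻¹.coeff m * (1 : Laurent ℂ).coeff n := by
      rw [HahnSeries.coeff_one]
      split_ifs with h <;> simp [h]
    have e2 : (if m = 0 then (M.density s)⁻¹.coeff (n + m) else 0) =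
        (1 : Laurent ℂ).coeff m * (M.density s)⁻¹.coeff n := by
      rw [HahnSeries.coeff_one]
      split_ifs with h <;> simp [h]
    have h1 := e n ((M.density s)⁻¹.coeff (n + m))
    have h2 := e m ((M.density s)⁻¹.coeff (n + m))
    rw [e1] at h1
    rw [e2] at h2
    linear_combination h1 - h2
  rw [← diag_eq_derivative (add_mem hr hg) h, diag_add hr hg, hd]
  ring

/-! ### The residue of `f dg` -/

/-- With `π` the projection to `R`, the operator `T = π g (1 - π)` has finite rank and kernel `(g(z)
- g(w))G = ∑ bₖ(z) cₖ(w)`, where `bₖ ∈ R`. On the diagonal this reads `∂g = -∑ bₖcₖ`. Hence `⟨f, ∂g⟩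
= -∑ ⟨cₖ, bₖf⟩`, and each term is a coordinate of `T(bₖf)`, which is zero because `T` kills `R`. -/
theorem pairing_derivation (E : DualBases M L) (hP : ∀ s, M.density s ≠ 0)
    (hmul : ∀ a ∈ M.R, ∀ b ∈ M.R, a * b ∈ M.R) {f g : M.K} (hf : f ∈ M.R) (hg : g ∈ M.R) :
    M.pairing f (fun s => M.del s (g s)) = 0 := by
  obtain ⟨N, hN⟩ := L.exists_le_latt
  obtain ⟨N', hN'⟩ := E.exists_latt_le
  obtain ⟨o, ho⟩ := MarkedCurve.exists_mem_latt g
  let T : M.K →ₗ[ℂ] M.K :=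
    { toFun := fun a => L.prR (g * (a - L.prR a))
      map_add' := fun a b => by rw [← map_add, ← mul_add, map_add]; congr 2; abel
      map_smul' := fun c a => by
        rw [RingHom.id_apply, ← map_smul, map_smul L.prR c a, ← smul_sub]
        congr 1
        ext s : 1
        simp only [Pi.mul_apply, Pi.smul_apply, ← HahnSeries.C_mul_eq_smul]
        ring }
  have hT : ∀ a, T a = L.prR (g * (a - L.prR a)) := fun _ => rfl
  have hTR : ∀ a ∈ M.R, T a = 0 := fun a ha => by
    rw [hT, L.prR_of_mem ha, sub_self, mul_zero, map_zero]
  have hT0 : ∀ a ∈ M.latt (max N' (N' - o)), T a = 0 := fun a ha => by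
    rw [hT, L.prR_eq_zero (hN' (MarkedCurve.latt_anti (le_max_left _ _) ha)), sub_zero]
    exact L.prR_eq_zero (hN' (MarkedCurve.latt_anti (by omega) (MarkedCurve.mul_mem_latt ho ha)))
  have hmem : ∀ a, T a ∈ M.R := fun a => L.prR_mem _
  -- The space `gΛ` lies in a lattice, which is finite-dimensional modulo a lattice inside `Λ`, and
  -- `π` kills the latter.
  have hfin : (LinearMap.range T).FG := by
    obtain ⟨F, hF, -, h⟩ := MarkedCurve.latt_le_fg_sup hP (o + N) N'
    have hle : LinearMap.range T ≤ F.map L.prR := by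
      rintro _ ⟨a, rfl⟩
      obtain ⟨x, hx, y, hy, hxy⟩ :=
        Submodule.mem_sup.1 (h (MarkedCurve.mul_mem_latt ho (hN (L.sub_prR_mem a))))
      exact ⟨x, hx, by rw [hT, ← hxy, map_add, L.prR_eq_zero (hN' hy), add_zero]⟩
    have : FiniteDimensional ℂ (F.map L.prR) := Module.Finite.iff_fg.2 (hF.map _)
    exact Module.Finite.iff_fg.1 (Submodule.finiteDimensional_of_le hle)
  have : FiniteDimensional ℂ (LinearMap.range T) := Module.Finite.iff_fg.2 hfin
  let b := Module.finBasis ℂ (LinearMap.range T)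
  let l := fun k => b.coord k ∘ₗ T.rangeRestrict
  have hsum : ∀ a, T a = ∑ k, l k a • (b k : M.K) := by
    intro a
    have := congrArg Subtype.val (b.sum_repr (T.rangeRestrict a))
    rw [Submodule.coe_sum] at this
    exact this.symm
  have hl : ∀ k a, T a = 0 → l k a = 0 := by
    intro k a h
    have : T.rangeRestrict a = 0 := Subtype.ext h
    rw [LinearMap.comp_apply, this, map_zero]
  choose c hc using fun k => MarkedCurve.exists_pairing_eq hP (l k) fun a ha => hl k a (hT0 a ha)
  have hbR : ∀ k, (b k : M.K) ∈ M.R := fun k => by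
    obtain ⟨a, ha⟩ := (b k).2
    rw [← ha]; exact hmem a
  -- For `x` the dual monomial of index `n`, the coefficient of `wⁿ` on the left is `π(gx) - gπ(x)`,
  -- which is `T x` since `gπ(x) ∈ R`. Multiplication by `g(w)` mixes the indices `n`, so it is
  -- computed for a fixed power of `z`, through the element `d` representing that coefficient of
  -- `π`.
  have key : ∀ s, (tens (g s) 1 - tens 1 (g s)) * E.green s s =
      ∑ k, tens ((b k : M.K) s) (c k s) := by
    intro s
    ext n m
    obtain ⟨d, hd⟩ := MarkedCurve.exists_pairing_eq hP
      ((HahnSeries.coeff.linearMap (R := ℂ) m ∘ₗ LinearMap.proj s) ∘ₗ L.prR)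
      (fun a ha => by rw [LinearMap.comp_apply, L.prR_eq_zero (hN' ha), map_zero])
    have hd' : ∀ a, (L.prR a s).coeff m = M.pairing d a := hd
    have hcol : col m (E.green s s) = -d s := by
      ext i
      rw [coeff_col, E.coeff_green hP, HahnSeries.coeff_neg, hd',
        MarkedCurve.pairing_dualMonomial hP, HahnSeries.coeff_neg]
    have h1 : (g s * d s).coeff n = (L.prR (g * M.dualMonomial s n) s).coeff m := by
      rw [hd', ← M.pairing_mul_left, MarkedCurve.pairing_dualMonomial hP, mul_comm]
      rfl
    have h2 : L.prR (g * M.dualMonomial s n) =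
        g * L.prR (M.dualMonomial s n) + T (M.dualMonomial s n) := by
      rw [hT, mul_sub, map_sub, L.prR_of_mem (hmul g hg _ (L.prR_mem _))]
      abel
    have h3 : (∑ k, tens ((b k : M.K) s) (c k s)).coeff n = T (M.dualMonomial s n) s := by
      rw [hsum, HahnSeries.coeff_sum, Finset.sum_apply]
      refine Finset.sum_congr rfl fun k _ => ?_
      rw [coeff_tens, Pi.smul_apply, hc, MarkedCurve.pairing_dualMonomial hP]
    rw [h3, sub_mul, HahnSeries.coeff_sub, HahnSeries.coeff_sub, coeff_C_mul, coeff_tens_one_mul,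
      hcol, E.coeff_green hP, mul_neg, mul_neg, HahnSeries.coeff_neg, HahnSeries.coeff_neg, h1, h2,
      Pi.add_apply, HahnSeries.coeff_add, Pi.mul_apply]
    ring
  -- Writing `g(z) - g(w) = (z - w)q` moves the factor `z - w` onto `G`, making both factors
  -- regular: on the diagonal `q` becomes `g'` and `(z - w)G` becomes `-P`.
  have hdiag : (fun s => M.del s (g s)) = -∑ k, (b k : M.K) * c k := by
    ext s : 1
    obtain ⟨q, hq, h, hqd⟩ := exists_divided_difference (g s)
    have h1 := key s
    rw [← h, mul_comm zw, mul_assoc, E.zw_mul_green] at h1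
    have h2 := congrArg diag h1
    have hr := mul_mem zw_mem (E.greenReg_mem hP s)
    rw [diag_mul hq (add_mem (neg_mem (tens_mem _ _)) hr), diag_add (neg_mem (tens_mem _ _)) hr,
      diag_neg (tens_mem _ _), diag_tens, diag_zw_mul (E.greenReg_mem hP s), hqd,
      diag_sum _ fun k _ => tens_mem _ _] at h2
    rw [Pi.neg_apply, Finset.sum_apply]
    simp only [diag_tens] at h2
    simp only [Pi.mul_apply, ← h2]
    change (M.density s)⁻¹ * _ = _
    ring
  rw [hdiag, M.pairing_comm, ← M.pairingLin_apply, map_neg, map_sum, neg_eq_zero]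
  refine Finset.sum_eq_zero fun k _ => ?_
  rw [M.pairingLin_apply, mul_comm, M.pairing_mul_left, ← hc]
  exact hl k _ (hTR _ (hmul _ (hbR k) _ hf))

end DualBases

end CurveKernel

namespace CurveKernel

/-! ### Laurent expansions of meromorphic functions -/

theorem hasSum_shift_iff {a : Laurent ℂ} {N : ℤ} (hN : ∀ n < N, a.coeff n = 0) (t w : ℂ) :
    HasSum (fun n : ℤ => a.coeff n * t ^ n) w ↔
      HasSum (fun n : ℕ => a.coeff (N + n) * t ^ (N + n)) w := by
  have hinj : Function.Injective (fun n : ℕ => N + (n : ℤ)) := fun m n h => by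
    simpa using h
  rw [← hinj.hasSum_iff]
  · rfl
  · intro n hn
    rw [hN, zero_mul]
    by_contra h
    exact hn ⟨(n - N).toNat, by simp only; omega⟩

theorem hasSum_zpow_iff {c : ℕ → ℂ} (N : ℤ) {t : ℂ} (ht : t ≠ 0) (w : ℂ) :
    HasSum (fun n : ℕ => c n * t ^ (N + n)) (t ^ N * w) ↔ HasSum (fun n : ℕ => c n * t ^ n) w := by
  rw [← hasSum_mul_left_iff (zpow_ne_zero N ht) (f := fun n : ℕ => c n * t ^ n)]
  refine iff_of_eq (congrArg₂ (fun f v => HasSum f v) (funext fun n => ?_) rfl)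
  rw [zpow_add₀ ht, zpow_natCast]
  ring

theorem eventually_punctured_ne_zero : ∀ᶠ t : ℂ in 𝓝[≠] 0, t ≠ 0 :=
  eventually_mem_nhdsWithin

theorem hasFPowerSeriesAt_ofScalars_iff {g : ℂ → ℂ} {c : ℕ → ℂ} :
    HasFPowerSeriesAt g (FormalMultilinearSeries.ofScalars ℂ c) 0 ↔
      ∀ᶠ t in 𝓝 (0 : ℂ), HasSum (fun n => c n * t ^ n) (g t) := by
  rw [hasFPowerSeriesAt_iff]
  simp [FormalMultilinearSeries.coeff_ofScalars, mul_comm]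

/-- Splitting off `t^N` reduces Laurent expansions to ordinary power series, for which analyticity
and uniqueness are available. -/
theorem hasLaurentExpansion_iff {f : ℂ → ℂ} {a : Laurent ℂ} {N : ℤ}
    (hN : ∀ n < N, a.coeff n = 0) :
    HasLaurentExpansion f a ↔ ∃ g : ℂ → ℂ, HasFPowerSeriesAt g
      (FormalMultilinearSeries.ofScalars ℂ fun n : ℕ => a.coeff (N + n)) 0 ∧
      f =ᶠ[𝓝[≠] 0] fun t => t ^ N * g t := by
  constructor
  · intro h
    have h1 : ∀ᶠ t in 𝓝[≠] (0 : ℂ),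
        HasSum (fun n : ℕ => a.coeff (N + n) * t ^ n) (t ^ (-N) * f t) := by
      filter_upwards [h, eventually_punctured_ne_zero] with t ht h0
      rw [← hasSum_zpow_iff N h0, ← mul_assoc, ← zpow_add₀ h0, add_neg_cancel, zpow_zero, one_mul]
      exact (hasSum_shift_iff hN _ _).1 ht
    refine ⟨fun t => ∑' n : ℕ, a.coeff (N + n) * t ^ n, ?_, ?_⟩
    · rw [hasFPowerSeriesAt_ofScalars_iff]
      have h2 := eventually_nhdsWithin_iff.1 h1
      filter_upwards [h2] with t ht
      -- The expansion says nothing at the centre, but there only the constant term of the series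
      -- survives.
      by_cases h0 : t = 0
      · refine (summable_of_hasFiniteSupport ((Set.finite_singleton 0).subset ?_)).hasSum
        intro n hn
        by_contra hn'
        exact hn (by simp [h0, show n ≠ 0 from hn'])
      · exact (ht h0).summable.hasSum
    · filter_upwards [h1, eventually_punctured_ne_zero] with t ht h0
      rw [ht.tsum_eq, ← mul_assoc, ← zpow_add₀ h0, add_neg_cancel, zpow_zero, one_mul]
  · rintro ⟨g, hg, hf⟩
    rw [hasFPowerSeriesAt_ofScalars_iff] at hg
    filter_upwards [hf, hg.filter_mono nhdsWithin_le_nhds, eventually_punctured_ne_zero]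
      with t h1 h2 h0
    rw [h1, hasSum_shift_iff hN, hasSum_zpow_iff N h0]
    exact h2

theorem HasLaurentExpansion.congr {f g : ℂ → ℂ} {a : Laurent ℂ} (h : HasLaurentExpansion f a)
    (hfg : f =ᶠ[𝓝[≠] 0] g) : HasLaurentExpansion g a := by
  filter_upwards [h, hfg] with t h1 h2
  rwa [← h2]

theorem HasLaurentExpansion.meromorphicAt {f : ℂ → ℂ} {a : Laurent ℂ}
    (h : HasLaurentExpansion f a) : MeromorphicAt f 0 := by
  obtain ⟨N, hN⟩ := exists_bound a
  obtain ⟨g, hg, hf⟩ := (hasLaurentExpansion_iff hN).1 h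
  refine MeromorphicAt.congr ?_ hf.symm
  exact ((MeromorphicAt.id 0).zpow N).mul hg.analyticAt.meromorphicAt

theorem exists_hasLaurentExpansion {f : ℂ → ℂ} (hf : MeromorphicAt f 0) :
    ∃ a, HasLaurentExpansion f a := by
  obtain ⟨N, g, hg, h⟩ := MeromorphicAt.iff_eventuallyEq_zpow_smul_analyticAt.1 hf
  let c : ℕ → ℂ := fun n => iteratedDeriv n g 0 / n.factorial
  let F : ℤ → ℂ := fun n => if N ≤ n then c (n - N).toNat else 0
  have hF : BddBelow (Function.support F) := ⟨N, fun n hn => by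
    by_contra h
    exact hn (if_neg h)⟩
  refine ⟨HahnSeries.ofSuppBddBelow F hF, ?_⟩
  refine (hasLaurentExpansion_iff (N := N) fun n hn => if_neg (not_le.2 hn)).2 ⟨g, ?_, ?_⟩
  · have : (fun n : ℕ => (HahnSeries.ofSuppBddBelow F hF).coeff (N + n)) = c := by
      funext n
      show F (N + n) = c n
      simp [F]
    rw [this]
    exact hg.hasFPowerSeriesAt
  · filter_upwards [h] with t ht
    simpa using ht

theorem hasLaurentExpansion_laurentExpansion {f : ℂ → ℂ} (hf : MeromorphicAt f 0) :
    HasLaurentExpansion f (laurentExpansion f) := by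
  have h := exists_hasLaurentExpansion hf
  rw [laurentExpansion, dif_pos h]
  exact h.choose_spec

theorem HasLaurentExpansion.add {f g : ℂ → ℂ} {a b : Laurent ℂ} (hf : HasLaurentExpansion f a)
    (hg : HasLaurentExpansion g b) : HasLaurentExpansion (fun t => f t + g t) (a + b) := by
  filter_upwards [hf, hg] with t h1 h2
  simpa [add_mul] using h1.add h2

theorem HasLaurentExpansion.const_mul {f : ℂ → ℂ} {a : Laurent ℂ} (hf : HasLaurentExpansion f a)
    (c : ℂ) : HasLaurentExpansion (fun t => c * f t) (c • a) := by
  filter_upwards [hf] with t h1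
  simpa [mul_assoc] using h1.mul_left c

theorem HasLaurentExpansion.sub {f g : ℂ → ℂ} {a b : Laurent ℂ} (hf : HasLaurentExpansion f a)
    (hg : HasLaurentExpansion g b) : HasLaurentExpansion (fun t => f t - g t) (a - b) := by
  filter_upwards [hf, hg] with t h1 h2
  simpa [sub_mul] using h1.sub h2

theorem coeff_mul_antidiagonal {A : Type*} [Ring A] {f g : LaurentSeries A} {a b : ℤ}
    (hf : ∀ n < a, f.coeff n = 0) (hg : ∀ n < b, g.coeff n = 0) (n : ℕ) :
    (f * g).coeff (a + b + n) = ∑ p ∈ Finset.HasAntidiagonal.antidiagonal n,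
      f.coeff (a + p.1) * g.coeff (b + p.2) := by
  rw [coeff_mul_Icc hf hg]
  symm
  refine Finset.sum_nbij (fun p => a + (p.1 : ℤ)) ?_ ?_ ?_ ?_
  · rintro ⟨i, j⟩ h
    rw [Finset.HasAntidiagonal.mem_antidiagonal] at h
    simp only [Finset.mem_Icc] at h ⊢
    omega
  · rintro ⟨i, j⟩ h ⟨i', j'⟩ h' e
    simp only [Finset.mem_coe, Finset.HasAntidiagonal.mem_antidiagonal] at h h' e
    ext <;> simp only <;> omega
  · intro i hi
    simp only [Finset.coe_Icc, Set.mem_Icc] at hi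
    refine ⟨((i - a).toNat, (a + n - i).toNat), ?_, ?_⟩
    · simp only [Finset.mem_coe, Finset.HasAntidiagonal.mem_antidiagonal]
      omega
    · simp only; omega
  · rintro ⟨i, j⟩ h
    simp only [Finset.HasAntidiagonal.mem_antidiagonal] at h
    simp only
    congr 2
    omega

theorem HasLaurentExpansion.mul {f g : ℂ → ℂ} {a b : Laurent ℂ} (hf : HasLaurentExpansion f a)
    (hg : HasLaurentExpansion g b) : HasLaurentExpansion (fun t => f t * g t) (a * b) := by
  obtain ⟨N, hN⟩ := exists_bound a
  obtain ⟨N', hN'⟩ := exists_bound b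
  filter_upwards [hf, hg, eventually_punctured_ne_zero] with t h1 h2 h0
  rw [hasSum_shift_iff hN] at h1
  rw [hasSum_shift_iff hN'] at h2
  rw [hasSum_shift_iff (coeff_mul_eq_zero hN hN'), ← h1.tsum_eq, ← h2.tsum_eq,
    tsum_mul_tsum_eq_tsum_sum_antidiagonal_of_summable_norm h1.summable.norm h2.summable.norm]
  have hs := (summable_norm_sum_mul_antidiagonal_of_summable_norm h1.summable.norm
    h2.summable.norm).of_norm.hasSum
  refine (iff_of_eq (congrArg₂ (fun F v => HasSum F v) (funext fun n => ?_) rfl)).1 hs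
  symm
  rw [coeff_mul_antidiagonal hN hN', Finset.sum_mul]
  refine Finset.sum_congr rfl fun p hp => ?_
  rw [Finset.HasAntidiagonal.mem_antidiagonal] at hp
  rw [mul_mul_mul_comm, ← zpow_add₀ h0, ← hp]
  congr 2
  push_cast
  ring

theorem HasLaurentExpansion.eq_zero {f : ℂ → ℂ} {a : Laurent ℂ} (h : HasLaurentExpansion f a)
    (hf : ∀ᶠ t in 𝓝[≠] 0, f t = 0) : a = 0 := by
  obtain ⟨N, hN⟩ := exists_bound a
  obtain ⟨g, hg, hfg⟩ := (hasLaurentExpansion_iff hN).1 h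
  have h1 : ∀ᶠ t in 𝓝[≠] (0 : ℂ), g t = 0 := by
    filter_upwards [hf, hfg, eventually_punctured_ne_zero] with t h1 h2 h0
    exact (mul_eq_zero.1 (h2.symm.trans h1)).resolve_left (zpow_ne_zero N h0)
  have h2 : ∀ᶠ t in 𝓝 (0 : ℂ), g t = 0 :=
    (hg.analyticAt.frequently_zero_iff_eventually_zero).1 h1.frequently
  have h3 := hg.eq_zero_of_eventually h2
  rw [FormalMultilinearSeries.ofScalars_series_eq_zero] at h3
  apply HahnSeries.ext
  funext n
  by_cases hn : n < N
  · exact hN n hn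
  · have := congrFun h3 (n - N).toNat
    rwa [show N + ((n - N).toNat : ℤ) = n by omega] at this

theorem HasLaurentExpansion.eventually_eq_zero {f : ℂ → ℂ} (h : HasLaurentExpansion f 0) :
    ∀ᶠ t in 𝓝[≠] 0, f t = 0 := by
  filter_upwards [h] with t ht
  simp only [HahnSeries.coeff_zero, zero_mul] at ht
  exact ht.unique hasSum_zero

theorem HasLaurentExpansion.unique {f : ℂ → ℂ} {a b : Laurent ℂ} (ha : HasLaurentExpansion f a)
    (hb : HasLaurentExpansion f b) : a = b :=
  sub_eq_zero.1 ((ha.sub hb).eq_zero (Eventually.of_forall fun _ => sub_self _))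

/-- A nonzero expansion means that `f` is nonzero near the centre, so `h = g/f` is meromorphic
there; its expansion is then found by uniqueness. -/
theorem HasLaurentExpansion.of_mul {f g h : ℂ → ℂ} {a b : Laurent ℂ}
    (hf : HasLaurentExpansion f a) (hg : HasLaurentExpansion g b) (ha : a ≠ 0)
    (hfg : ∀ᶠ t in 𝓝[≠] 0, f t * h t = g t) : HasLaurentExpansion h (a⁻¹ * b) := by
  have hm : MeromorphicAt h 0 := by
    refine (hg.meromorphicAt.div hf.meromorphicAt).congr ?_
    rcases hf.meromorphicAt.eventually_eq_zero_or_eventually_ne_zero with h0 | h0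
    · exact absurd (hf.eq_zero h0) ha
    · filter_upwards [h0, hfg] with t h1 h2
      simp only [Pi.div_apply]
      rw [← h2, mul_div_cancel_left₀ _ h1]
  obtain ⟨c, hc⟩ := exists_hasLaurentExpansion hm
  have := ((hf.mul hc).congr hfg).unique hg
  rwa [← this, inv_mul_cancel_left₀ ha]

theorem hasLaurentExpansion_const (c : ℂ) : HasLaurentExpansion (fun _ => c) (HahnSeries.C c) := by
  refine Eventually.of_forall fun t => ?_
  convert hasSum_single (0 : ℤ) ?_ using 1
  · simp
  · intro n hn
    rw [HahnSeries.C_apply, HahnSeries.coeff_single_of_ne hn, zero_mul]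

theorem hasLaurentExpansion_zpow (N : ℤ) :
    HasLaurentExpansion (fun t => t ^ N) (HahnSeries.single N 1) := by
  refine Eventually.of_forall fun t => ?_
  convert hasSum_single N ?_ using 1
  · simp
  · intro n hn
    rw [HahnSeries.coeff_single_of_ne hn, zero_mul]

theorem HasLaurentExpansion.deriv {f : ℂ → ℂ} {a : Laurent ℂ} (h : HasLaurentExpansion f a) :
    HasLaurentExpansion (deriv f) (LaurentSeries.derivative ℂ a) := by
  obtain ⟨N, hN⟩ := exists_bound a
  obtain ⟨g, hg, hfg⟩ := (hasLaurentExpansion_iff hN).1 h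
  have hga := hg.analyticAt
  have hc : ∀ n : ℕ, a.coeff (N + n) = iteratedDeriv n g 0 / n.factorial := fun n =>
    congrFun (FormalMultilinearSeries.ofScalars_series_injective ℂ ℂ
      (hg.eq_formalMultilinearSeries hga.hasFPowerSeriesAt)) n
  have hb0 : ∀ n < (0 : ℤ), (HahnSeries.single (-N) 1 * a).coeff n = 0 := fun n hn => by
    rw [HahnSeries.coeff_single_mul, hN _ (by omega), mul_zero]
  have hbc : ∀ n : ℤ, (HahnSeries.single (-N) 1 * a).coeff n = a.coeff (N + n) := fun n => by
    rw [HahnSeries.coeff_single_mul, one_mul]; congr 1; ring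
  -- The analytic factor `g` has series `t^{-N}a`, differentiated through its Taylor coefficients.
  -- The Leibniz rule for `t^N g` then gives the derivative of `f`.
  have hb : HasLaurentExpansion g (HahnSeries.single (-N) 1 * a) := by
    rw [hasLaurentExpansion_iff hb0]
    refine ⟨g, ?_, Eventually.of_forall fun t => by simp⟩
    simp only [hbc, zero_add]
    exact hg
  have hb' : HasLaurentExpansion (_root_.deriv g)
      (LaurentSeries.derivative ℂ (HahnSeries.single (-N) 1 * a)) := by
    have hd : ∀ n < (0 : ℤ),
        (LaurentSeries.derivative ℂ (HahnSeries.single (-N) 1 * a)).coeff n = 0 := fun n hn => by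
      rw [coeff_derivative]
      rcases eq_or_ne n (-1) with rfl | h1
      · simp
      · rw [hb0 _ (by omega), smul_zero]
    rw [hasLaurentExpansion_iff hd]
    refine ⟨_root_.deriv g, ?_, Eventually.of_forall fun t => by simp⟩
    have hcoef : (fun n : ℕ => (LaurentSeries.derivative ℂ
        (HahnSeries.single (-N) 1 * a)).coeff (0 + n)) =
        fun n : ℕ => iteratedDeriv n (_root_.deriv g) 0 / n.factorial := ?_
    · rw [hcoef]
      exact hga.deriv.hasFPowerSeriesAt
    funext n
    rw [coeff_derivative, hbc, show N + (0 + (n : ℤ) + 1) = N + ((n + 1 : ℕ) : ℤ) by push_cast; ring,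
      hc, ← iteratedDeriv_succ', Nat.factorial_succ]
    have h1 : ((n : ℂ) + 1) ≠ 0 := by exact_mod_cast n.succ_ne_zero
    have h2 : (n.factorial : ℂ) ≠ 0 := by exact_mod_cast n.factorial_ne_zero
    rw [zero_add, zsmul_eq_mul]
    push_cast
    rw [mul_div_assoc', mul_div_mul_left _ _ h1]
  have hz := hasLaurentExpansion_zpow N
  have hz' := (hasLaurentExpansion_zpow (N - 1)).const_mul (N : ℂ)
  have key := (hz'.mul hb).add (hz.mul hb')
  have e : LaurentSeries.derivative ℂ a =
      ((N : ℂ) • HahnSeries.single (N - 1) 1) * (HahnSeries.single (-N) 1 * a) +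
      HahnSeries.single N 1 * LaurentSeries.derivative ℂ (HahnSeries.single (-N) 1 * a) := by
    have e1 : a = HahnSeries.single N 1 * (HahnSeries.single (-N) 1 * a) := by
      rw [← mul_assoc, HahnSeries.single_mul_single]
      simp
    have e2 : LaurentSeries.derivative ℂ (HahnSeries.single N 1 : Laurent ℂ) =
        (N : ℂ) • HahnSeries.single (N - 1) 1 := by
      apply HahnSeries.ext
      funext n
      rw [coeff_derivative, HahnSeries.coeff_smul, HahnSeries.coeff_single, HahnSeries.coeff_single]
      split_ifs with h1 h2 h2
      · subst h1; simp
      · omega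
      · omega
      · simp
    conv_lhs => rw [e1, derivative_mul, e2]
  rw [e]
  refine key.congr ?_
  have hfg' : ∀ᶠ t in 𝓝[≠] (0 : ℂ), f =ᶠ[𝓝 t] fun t => t ^ N * g t := by
    have := eventually_eventually_nhdsWithin.2 hfg
    filter_upwards [this, eventually_punctured_ne_zero] with t h1 h0
    rwa [IsOpen.nhdsWithin_eq isOpen_compl_singleton h0] at h1
  filter_upwards [hfg', hga.eventually_analyticAt.filter_mono nhdsWithin_le_nhds,
    eventually_punctured_ne_zero] with t h1 h2 h0
  rw [h1.deriv_eq]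
  exact (((hasDerivAt_zpow N t (Or.inl h0)).mul h2.differentiableAt.hasDerivAt).deriv).symm

end CurveKernel

namespace CurveKernel

/-! ### Functions and differentials on a complex curve in local coordinates -/

section Curve

variable {X : Type*} [TopologicalSpace X]

theorem eventually_punctured_chart (e : OpenPartialHomeomorph X ℂ) {x : X} (hx : x ∈ e.source)
    (p : X → Prop) : (∀ᶠ z in 𝓝[≠] (e x), p (e.symm z)) ↔ ∀ᶠ y in 𝓝[≠] x, p y := by
  rw [← e.eventually_nhdsWithin' p hx]
  refine iff_of_eq (congrArg (fun F => ∀ᶠ z in F, p (e.symm z)) ?_)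
  refine nhdsWithin_eq_nhdsWithin (e.map_source hx) e.open_target ?_
  ext z
  simp only [Set.mem_inter_iff, Set.mem_compl_iff, Set.mem_singleton_iff, Set.mem_preimage]
  refine and_congr_left fun hz => not_congr ⟨fun h => ?_, fun h => ?_⟩
  · rw [h, e.left_inv hx]
  · rw [← h, e.right_inv hz]

theorem nhdsNE_neBot_of_chart [ChartedSpace ℂ X] (x : X) : (𝓝[≠] x).NeBot := by
  have h := eventually_punctured_chart (chartAt ℂ x) (mem_chart_source ℂ x) fun _ => False
  rw [Filter.neBot_iff, Ne, ← Filter.eventually_false_iff_eq_bot, ← h,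
    Filter.eventually_false_iff_eq_bot]
  exact NeBot.ne inferInstance

/-- A meromorphic function on a connected curve vanishes identically or has isolated zeros. -/
theorem eventually_zero_or_ne_zero [T1Space X] [ConnectedSpace X] [ChartedSpace ℂ X] {f : X → ℂ}
    (hf : ∀ x, ∃ e : OpenPartialHomeomorph X ℂ, x ∈ e.source ∧
      MeromorphicAt (f ∘ e.symm) (e x)) :
    (∀ x, ∀ᶠ y in 𝓝[≠] x, f y = 0) ∨ (∀ x, ∀ᶠ y in 𝓝[≠] x, f y ≠ 0) := by
  have hor : ∀ x, (∀ᶠ y in 𝓝[≠] x, f y = 0) ∨ (∀ᶠ y in 𝓝[≠] x, f y ≠ 0) := by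
    intro x
    obtain ⟨e, hx, h⟩ := hf x
    rw [← eventually_punctured_chart e hx, ← eventually_punctured_chart e hx]
    exact h.eventually_eq_zero_or_eventually_ne_zero
  have hopen : ∀ p : X → Prop, IsOpen {x | ∀ᶠ y in 𝓝[≠] x, p y} := by
    intro p
    rw [isOpen_iff_mem_nhds]
    intro x hx
    have h1 := eventually_nhdsWithin_iff.1 (eventually_eventually_nhdsWithin.2 hx)
    filter_upwards [h1] with y hy
    by_cases hyx : y = x
    · rw [hyx]; exact hx
    · have := hy hyx
      rw [IsOpen.nhdsWithin_eq isOpen_compl_singleton hyx] at this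
      exact this.filter_mono nhdsWithin_le_nhds
  have hcompl : {x | ∀ᶠ y in 𝓝[≠] x, f y = 0}ᶜ = {x | ∀ᶠ y in 𝓝[≠] x, f y ≠ 0} := by
    ext x
    refine ⟨fun h => (hor x).resolve_left h, fun h h' => ?_⟩
    have := nhdsNE_neBot_of_chart x
    obtain ⟨y, h1, h2⟩ := ((show ∀ᶠ y in 𝓝[≠] x, f y = 0 from h').and h).exists
    exact h2 h1
  have hclopen : IsClopen {x | ∀ᶠ y in 𝓝[≠] x, f y = 0} :=
    ⟨isOpen_compl_iff.1 (hcompl ▸ hopen _), hopen _⟩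
  rcases isClopen_iff.1 hclopen with h | h
  · refine Or.inr fun x => ?_
    have : x ∈ {x | ∀ᶠ y in 𝓝[≠] x, f y = 0}ᶜ := by rw [h]; exact fun h => h
    rw [hcompl] at this
    exact this
  · refine Or.inl fun x => ?_
    have : x ∈ {x | ∀ᶠ y in 𝓝[≠] x, f y = 0} := by rw [h]; trivial
    exact this

variable [ChartedSpace ℂ X] {e e' : OpenPartialHomeomorph X ℂ}

theorem mdifferentiableAt_chart_symm
    (he : e ∈ IsManifold.maximalAtlas 𝓘(ℂ, ℂ) (⊤ : WithTop ℕ∞) X) {z : ℂ} (hz : z ∈ e.target) :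
    MDifferentiableAt 𝓘(ℂ, ℂ) 𝓘(ℂ, ℂ) e.symm z :=
  (contMDiffAt_symm_of_mem_maximalAtlas he hz).mdifferentiableAt (by simp)

theorem mdifferentiableAt_chart
    (he : e ∈ IsManifold.maximalAtlas 𝓘(ℂ, ℂ) (⊤ : WithTop ℕ∞) X) {x : X} (hx : x ∈ e.source) :
    MDifferentiableAt 𝓘(ℂ, ℂ) 𝓘(ℂ, ℂ) e x :=
  (contMDiffAt_of_mem_maximalAtlas he hx).mdifferentiableAt (by simp)

theorem deriv_comp_chart_symm
    (he : e ∈ IsManifold.maximalAtlas 𝓘(ℂ, ℂ) (⊤ : WithTop ℕ∞) X) {z : ℂ} (hz : z ∈ e.target)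
    {f : X → ℂ} (hf : MDifferentiableAt 𝓘(ℂ, ℂ) 𝓘(ℂ, ℂ) f (e.symm z)) :
    deriv (f ∘ e.symm) z = mfderiv 𝓘(ℂ, ℂ) 𝓘(ℂ, ℂ) f (e.symm z)
      (mfderiv 𝓘(ℂ, ℂ) 𝓘(ℂ, ℂ) e.symm z (1 : ℂ)) := by
  have h := mfderiv_comp (I := 𝓘(ℂ, ℂ)) (I' := 𝓘(ℂ, ℂ)) (I'' := 𝓘(ℂ, ℂ)) z hf
    (mdifferentiableAt_chart_symm he hz)
  rw [mfderiv_eq_fderiv] at h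
  exact DFunLike.congr_fun h (1 : ℂ)

theorem differentiableAt_comp_chart_symm
    (he : e ∈ IsManifold.maximalAtlas 𝓘(ℂ, ℂ) (⊤ : WithTop ℕ∞) X) {z : ℂ} (hz : z ∈ e.target)
    {f : X → ℂ} (hf : MDifferentiableAt 𝓘(ℂ, ℂ) 𝓘(ℂ, ℂ) f (e.symm z)) :
    DifferentiableAt ℂ (f ∘ e.symm) z :=
  (MDifferentiableAt.comp z hf (mdifferentiableAt_chart_symm he hz)).differentiableAt

theorem analyticAt_comp_chart_symm
    (he : e ∈ IsManifold.maximalAtlas 𝓘(ℂ, ℂ) (⊤ : WithTop ℕ∞) X) {x : X} (hx : x ∈ e.source)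
    {f : X → ℂ} (hf : ∀ᶠ y in 𝓝 x, MDifferentiableAt 𝓘(ℂ, ℂ) 𝓘(ℂ, ℂ) f y) :
    AnalyticAt ℂ (f ∘ e.symm) (e x) := by
  rw [Complex.analyticAt_iff_eventually_differentiableAt]
  rw [← e.eventually_nhds' _ hx] at hf
  filter_upwards [hf, e.open_target.mem_nhds (e.map_source hx)] with z h1 h2
  exact differentiableAt_comp_chart_symm he h2 h1

/-- The change of coordinates for a differential. -/
theorem localDensity_eq_mul_deriv (om : Differential X)
    (he : e ∈ IsManifold.maximalAtlas 𝓘(ℂ, ℂ) (⊤ : WithTop ℕ∞) X)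
    (he' : e' ∈ IsManifold.maximalAtlas 𝓘(ℂ, ℂ) (⊤ : WithTop ℕ∞) X)
    {z : ℂ} (hz : z ∈ e.target) (hz' : e.symm z ∈ e'.source) :
    localDensity om e z = deriv (e' ∘ e.symm) z * localDensity om e' (e' (e.symm z)) := by
  have hloc : (e'.symm ∘ (e' ∘ e.symm)) =ᶠ[𝓝 z] e.symm := by
    filter_upwards [e.open_target.mem_nhds hz,
      (e.continuousAt_symm hz).preimage_mem_nhds (e'.open_source.mem_nhds hz')] with w _ h
    exact e'.left_inv h
  have hd := differentiableAt_comp_chart_symm he hz (mdifferentiableAt_chart he' hz')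
  have h := mfderiv_comp (I := 𝓘(ℂ, ℂ)) (I' := 𝓘(ℂ, ℂ)) (I'' := 𝓘(ℂ, ℂ)) (f := e' ∘ e.symm)
    (g := e'.symm) z (mdifferentiableAt_chart_symm he' (e'.map_source hz'))
    hd.mdifferentiableAt
  have h2 : mfderiv 𝓘(ℂ, ℂ) 𝓘(ℂ, ℂ) e.symm z =
      mfderiv 𝓘(ℂ, ℂ) 𝓘(ℂ, ℂ) (e'.symm ∘ (e' ∘ e.symm)) z := hloc.symm.mfderiv_eq
  -- All tangent spaces are identified with `ℂ`, so that the differentials become multiplications by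
  -- scalars and linearity can be applied.
  let om' : X → (ℂ →L[ℂ] ℂ) := om
  let T : ℂ → (ℂ →L[ℂ] ℂ) := fun w => mfderiv 𝓘(ℂ, ℂ) 𝓘(ℂ, ℂ) e.symm w
  let T' : ℂ → (ℂ →L[ℂ] ℂ) := fun w => mfderiv 𝓘(ℂ, ℂ) 𝓘(ℂ, ℂ) e'.symm w
  have h3 : T z 1 = T' (e' (e.symm z)) (deriv (e' ∘ e.symm) z) := by
    rw [mfderiv_eq_fderiv] at h
    exact (DFunLike.congr_fun (h2.trans h) (1 : ℂ))
  show om' (e.symm z) (T z 1) = _ * om' (e'.symm (e' (e.symm z))) (T' (e' (e.symm z)) 1)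
  rw [h3, e'.left_inv hz', ← smul_eq_mul, ← map_smul, ← map_smul, smul_eq_mul, mul_one]

theorem meromorphicAt_localDensity [IsManifold 𝓘(ℂ, ℂ) (⊤ : WithTop ℕ∞) X]
    {om : Differential X} (hom : IsMeromorphicDifferential om)
    (he : e ∈ IsManifold.maximalAtlas 𝓘(ℂ, ℂ) (⊤ : WithTop ℕ∞) X) {x : X} (hx : x ∈ e.source) :
    MeromorphicAt (localDensity om e) (e x) := by
  have hc : chartAt ℂ x ∈ IsManifold.maximalAtlas 𝓘(ℂ, ℂ) (⊤ : WithTop ℕ∞) X :=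
    IsManifold.chart_mem_maximalAtlas x
  have hτ : AnalyticAt ℂ (chartAt ℂ x ∘ e.symm) (e x) := analyticAt_comp_chart_symm he hx
    ((chartAt ℂ x).open_source.eventually_mem (mem_chart_source ℂ x) |>.mono
      fun y hy => mdifferentiableAt_chart hc hy)
  have hm := hom x
  have hx' : (chartAt ℂ x ∘ e.symm) (e x) = chartAt ℂ x x := by
    rw [Function.comp_apply, e.left_inv hx]
  rw [← hx'] at hm
  refine (hτ.deriv.meromorphicAt.mul (hm.comp_analyticAt hτ)).congr ?_
  have h1 := (e.eventually_nhds' _ hx).2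
    ((chartAt ℂ x).open_source.eventually_mem (mem_chart_source ℂ x))
  filter_upwards [(e.open_target.eventually_mem (e.map_source hx)).filter_mono nhdsWithin_le_nhds,
    h1.filter_mono nhdsWithin_le_nhds] with z h1 h2
  exact (localDensity_eq_mul_deriv om he hc h1 h2).symm

end Curve

end CurveKernel

namespace CurveKernel

/-! ### Elements of `R` as functions on the curve; stability under `∂` -/

namespace MarkedCurve

variable {X : Type*} [TopologicalSpace X] [ChartedSpace ℂ X]
  [IsManifold 𝓘(ℂ, ℂ) (⊤ : WithTop ℕ∞) X] (M : MarkedCurve X)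

theorem notMem_S_eventually [T1Space X] {x : X} (hx : x ∉ M.S) : ∀ᶠ y in 𝓝 x, y ∉ M.S :=
  M.S.finite_toSet.isClosed.isOpen_compl.eventually_mem hx

theorem notMem_S_eventually_punctured [T1Space X] (x : X) : ∀ᶠ y in 𝓝[≠] x, y ∉ M.S := by
  have h : ((M.S : Set X) \ {x})ᶜ ∈ 𝓝 x :=
    (M.S.finite_toSet.subset Set.sdiff_subset).isClosed.isOpen_compl.mem_nhds (by simp)
  filter_upwards [mem_nhdsWithin_of_mem_nhds h, eventually_mem_nhdsWithin] with y h1 h2 h3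
  exact h1 ⟨h3, h2⟩

theorem eventually_coord (s : M.S) (p : X → Prop) :
    (∀ᶠ z in 𝓝[≠] 0, p ((M.coord s).symm z)) ↔ ∀ᶠ y in 𝓝[≠] (s : X), p y := by
  rw [← eventually_punctured_chart _ (M.mem_coord_source s), M.coord_apply]

theorem hasLaurentExpansion_density (s : M.S) :
    HasLaurentExpansion (localDensity M.om (M.coord s)) (M.density s) := by
  have h := meromorphicAt_localDensity M.meromorphic (M.coord_mem_atlas s) (M.mem_coord_source s)
  rw [M.coord_apply] at h
  exact hasLaurentExpansion_laurentExpansion h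

/-- Otherwise `ω` vanishes identically near some point outside `S`, where its order would be `⊤`
instead of `0`. -/
theorem density_ne_zero [T1Space X] (s : M.S) : M.density s ≠ 0 := by
  intro h0
  have h1 : ∀ᶠ z in 𝓝[≠] (0 : ℂ), localDensity M.om (M.coord s) z = 0 := by
    have := M.hasLaurentExpansion_density s
    rw [h0] at this
    exact this.eventually_eq_zero
  have h2 : ∀ᶠ z in 𝓝[≠] (0 : ℂ), ∀ᶠ w in 𝓝 z, localDensity M.om (M.coord s) w = 0 := by
    filter_upwards [eventually_eventually_nhdsWithin.2 h1, eventually_punctured_ne_zero]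
      with z hz h0
    rwa [IsOpen.nhdsWithin_eq isOpen_compl_singleton h0] at hz
  have h3 : ∀ᶠ z in 𝓝[≠] (0 : ℂ), z ∈ (M.coord s).target := by
    have := (M.coord s).open_target.eventually_mem ((M.coord s).map_source (M.mem_coord_source s))
    rw [M.coord_apply] at this
    exact this.filter_mono nhdsWithin_le_nhds
  have h4 := (M.eventually_coord s _).2 (M.notMem_S_eventually_punctured (s : X))
  obtain ⟨z, hz, hzt, hzS⟩ := (h2.and (h3.and h4)).exists
  set y := (M.coord s).symm z with hy
  have hys : y ∈ (M.coord s).source := (M.coord s).map_target hzt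
  have hyz : M.coord s y = z := (M.coord s).right_inv hzt
  refine hzS (M.zeros_poles_mem y ?_)
  have h5 : diffOrder M.om y = ⊤ := by
    rw [diffOrder, meromorphicOrderAt_eq_top_iff]
    refine Eventually.filter_mono nhdsWithin_le_nhds ?_
    have hyc := mem_chart_source ℂ y
    have hcs := ((chartAt ℂ y).eventually_nhds' _ hyc).2
      (((M.coord s).open_source.eventually_mem hys).and
        (((M.coord s).continuousAt hys).eventually (hyz.symm ▸ hz)))
    filter_upwards [hcs, (chartAt ℂ y).open_target.eventually_mem
      ((chartAt ℂ y).map_source hyc)] with w h1 h2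
    rw [localDensity_eq_mul_deriv M.om (IsManifold.chart_mem_maximalAtlas y) (M.coord_mem_atlas s)
      h2 h1.1, h1.2, mul_zero]
  rw [h5]
  exact WithTop.top_ne_zero

theorem exists_density_eq {x : X} (hx : x ∉ M.S) : ∃ h : ℂ → ℂ, AnalyticAt ℂ h (chartAt ℂ x x) ∧
    h (chartAt ℂ x x) ≠ 0 ∧ localDensity M.om (chartAt ℂ x) =ᶠ[𝓝[≠] (chartAt ℂ x x)] h := by
  have h0 : diffOrder M.om x = ((0 : ℤ) : WithTop ℤ) := by
    by_contra h
    exact hx (M.zeros_poles_mem x h)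
  obtain ⟨h, h1, h2, h3⟩ := (meromorphicOrderAt_eq_int_iff (M.meromorphic x)).1 h0
  refine ⟨h, h1, h2, ?_⟩
  filter_upwards [h3] with z hz
  rw [hz, zpow_zero, one_smul]

/-- `f` is regular outside `S`, with Laurent expansions `a` at the points of `S`. -/
structure IsExpansion (a : M.K) (f : X → ℂ) : Prop where
  mdifferentiableOn : MDifferentiableOn 𝓘(ℂ, ℂ) 𝓘(ℂ, ℂ) f ((M.S : Set X)ᶜ)
  hasLaurentExpansion : ∀ s, HasLaurentExpansion (f ∘ (M.coord s).symm) (a s)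

variable {M}

theorem mem_R_iff {a : M.K} : a ∈ M.R ↔ ∃ f, M.IsExpansion a f :=
  ⟨fun ⟨f, h1, h2⟩ => ⟨f, h1, h2⟩, fun ⟨f, h1, h2⟩ => ⟨f, h1, h2⟩⟩

namespace IsExpansion

variable {a b : M.K} {f g : X → ℂ}

theorem mem_R (h : M.IsExpansion a f) : a ∈ M.R := mem_R_iff.2 ⟨f, h⟩

theorem mul (ha : M.IsExpansion a f) (hb : M.IsExpansion b g) :
    M.IsExpansion (a * b) (fun x => f x * g x) :=
  ⟨ha.1.mul hb.1, fun s => (ha.2 s).mul (hb.2 s)⟩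

theorem sub (ha : M.IsExpansion a f) (hb : M.IsExpansion b g) :
    M.IsExpansion (a - b) (fun x => f x - g x) :=
  ⟨ha.1.sub hb.1, fun s => (ha.2 s).sub (hb.2 s)⟩

theorem mdifferentiableAt_eventually [T1Space X] (h : M.IsExpansion a f) {x : X} (hx : x ∉ M.S) :
    ∀ᶠ y in 𝓝 x, MDifferentiableAt 𝓘(ℂ, ℂ) 𝓘(ℂ, ℂ) f y := by
  filter_upwards [M.notMem_S_eventually hx] with y hy
  exact (h.1 y hy).mdifferentiableAt (M.S.finite_toSet.isClosed.isOpen_compl.mem_nhds hy)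

theorem analyticAt [T1Space X] (h : M.IsExpansion a f) {x : X} (hx : x ∉ M.S) :
    AnalyticAt ℂ (f ∘ (chartAt ℂ x).symm) (chartAt ℂ x x) :=
  analyticAt_comp_chart_symm (IsManifold.chart_mem_maximalAtlas x) (mem_chart_source ℂ x)
    (h.mdifferentiableAt_eventually hx)

theorem eventually_zero_or_ne_zero [T1Space X] [ConnectedSpace X] (h : M.IsExpansion a f) :
    (∀ x, ∀ᶠ y in 𝓝[≠] x, f y = 0) ∨ (∀ x, ∀ᶠ y in 𝓝[≠] x, f y ≠ 0) := by
  refine CurveKernel.eventually_zero_or_ne_zero fun x => ?_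
  by_cases hx : x ∈ M.S
  · refine ⟨M.coord ⟨x, hx⟩, M.mem_coord_source ⟨x, hx⟩, ?_⟩
    rw [M.coord_apply ⟨x, hx⟩]
    exact (h.2 ⟨x, hx⟩).meromorphicAt
  · exact ⟨chartAt ℂ x, mem_chart_source ℂ x, (h.analyticAt hx).meromorphicAt⟩

theorem eq_zero (h : M.IsExpansion a f) (h0 : ∀ x, ∀ᶠ y in 𝓝[≠] x, f y = 0) : a = 0 :=
  funext fun s => (h.2 s).eq_zero ((M.eventually_coord s fun y => f y = 0).2 (h0 s))

theorem eventually_ne_zero [T1Space X] [ConnectedSpace X] (h : M.IsExpansion a f) (ha : a ≠ 0)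
    (x : X) : ∀ᶠ y in 𝓝[≠] x, f y ≠ 0 :=
  (h.eventually_zero_or_ne_zero.resolve_left fun h0 => ha (h.eq_zero h0)) x

theorem eventually_eq_zero [T1Space X] [ConnectedSpace X] (h : M.IsExpansion 0 f) (hS : M.S.Nonempty)
    (x : X) : ∀ᶠ y in 𝓝[≠] x, f y = 0 := by
  refine (h.eventually_zero_or_ne_zero.resolve_right fun h0 => ?_) x
  obtain ⟨s, hs⟩ := hS
  have := nhdsNE_neBot_of_chart s
  have h1 := (M.eventually_coord ⟨s, hs⟩ fun y => f y = 0).1 (h.2 ⟨s, hs⟩).eventually_eq_zero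
  obtain ⟨y, hy, hy'⟩ := (h1.and (h0 s)).exists
  exact hy' hy

theorem apply_ne_zero [T1Space X] [ConnectedSpace X] (h : M.IsExpansion a f) (ha : a ≠ 0)
    (s : M.S) : a s ≠ 0 := by
  intro h0
  have := nhdsNE_neBot_of_chart (s : X)
  have h1 := h.2 s
  rw [h0] at h1
  obtain ⟨y, hy, hy'⟩ := (((M.eventually_coord s fun y => f y = 0).1 h1.eventually_eq_zero).and
    (h.eventually_ne_zero ha s)).exists
  exact hy' hy

end IsExpansion

/-- Removal of the singularities outside `S`. -/
theorem exists_isExpansion [T1Space X] {c : M.K} {F : X → ℂ}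
    (hreg : ∀ x ∉ M.S, ∃ k : ℂ → ℂ, AnalyticAt ℂ k (chartAt ℂ x x) ∧
      (F ∘ (chartAt ℂ x).symm) =ᶠ[𝓝[≠] (chartAt ℂ x x)] k)
    (hexp : ∀ s, HasLaurentExpansion (F ∘ (M.coord s).symm) (c s)) :
    ∃ f, M.IsExpansion c f ∧ ∀ x ∉ M.S, ∀ k : ℂ → ℂ, AnalyticAt ℂ k (chartAt ℂ x x) →
      (F ∘ (chartAt ℂ x).symm) =ᶠ[𝓝[≠] (chartAt ℂ x x)] k →
      (f ∘ (chartAt ℂ x).symm) =ᶠ[𝓝 (chartAt ℂ x x)] k := by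
  have hlim : ∀ x l, Tendsto F (𝓝[≠] x) (𝓝 l) → limUnder (𝓝[≠] x) F = l := fun x l h => by
    have := nhdsNE_neBot_of_chart x
    exact h.limUnder_eq
  have hfar : ∀ (e : OpenPartialHomeomorph X ℂ) (x : X), x ∈ e.source → ∀ k : ℂ → ℂ,
      ContinuousAt k (e x) → (F ∘ e.symm) =ᶠ[𝓝[≠] (e x)] k →
      limUnder (𝓝[≠] x) F = k (e x) := by
    intro e x hx k hk h
    refine hlim x _ ?_
    have h1 : Tendsto (fun y => k (e y)) (𝓝[≠] x) (𝓝 (k (e x))) :=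
      (ContinuousAt.comp (f := e) hk (e.continuousAt hx)).tendsto.mono_left nhdsWithin_le_nhds
    refine h1.congr' ?_
    have h2 := (eventually_punctured_chart e hx fun y => F y = k (e y)).1 (by
      filter_upwards [h, (e.open_target.eventually_mem (e.map_source hx)).filter_mono
        nhdsWithin_le_nhds] with z h1 h2
      rw [e.right_inv h2]
      exact h1)
    filter_upwards [h2] with y hy
    exact hy.symm
  have hloc : ∀ x ∉ M.S, ∀ k : ℂ → ℂ, AnalyticAt ℂ k (chartAt ℂ x x) →
      (F ∘ (chartAt ℂ x).symm) =ᶠ[𝓝[≠] (chartAt ℂ x x)] k →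
      ((fun y => limUnder (𝓝[≠] y) F) ∘ (chartAt ℂ x).symm) =ᶠ[𝓝 (chartAt ℂ x x)] k := by
    intro x _ k hk h
    have h2 := eventually_nhdsWithin_iff.1 (eventually_eventually_nhdsWithin.2 h)
    have ht := (chartAt ℂ x).open_target.eventually_mem
      ((chartAt ℂ x).map_source (mem_chart_source ℂ x))
    filter_upwards [h2, ht, hk.eventually_analyticAt] with z hz hzt hkz
    have hzz : ∀ᶠ w in 𝓝[≠] z, (F ∘ (chartAt ℂ x).symm) w = k w := by
      by_cases h0 : z = chartAt ℂ x x
      · rw [h0]; exact h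
      · have := hz h0
        rw [IsOpen.nhdsWithin_eq isOpen_compl_singleton h0] at this
        exact this.filter_mono nhdsWithin_le_nhds
    have hr := (chartAt ℂ x).right_inv hzt
    have := hfar (chartAt ℂ x) ((chartAt ℂ x).symm z) ((chartAt ℂ x).map_target hzt) k
      (by rw [hr]; exact hkz.continuousAt) (by rw [hr]; exact hzz)
    rw [hr] at this
    exact this
  -- The extension takes at each point the limit of `F` along the punctured neighbourhood. At points
  -- of `S` the limit may fail to exist; the value there is irrelevant.
  refine ⟨fun x => limUnder (𝓝[≠] x) F, ⟨fun x hx => ?_, fun s => ?_⟩, hloc⟩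
  · obtain ⟨k, hk, h⟩ := hreg x hx
    have h1 := hloc x hx k hk h
    have hc : chartAt ℂ x ∈ IsManifold.maximalAtlas 𝓘(ℂ, ℂ) (⊤ : WithTop ℕ∞) X :=
      IsManifold.chart_mem_maximalAtlas x
    have hmd : MDifferentiableAt 𝓘(ℂ, ℂ) 𝓘(ℂ, ℂ) (k ∘ chartAt ℂ x) x :=
      MDifferentiableAt.comp x hk.differentiableAt.mdifferentiableAt
        (mdifferentiableAt_chart hc (mem_chart_source ℂ x))
    refine MDifferentiableAt.mdifferentiableWithinAt (hmd.congr_of_eventuallyEq ?_)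
    refine ((chartAt ℂ x).eventually_nhds' (fun y => limUnder (𝓝[≠] y) F = (k ∘ chartAt ℂ x) y)
      (mem_chart_source ℂ x)).1 ?_
    filter_upwards [h1, (chartAt ℂ x).open_target.eventually_mem
      ((chartAt ℂ x).map_source (mem_chart_source ℂ x))] with z h1 h2
    rw [Function.comp_apply, (chartAt ℂ x).right_inv h2]
    exact h1
  · refine (hexp s).congr ?_
    have ht := (M.coord s).open_target.eventually_mem
      ((M.coord s).map_source (M.mem_coord_source s))
    rw [M.coord_apply] at ht
    filter_upwards [(hexp s).meromorphicAt.eventually_continuousAt,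
      ht.filter_mono nhdsWithin_le_nhds] with z hz hzt
    have hr := (M.coord s).right_inv hzt
    have := hfar (M.coord s) ((M.coord s).symm z) ((M.coord s).map_target hzt)
      (F ∘ (M.coord s).symm) (by rw [hr]; exact hz) (Eventually.of_forall fun _ => rfl)
    rw [hr] at this
    exact this.symm

variable (M) in
/-- The function `df / om`. -/
def ratioDeriv (f : X → ℂ) (x : X) : ℂ :=
  let T : ℂ →L[ℂ] ℂ := mfderiv 𝓘(ℂ, ℂ) 𝓘(ℂ, ℂ) f x
  let om' : ℂ →L[ℂ] ℂ := M.om x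
  T 1 / om' 1

/-- In dimension one, `df` and `ω` have the same ratio on every vector not killed by `ω`, so the
coordinate vector of any chart computes `df/ω`. -/
theorem ratioDeriv_chart_symm {a : M.K} {f : X → ℂ} [T1Space X] (h : M.IsExpansion a f)
    {e : OpenPartialHomeomorph X ℂ} (he : e ∈ IsManifold.maximalAtlas 𝓘(ℂ, ℂ) (⊤ : WithTop ℕ∞) X)
    {z : ℂ} (hz : z ∈ e.target) (hS : e.symm z ∉ M.S) (hd : localDensity M.om e z ≠ 0) :
    M.ratioDeriv f (e.symm z) = deriv (f ∘ e.symm) z / localDensity M.om e z := by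
  rw [deriv_comp_chart_symm he hz (h.mdifferentiableAt_eventually hS).self_of_nhds]
  rw [localDensity] at hd ⊢
  let om' : ℂ →L[ℂ] ℂ := M.om (e.symm z)
  let T : ℂ →L[ℂ] ℂ := mfderiv 𝓘(ℂ, ℂ) 𝓘(ℂ, ℂ) f (e.symm z)
  let V : ℂ →L[ℂ] ℂ := mfderiv 𝓘(ℂ, ℂ) 𝓘(ℂ, ℂ) e.symm z
  let v : ℂ := V 1
  change om' v ≠ 0 at hd
  change T 1 / om' 1 = T v / om' v
  have h1 : ∀ A : ℂ →L[ℂ] ℂ, A v = v * A 1 := fun A => by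
    rw [← smul_eq_mul, ← map_smul, smul_eq_mul, mul_one]
  rw [h1] at hd
  rw [h1 T, h1 om', mul_div_mul_left _ _ (left_ne_zero_of_mul hd)]

/-- `R` is stable under `∂`. -/
theorem IsExpansion.exists_del [T1Space X] {a : M.K} {f : X → ℂ} (h : M.IsExpansion a f) :
    ∃ f', M.IsExpansion (fun s => M.del s (a s)) f' ∧ ∀ x ∉ M.S, ∃ k : ℂ → ℂ,
      AnalyticAt ℂ k (chartAt ℂ x x) ∧ k (chartAt ℂ x x) ≠ 0 ∧
      (f' ∘ (chartAt ℂ x).symm) =ᶠ[𝓝 (chartAt ℂ x x)]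
        fun z => k z * deriv (f ∘ (chartAt ℂ x).symm) z := by
  have hk : ∀ x ∉ M.S, ∃ k : ℂ → ℂ, AnalyticAt ℂ k (chartAt ℂ x x) ∧ k (chartAt ℂ x x) ≠ 0 ∧
      (M.ratioDeriv f ∘ (chartAt ℂ x).symm) =ᶠ[𝓝[≠] (chartAt ℂ x x)]
        fun z => k z * deriv (f ∘ (chartAt ℂ x).symm) z := by
    intro x hx
    obtain ⟨d, hd, hd0, hd1⟩ := M.exists_density_eq hx
    -- Outside `S` the density `d` is a unit, so `∂` is `d/dz` times a unit; this controls orders of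
    -- vanishing under `∂`.
    refine ⟨fun z => (d z)⁻¹, hd.inv hd0, inv_ne_zero hd0, ?_⟩
    have hxs := mem_chart_source ℂ x
    have hS := ((chartAt ℂ x).eventually_nhds' _ hxs).2 (M.notMem_S_eventually hx)
    filter_upwards [hd1, hS.filter_mono nhdsWithin_le_nhds,
      ((chartAt ℂ x).open_target.eventually_mem ((chartAt ℂ x).map_source hxs)).filter_mono
        nhdsWithin_le_nhds, (hd.continuousAt.eventually_ne hd0).filter_mono nhdsWithin_le_nhds]
      with z h1 h2 h3 h4
    rw [Function.comp_apply, ratioDeriv_chart_symm h (IsManifold.chart_mem_maximalAtlas x) h3 h2 (by rwa [h1]), h1,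
      div_eq_inv_mul]
  obtain ⟨f', hf', hf''⟩ := exists_isExpansion (c := fun s => M.del s (a s)) (F := M.ratioDeriv f)
    (fun x hx => by
      obtain ⟨k, h1, _, h3⟩ := hk x hx
      exact ⟨_, h1.mul (h.analyticAt hx).deriv, h3⟩)
    (fun s => by
      refine (M.hasLaurentExpansion_density s).of_mul (h.2 s).deriv (M.density_ne_zero s) ?_
      have ht := (M.coord s).open_target.eventually_mem
        ((M.coord s).map_source (M.mem_coord_source s))
      rw [M.coord_apply] at ht
      have hne : ∀ᶠ z in 𝓝[≠] (0 : ℂ), localDensity M.om (M.coord s) z ≠ 0 := by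
        refine (M.hasLaurentExpansion_density s).meromorphicAt
          |>.eventually_eq_zero_or_eventually_ne_zero |>.resolve_left fun h0 => ?_
        exact M.density_ne_zero s ((M.hasLaurentExpansion_density s).eq_zero h0)
      filter_upwards [ht.filter_mono nhdsWithin_le_nhds, hne, (M.eventually_coord s _).2
        (M.notMem_S_eventually_punctured (s : X))] with z h1 h2 h3
      rw [Function.comp_apply, ratioDeriv_chart_symm h (M.coord_mem_atlas s) h1 h3 h2, mul_div_cancel₀ _ h2])
  refine ⟨f', hf', fun x hx => ?_⟩
  obtain ⟨k, h1, h2, h3⟩ := hk x hx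
  exact ⟨k, h1, h2, hf'' x hx _ (h1.mul (h.analyticAt hx).deriv) h3⟩

theorem del_mem_R [T1Space X] {a : M.K} (ha : a ∈ M.R) : (fun s => M.del s (a s)) ∈ M.R := by
  obtain ⟨f, hf⟩ := mem_R_iff.1 ha
  obtain ⟨f', hf', -⟩ := hf.exists_del
  exact hf'.mem_R

theorem mul_mem_R {a b : M.K} (ha : a ∈ M.R) (hb : b ∈ M.R) : a * b ∈ M.R := by
  obtain ⟨f, hf⟩ := mem_R_iff.1 ha
  obtain ⟨g, hg⟩ := mem_R_iff.1 hb
  exact (hf.mul hg).mem_R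

theorem const_mem_R (c : ℂ) : (fun _ => HahnSeries.C c : M.K) ∈ M.R :=
  mem_R_iff.2 ⟨fun _ => c, mdifferentiableOn_const, fun _ => hasLaurentExpansion_const c⟩

/-- A nonzero `∂`-stable space of regular functions has no common zero outside `S`. -/
theorem exists_apply_ne_zero [T1Space X] [ConnectedSpace X] {J : Set M.K}
    (hdel : ∀ j ∈ J, (fun s => M.del s (j s)) ∈ J) {x : X} (hx : x ∉ M.S) :
    ∀ {j : M.K} {f : X → ℂ}, j ∈ J → j ≠ 0 → M.IsExpansion j f →
      ∃ j' ∈ J, ∃ f', M.IsExpansion j' f' ∧ f' x ≠ 0 := by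
  -- Induction on the order of vanishing at `x`, which `∂` lowers by exactly one as long as it is
  -- positive.
  have key : ∀ (n : ℕ) (j : M.K) (f : X → ℂ), j ∈ J → M.IsExpansion j f →
      analyticOrderAt (f ∘ (chartAt ℂ x).symm) (chartAt ℂ x x) = n →
      ∃ j' ∈ J, ∃ f', M.IsExpansion j' f' ∧ f' x ≠ 0 := by
    intro n
    induction n with
    | zero =>
      intro j f hj hf hn
      refine ⟨j, hj, f, hf, ?_⟩
      have := (hf.analyticAt hx).analyticOrderAt_eq_zero.1 (by simpa using hn)
      rwa [Function.comp_apply, (chartAt ℂ x).left_inv (mem_chart_source ℂ x)] at this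
    | succ n ih =>
      intro j f hj hf hn
      obtain ⟨f', hf', hk⟩ := hf.exists_del
      obtain ⟨k, h1, h2, h3⟩ := hk x hx
      refine ih _ f' (hdel j hj) hf' ?_
      rw [analyticOrderAt_congr h3]
      have h4 := analyticOrderAt_mul h1 (hf.analyticAt hx).deriv
      rw [h1.analyticOrderAt_eq_zero.2 h2, zero_add,
        analyticOrderAt_deriv_of_pos (hf.analyticAt hx) (n := n) (by rw [hn]; push_cast; rfl)] at h4
      exact h4
  intro j f hj h0 hf
  have hne : analyticOrderAt (f ∘ (chartAt ℂ x).symm) (chartAt ℂ x x) ≠ ⊤ := by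
    rw [Ne, analyticOrderAt_eq_top]
    intro h
    obtain ⟨z, h1, h2⟩ := ((h.filter_mono nhdsWithin_le_nhds).and
      ((eventually_punctured_chart _ (mem_chart_source ℂ x) _).2
        (hf.eventually_ne_zero h0 x))).exists
    exact h2 h1
  obtain ⟨n, hn⟩ := ENat.ne_top_iff_exists.1 hne
  exact key n j f hj hf hn.symm

/-- If `j a ∈ u R` for all `j` in a nonzero `∂`-stable set, then `a ∈ u R`. -/
theorem exists_eq_mul [T1Space X] [ConnectedSpace X] {J : Set M.K} (hJR : ∀ j ∈ J, j ∈ M.R)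
    (hdel : ∀ j ∈ J, (fun s => M.del s (j s)) ∈ J) {u a : M.K} (hu : u ∈ J) (hu0 : u ≠ 0)
    (ha : a ∈ M.R) (hdiv : ∀ j ∈ J, ∃ b ∈ M.R, a * j = u * b) : ∃ h ∈ M.R, a = u * h := by
  have hS : M.S.Nonempty := by
    by_contra hS
    refine hu0 (funext fun s => absurd ⟨s.1, s.2⟩ hS)
  obtain ⟨fu, hfu⟩ := mem_R_iff.1 (hJR u hu)
  obtain ⟨fa, hfa⟩ := mem_R_iff.1 ha
  obtain ⟨F, hF, -⟩ := exists_isExpansion (c := fun s => (u s)⁻¹ * a s)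
    (F := fun x => fa x / fu x) (fun x hx => by
      -- For `j` not vanishing at `x`, the relation `aj = ub` gives `a/u = b/j` near `x`, and the
      -- right side is regular at `x`.
      obtain ⟨j, hj, f, hf, hfx⟩ := exists_apply_ne_zero hdel hx hu hu0 hfu
      obtain ⟨b, hb, hab⟩ := hdiv j hj
      obtain ⟨fb, hfb⟩ := mem_R_iff.1 hb
      have h0 := (hfa.mul hf).sub (hfu.mul hfb)
      rw [sub_eq_zero.2 hab] at h0
      have h1 := (eventually_punctured_chart (chartAt ℂ x) (mem_chart_source ℂ x) _).2
        ((h0.eventually_eq_zero hS x).and (hfu.eventually_ne_zero hu0 x))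
      have hfx' : (f ∘ (chartAt ℂ x).symm) (chartAt ℂ x x) ≠ 0 := by
        rwa [Function.comp_apply, (chartAt ℂ x).left_inv (mem_chart_source ℂ x)]
      refine ⟨_, (hfb.analyticAt hx).div (hf.analyticAt hx) hfx', ?_⟩
      filter_upwards [h1, ((hf.analyticAt hx).continuousAt.eventually_ne hfx').filter_mono
        nhdsWithin_le_nhds] with z h2 h3
      obtain ⟨h2, h4⟩ := h2
      simp only [Function.comp_apply, Pi.div_apply] at h3 ⊢
      rw [div_eq_div_iff h4 h3]
      linear_combination h2)
    (fun s => by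
      refine (hfu.2 s).of_mul (hfa.2 s) (hfu.apply_ne_zero hu0 s) ?_
      filter_upwards [(M.eventually_coord s _).2 (hfu.eventually_ne_zero hu0 s)] with z hz
      exact mul_div_cancel₀ _ hz)
  refine ⟨_, hF.mem_R, funext fun s => ?_⟩
  exact (mul_inv_cancel_left₀ (hfu.apply_ne_zero hu0 s) _).symm

end MarkedCurve

end CurveKernel

namespace CurveKernel

/-! ### The residue theorem

The subspace `R` is isotropic. -/

/-- In the Artinian ring `A/I` every prime is maximal. A maximal ideal containing the image of `J`
is thus minimal over the zero annihilator, hence an associated prime; `a` lifts an element whose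
annihilator it is. -/
theorem exists_notMem_mul_mem_of_isArtinianRing_quotient {A : Type*} [CommRing A] {I J : Ideal A}
    [IsArtinianRing (A ⧸ I)] (hIJ : I ≤ J) (hJ : J ≠ ⊤) :
    ∃ a ∉ I, ∀ j ∈ J, a * j ∈ I := by
  obtain ⟨m, hm, hJm⟩ := J.exists_le_maximal hJ
  have hIm : I ≤ m := hIJ.trans hJm
  let q := Ideal.Quotient.mk I
  have hmax : (m.map q).IsMaximal := by
    refine (Ideal.map_eq_top_or_isMaximal_of_surjective q Ideal.Quotient.mk_surjective hm).resolve_left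
      fun h => hm.ne_top ?_
    have := congrArg (Ideal.comap q) h
    rwa [Ideal.comap_map_of_surjective q Ideal.Quotient.mk_surjective, Ideal.comap_top,
      ← RingHom.ker_eq_comap_bot, Ideal.mk_ker, sup_eq_left.2 hIm] at this
  have hmin : m.map q ∈ (Module.annihilator (A ⧸ I) (A ⧸ I)).minimalPrimes := by
    refine ⟨⟨hmax.isPrime, ?_⟩, fun p ⟨hp, _⟩ hpm => ?_⟩
    · rw [Module.annihilator_eq_bot.2 inferInstance]
      exact bot_le
    · have : p.IsMaximal := IsArtinianRing.isMaximal_of_isPrime p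
      exact (this.eq_of_le hmax.ne_top hpm).ge
  obtain ⟨_, b, hb⟩ := isAssociatedPrime_iff.1
    (Module.associatedPrimes.minimalPrimes_annihilator_subset_associatedPrimes _ _ hmin)
  obtain ⟨a, rfl⟩ := Ideal.Quotient.mk_surjective b
  refine ⟨a, fun ha => hmax.ne_top ?_, fun j hj => ?_⟩
  · rw [hb, Ideal.Quotient.eq_zero_iff_mem.2 ha, Ideal.eq_top_iff_one, Submodule.mem_colon_singleton]
    simp
  · have h : q j ∈ m.map q := Ideal.mem_map_of_mem q (hJm hj)
    rw [hb, Submodule.mem_colon_singleton, Submodule.mem_bot, smul_eq_mul, ← map_mul] at h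
    rw [mul_comm]
    exact Ideal.Quotient.eq_zero_iff_mem.1 h

namespace MarkedCurve

variable {X : Type*} [TopologicalSpace X] [ChartedSpace ℂ X]
  [IsManifold 𝓘(ℂ, ℂ) (⊤ : WithTop ℕ∞) X] (M : MarkedCurve X)

/-- The subspace `R` as a ring. -/
def regularRing [T1Space X] : Subring M.K where
  carrier := M.R
  mul_mem' := mul_mem_R
  one_mem' := const_mem_R 1
  add_mem' := M.R.add_mem
  zero_mem' := M.R.zero_mem
  neg_mem' := M.R.neg_mem

instance [T1Space X] : Algebra ℂ M.regularRing :=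
  RingHom.toAlgebra <| RingHom.codRestrict
    (RingHom.pi fun _ => (HahnSeries.C : ℂ →+* Laurent ℂ)) M.regularRing const_mem_R

theorem coe_smul_regularRing [T1Space X] (c : ℂ) (a : M.regularRing) :
    ((c • a : M.regularRing) : M.K) = c • (a : M.K) := by
  rw [Algebra.smul_def]
  funext s
  exact HahnSeries.C_mul_eq_smul

/-- The elements of `R` orthogonal to `R`. -/
def radical [T1Space X] : Ideal M.regularRing where
  carrier := {f | ∀ g ∈ M.R, M.pairing f g = 0}
  add_mem' := fun ha hb g hg => by
    rw [Subring.coe_add, pairing_add_left, ha g hg, hb g hg, add_zero]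
  zero_mem' := fun g _ => by simp [pairing]
  smul_mem' := fun c f hf g hg => by
    rw [smul_eq_mul, mul_comm, Subring.coe_mul, pairing_mul_left]
    exact hf _ (mul_mem_R c.2 hg)

end MarkedCurve

namespace DualBases

variable {X : Type*} [TopologicalSpace X] [ChartedSpace ℂ X]
  [IsManifold 𝓘(ℂ, ℂ) (⊤ : WithTop ℕ∞) X] {M : MarkedCurve X} {L : LagrangianComplement M}

/-- For `x ∈ R` put `y = x/u`. Then `x = uπ(y) + u(y - π(y))`, with `π` the projection to `R`, and
the last term lies in `uΛ`, hence in a fixed lattice. Modulo a lattice inside `Λ`, which `π` kills,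
it ranges over a finite-dimensional space. -/
theorem finite_quotient_span [T1Space X] (E : DualBases M L) (u : M.regularRing)
    (hu : ∀ s, (u : M.K) s ≠ 0) : Module.Finite ℂ (M.regularRing ⧸ Ideal.span {u}) := by
  obtain ⟨N₀, h₀⟩ := E.exists_latt_le
  obtain ⟨N₁, h₁⟩ := L.exists_le_latt
  obtain ⟨N₂, h₂⟩ := M.exists_mem_latt u
  obtain ⟨F, hF, -, hsup⟩ := M.latt_le_fg_sup M.density_ne_zero (N₂ + N₁) N₀
  have : Module.Finite ℂ F := Module.Finite.iff_fg.2 hF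
  let φ : F →ₗ[ℂ] M.regularRing :=
    { toFun := fun f => ⟨L.prR f, L.prR_mem f⟩
      map_add' := fun f g => Subtype.ext (map_add L.prR (f : M.K) g)
      map_smul' := fun c f => Subtype.ext <| by
        rw [M.coe_smul_regularRing]
        exact map_smul L.prR c (f : M.K) }
  refine Module.Finite.of_surjective
    ((Ideal.Quotient.mkₐ ℂ (Ideal.span {u})).toLinearMap ∘ₗ φ) fun x => ?_
  obtain ⟨x, rfl⟩ := Ideal.Quotient.mk_surjective x
  let y : M.K := fun s => ((u : M.K) s)⁻¹ * (x : M.K) s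
  have hxy : (x : M.K) = u * L.prR y + u * (y - L.prR y) := by
    rw [← mul_add, add_sub_cancel]
    funext s
    exact (mul_inv_cancel_left₀ (hu s) _).symm
  obtain ⟨f, hf, l, hl, hfl⟩ := Submodule.mem_sup.1
    (hsup (M.mul_mem_latt h₂ (h₁ (L.sub_prR_mem y))))
  refine ⟨⟨f, hf⟩, ?_⟩
  refine (Ideal.Quotient.eq (I := Ideal.span {u})).2 ?_
  rw [← neg_mem_iff, Ideal.mem_span_singleton]
  refine ⟨⟨L.prR y, L.prR_mem y⟩, Subtype.ext ?_⟩
  have h3 := congrArg L.prR hxy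
  rw [← hfl, L.prR_of_mem x.2, map_add, map_add, L.prR_eq_zero (h₀ hl), add_zero,
    L.prR_of_mem (MarkedCurve.mul_mem_R u.2 (L.prR_mem y))] at h3
  show -(L.prR f - (x : M.K)) = u * L.prR y
  rw [h3]
  ring

/-- If `∂` killed `R`, all expansions would be constant and `R` would embed in `ℂ^S`, against its
infinite basis. -/
theorem exists_del_ne_zero [T1Space X] (E : DualBases M L) :
    ∃ a ∈ M.R, (fun s => M.del s (a s)) ≠ 0 := by
  by_contra! h
  have h0 : ∀ a ∈ M.R, ∀ s, ∀ n : ℤ, n ≠ 0 → (a s).coeff n = 0 := by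
    intro a ha s n hn
    have h1 : (M.density s)⁻¹ * LaurentSeries.derivative ℂ (a s) = 0 := congrFun (h a ha) s
    have h2 := (mul_eq_zero.1 h1).resolve_left (inv_ne_zero (M.density_ne_zero s))
    have h3 := congrArg (fun f => HahnSeries.coeff f (n - 1)) h2
    simp only [coeff_derivative, sub_add_cancel, HahnSeries.coeff_zero, zsmul_eq_mul,
      mul_eq_zero] at h3
    exact h3.resolve_left (by exact_mod_cast hn)
  let φ : M.R →ₗ[ℂ] (M.S → ℂ) :=
    { toFun := fun a s => ((a : M.K) s).coeff 0
      map_add' := fun a b => rfl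
      map_smul' := fun c a => rfl }
  have hφ : Function.Injective φ := by
    rw [injective_iff_map_eq_zero]
    intro a ha
    refine Subtype.ext (funext fun s => HahnSeries.ext (funext fun n => ?_))
    rcases eq_or_ne n 0 with rfl | hn
    · exact congrFun ha s
    · exact h0 a a.2 s n hn
  have : Module.Finite ℂ M.R := Module.Finite.of_injective φ hφ
  have := Module.Finite.finite_basis E.up
  exact not_finite ℕ

/-- The sum of the residues of `a b om` vanishes for `a, b` in `R`. -/
theorem pairing_R_eq_zero [T1Space X] [ConnectedSpace X] (E : DualBases M L) {a b : M.K} (ha : a ∈ M.R)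
    (hb : b ∈ M.R) : M.pairing a b = 0 := by
  have hdel : ∀ f ∈ M.R, ∀ g ∈ M.R, M.pairing (fun s => M.del s (f s)) g = 0 := by
    intro f hf g hg
    rw [M.pairing_comm]
    exact E.pairing_derivation M.density_ne_zero (fun _ h _ => MarkedCurve.mul_mem_R h) hg hf
  obtain ⟨g, hg, hu0⟩ := E.exists_del_ne_zero
  let u : M.regularRing := ⟨_, MarkedCurve.del_mem_R hg⟩
  have huJ : u ∈ M.radical := hdel g hg
  have hus : ∀ s, (u : M.K) s ≠ 0 := by
    obtain ⟨f, hf⟩ := MarkedCurve.mem_R_iff.1 u.2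
    exact hf.apply_ne_zero hu0
  have := E.finite_quotient_span u hus
  have : IsArtinianRing (M.regularRing ⧸ Ideal.span {u}) := IsArtinianRing.of_finite ℂ _
  suffices h : M.radical = ⊤ by
    have : (⟨a, ha⟩ : M.regularRing) ∈ M.radical := by rw [h]; trivial
    exact this b hb
  by_contra hJ
  -- If the radical were proper, some `h ∉ (u)` would multiply it into `(u)`. The radical contains
  -- `∂R` and is therefore `∂`-stable, so `exists_eq_mul` puts `h` in `(u)`.
  obtain ⟨h, hh, hdiv⟩ := exists_notMem_mul_mem_of_isArtinianRing_quotient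
    ((Ideal.span_singleton_le_iff_mem _).2 huJ) hJ
  refine hh (Ideal.mem_span_singleton.2 ?_)
  obtain ⟨r, hr, hr'⟩ := MarkedCurve.exists_eq_mul
    (J := {f | f ∈ M.R ∧ ∀ g ∈ M.R, M.pairing f g = 0}) (u := u) (a := h)
    (fun j hj => hj.1) (fun j hj => ⟨MarkedCurve.del_mem_R hj.1, hdel j hj.1⟩) ⟨u.2, huJ⟩ hu0 h.2
    (fun j hj => by
      obtain ⟨b, hb⟩ := Ideal.mem_span_singleton.1 (hdiv ⟨j, hj.1⟩ hj.2)
      exact ⟨b, b.2, congrArg Subtype.val hb⟩)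
  exact ⟨⟨r, hr⟩, Subtype.ext hr'⟩

end DualBases

end CurveKernel

end

theorem mainTheorem4 {X : Type*} [TopologicalSpace X] [T2Space X] [CompactSpace X]
    [ConnectedSpace X] [ChartedSpace ℂ X] [IsManifold 𝓘(ℂ, ℂ) (⊤ : WithTop ℕ∞) X]
    (M : CurveKernel.MarkedCurve X) (L : CurveKernel.LagrangianComplement M)
    (E : CurveKernel.DualBases M L)
    (tau : ℕ → M.R ⊗[ℂ] M.R) (htau : E.IsTau tau) (s : M.S) :
    M.VanishesAt s (-1) (E.structureFunction tau s s) ∧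
      M.VanishesAt s 1 (E.structureFunction tau s s)⁻¹ := by
  exact E.vanishesAt_of_green s (M.density_ne_zero s) (E.greenReg_mem M.density_ne_zero s)
    (E.zw_mul_green s) (E.diag_greenReg M.density_ne_zero
      (fun _ ha _ hb => E.pairing_R_eq_zero ha hb) s) tau
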